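/- Let $M$ be a complex surface with complex structure $J$. A torsion-free affine connection $\nabla$ on $TM$ is complex-linear if $\nabla J=0$; its generalised geodesics are the smoothly immersed curves $\gamma$ with $\nabla_{\dot\gamma}\dot\gamma\in\mathrm{span}_{\mathbb R}(\dot\gamma,J\dot\gamma)$. A complex projective structure $[\nabla]$ is the class of complex-linear torsion-free connections with the same generalised geodesics as a given one $\nabla$. A (pseudo-)Kähler metric on an open set $V\subset M$ is compatible with $[\nabla]$ if its Levi-Civita connection is complex-linear and has the same generalised geodesics in $V$ as $\nabla$. In holomorphic coordinates $z=(z^1,z^2)$ let $\nabla_{\partial_{z^j}}\partial_{z^k}=\Gamma^i_{jk}\partial_{z^i}$ and $$\Pi^i_{jk}=\Gamma^i_{jk}-\tfrac13(\Gamma^l_{lj}\delta^i_k+\Gamma^l_{lk}\delta^i_j),\qquad \Pi_{ij}=\Pi^k_{il}\Pi^l_{jk}-\frac{\partial\Pi^k_{ij}}{\partial z^k}.$$ Let $P\subset\mathrm{PSL}(3,\mathbb C)$ be the stabiliser of $[1,0,0]^t\in\mathbb{CP}^2$. The Cartan geometry of $(M,J,[\nabla])$ is the (up to isomorphism unique)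 real Cartan geometry $(\pi:B\to M,\theta)$ of type $(\mathrm{PSL}(3,\mathbb C),P)$, $\theta=(\theta^i_j)_{i,j=0,1,2}$, such that every holomorphic coordinate system $z$ on $M$ admits a section $\sigma_z$ of $B$ over its domain with, for $i,j\in\{1,2\}$, $$\sigma_z^*\theta^0_0=0,\quad \sigma_z^*\theta^i_0=dz^i,\quad \sigma_z^*\theta^i_j=\Pi^i_{jk}\,dz^k,\quad \sigma_z^*\theta^0_i=\Pi_{ik}\,dz^k .$$ Its curvature $\Theta=d\theta+\theta\wedge\theta$ has components $\Theta^0_i=L_i\,\theta^1_0\wedge\theta^2_0+K_{il\bar\jmath}\,\theta^l_0\wedge\overline{\theta^j_0}$ and $\Theta^i_k=W^i_{kl\bar\jmath}\,\theta^l_0\wedge\overline{\theta^j_0}$ for $i,k\in\{1,2\}$, which defines the functions $K_{il\bar\jmath}$ and $W^i_{kl\bar\jmath}$ on $B$. Let $\varepsilon_{ij}$ be the antisymmetric matrix with $\varepsilon_{12}=1$ and $\varepsilon^{ij}$ its inverse matrix. Lower case indices in sums run over $1,2$. **Theorem.** Let $U\subset B$ be a connected open set on which there are smooth complex-valued functions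 $h_{i\bar\jmath}=\overline{h_{j\bar\imath}}$ and $h_i$ and a smooth real-valued function $h$ that satisfy the rank $9$ linear system $$\begin{aligned} dh_{i\bar\jmath}&=2h_{i\bar\jmath}\,\mathrm{Re}(\theta^0_0)+h_{i\bar s}\overline{\theta^s_j}+h_{s\bar\jmath}\theta^s_i+h_i\overline{\varepsilon_{sj}\theta^s_0}+\overline{h_j}\,\varepsilon_{si}\theta^s_0,\\ dh_k&=2\mathrm i\,h_k\,\mathrm{Im}(\theta^0_0)+h_l\theta^l_k+h_{k\bar\imath}\overline{\varepsilon^{ij}\theta^0_j}+\Big(\varepsilon_{kl}h-\tfrac12\overline{\varepsilon^{ij}}h_{s\bar\imath}W^s_{kl\bar\jmath}\Big)\theta^l_0,\\ dh&=-2h\,\mathrm{Re}(\theta^0_0)-2\varepsilon^{lk}\,\mathrm{Re}(h_l\theta^0_k)+\overline{\varepsilon^{ij}}\varepsilon^{kl}\,\mathrm{Re}(h_{k\bar\imath}K_{ls\bar\jmath}\theta^s_0), \end{aligned}$$ and $h_{1\bar1}h_{2\bar2}-|h_{1\bar2}|^2\neq0$ everywhere on $U$. Consider on $U$ the quadratic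 form $$g=\frac{h_{i\bar\jmath}\,\theta^i_0\circ\overline{\theta^j_0}}{(h_{1\bar1}h_{2\bar2}-|h_{1\bar2}|^2)^2}.$$ (a) Every point of $U$ has an open neighbourhood $U'\subset U$ such that $g|_{U'}$ is the $\pi$-pullback to $U'$ of a (pseudo-)Kähler metric on the open set $\pi(U')\subset M$ that is compatible with $[\nabla]$. (b) If the fibres $U\cap\pi^{-1}(x)$, $x\in M$, are connected (or empty), for instance if $U=\pi^{-1}(\pi(U))$, then $g$ is the $\pi$-pullback to $U$ of a (pseudo-)Kähler metric on the open set $\pi(U)\subset M$ that is compatible with $[\nabla]$. -/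

import Mathlib

open Set Filter Topology
open scoped Manifold ContDiff ComplexConjugate

noncomputable section

namespace CProj

/-- The model space `ℂ²` of complex surfaces. -/
abbrev CSq : Type := Fin 2 → ℂ

/-- A complex surface is in particular a smooth real manifold modelled on `ℂ² = ℝ⁴`. -/
instance realManifold {M : Type*} [TopologicalSpace M] [ChartedSpace CSq M]
    [IsManifold 𝓘(ℂ, CSq) ω M] : IsManifold 𝓘(ℝ, CSq) ∞ M := by
  refine isManifold_of_contDiffOn _ _ _ fun e e' he he' => ?_
  have h := (HasGroupoid.compatible (G := contDiffGroupoid ω 𝓘(ℂ, CSq)) he he')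
  rw [contDiffGroupoid, mem_groupoid_of_pregroupoid] at h
  have h1 : ContDiffOn ℂ ω (𝓘(ℂ, CSq) ∘ (e.symm.trans e') ∘ 𝓘(ℂ, CSq).symm)
    (𝓘(ℂ, CSq).symm ⁻¹' (e.symm.trans e').source ∩ range 𝓘(ℂ, CSq)) := h.1
  exact (h1.restrict_scalars ℝ).of_le le_top

section Surface

variable {M : Type*} [TopologicalSpace M] [ChartedSpace CSq M]

/-- Vector fields on (the real manifold underlying) a complex surface; no regularity is implied. -/
abbrev VField (M : Type*) [TopologicalSpace M] [ChartedSpace CSq M] : Type _ :=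
  (x : M) → TangentSpace 𝓘(ℝ, CSq) x

/-- The data of an affine connection: `cov Y x v` is `(∇_v Y)(x)`. -/
abbrev Conn (M : Type*) [TopologicalSpace M] [ChartedSpace CSq M] : Type _ :=
  VField M → (x : M) → TangentSpace 𝓘(ℝ, CSq) x →L[ℝ] TangentSpace 𝓘(ℝ, CSq) x

/-- Fields of symmetric bilinear forms on the tangent spaces (the symmetry is imposed later). -/
abbrev BilinField (M : Type*) [TopologicalSpace M] [ChartedSpace CSq M] : Type _ :=
  (x : M) → TangentSpace 𝓘(ℝ, CSq) x →L[ℝ] TangentSpace 𝓘(ℝ, CSq) x →L[ℝ] ℝ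

/-- The almost complex structure: multiplication by `i` in the holomorphic chart through which
the tangent space at `x` is identified with `ℂ²` (any other holomorphic chart gives the same). -/
def J (x : M) : TangentSpace 𝓘(ℝ, CSq) x →L[ℝ] TangentSpace 𝓘(ℝ, CSq) x :=
  (Complex.I • ContinuousLinearMap.id ℝ CSq : CSq →L[ℝ] CSq)

variable [IsManifold 𝓘(ℂ, CSq) ω M]

/-- Differentiability at a point of a vector field. -/
def DiffFieldAt (Y : VField M) (x : M) : Prop :=
  MDifferentiableAt 𝓘(ℝ, CSq) 𝓘(ℝ, CSq).tangent
    (fun y => (⟨y, Y y⟩ : TangentBundle 𝓘(ℝ, CSq) M)) x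

/-- Smoothness near a point of a vector field. -/
def SmoothFieldAt (Y : VField M) (x : M) : Prop :=
  ContMDiffAt 𝓘(ℝ, CSq) 𝓘(ℝ, CSq).tangent ∞
    (fun y => (⟨y, Y y⟩ : TangentBundle 𝓘(ℝ, CSq) M)) x

/-- `cov` is, over the open set `V`, a smooth torsion-free affine connection on `TM`
that is complex-linear, i.e. `∇J = 0`. -/
structure IsComplexLinearOn (cov : Conn M) (V : Set M) : Prop where
  isCov : IsCovariantDerivativeOn CSq cov V
  smooth : ContMDiffCovariantDerivativeOn CSq ∞ cov V
  torsion_free : ∀ x ∈ V, ∀ X Y : VField M, DiffFieldAt X x → DiffFieldAt Y x →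
    cov Y x (X x) - cov X x (Y x) = VectorField.mlieBracket 𝓘(ℝ, CSq) X Y x
  complex_linear : ∀ x ∈ V, ∀ Y : VField M, DiffFieldAt Y x →
    ∀ v, cov (fun y => J y (Y y)) x v = J x (cov Y x v)

/-- The velocity of a curve. -/
def velocity (γ : ℝ → M) (t : ℝ) : TangentSpace 𝓘(ℝ, CSq) (γ t) :=
  mfderiv 𝓘(ℝ, ℝ) 𝓘(ℝ, CSq) γ t (1 : ℝ)

/-- `γ : (a, b) → V` is a generalised geodesic: a smoothly immersed curve such that
`∇_γ' γ'` lies in the span of `γ'` and `Jγ'`. The value of `∇_γ' γ'` at `t` is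
`∇_X X` at `γ t`, for any local vector field `X` that extends `γ'` near `t`
(such extensions exist as `γ` is an immersion, and the value does not depend on the choice). -/
structure IsGeneralisedGeodesicOn (cov : Conn M) (V : Set M) (γ : ℝ → M) (a b : ℝ) : Prop where
  smooth : ContMDiffOn 𝓘(ℝ, ℝ) 𝓘(ℝ, CSq) ∞ γ (Ioo a b)
  mapsTo : MapsTo γ (Ioo a b) V
  immersed : ∀ t ∈ Ioo a b, velocity γ t ≠ 0
  planar : ∀ t ∈ Ioo a b, ∀ X : VField M, SmoothFieldAt X (γ t) →
    (∀ᶠ s in 𝓝 t, X (γ s) = velocity γ s) →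
    cov X (γ t) (velocity γ t) ∈
      Submodule.span ℝ {velocity γ t, J (γ t) (velocity γ t)}

/-- Complex projective equivalence over `V`: the same generalised geodesics. -/
def CProjEquivOn (cov cov' : Conn M) (V : Set M) : Prop :=
  ∀ (γ : ℝ → M) (a b : ℝ),
    IsGeneralisedGeodesicOn cov V γ a b ↔ IsGeneralisedGeodesicOn cov' V γ a b

/-- `g` is a (pseudo-)Riemannian metric over the open set `V`. Smoothness of the symmetric form
is smoothness of the function `v ↦ g(v, v)` on the tangent bundle. -/
structure IsMetricOn (g : BilinField M) (V : Set M) : Prop where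
  smooth : ContMDiffOn 𝓘(ℝ, CSq).tangent 𝓘(ℝ, ℝ) ∞
    (fun v : TangentBundle 𝓘(ℝ, CSq) M => g v.proj v.snd v.snd) {v | v.proj ∈ V}
  symm : ∀ x ∈ V, ∀ v w, g x v w = g x w v
  nondegenerate : ∀ x ∈ V, ∀ v, (∀ w, g x v w = 0) → v = 0

/-- `cov` is the Levi-Civita connection of `g` over `V`: torsion-free and `∇g = 0`. -/
structure IsLeviCivitaOn (cov : Conn M) (g : BilinField M) (V : Set M) : Prop where
  isCov : IsCovariantDerivativeOn CSq cov V
  smooth : ContMDiffCovariantDerivativeOn CSq ∞ cov V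
  torsion_free : ∀ x ∈ V, ∀ X Y : VField M, DiffFieldAt X x → DiffFieldAt Y x →
    cov Y x (X x) - cov X x (Y x) = VectorField.mlieBracket 𝓘(ℝ, CSq) X Y x
  metric : ∀ x ∈ V, ∀ Y Z : VField M, DiffFieldAt Y x → DiffFieldAt Z x → ∀ v,
    mvfderiv 𝓘(ℝ, CSq) (fun y => g y (Y y) (Z y)) x v =
      g x (cov Y x v) (Z x) + g x (Y x) (cov Z x v)

/-- `g` is a (pseudo-)Kähler metric on the open set `V`: a `J`-hermitian (pseudo-)Riemannian
metric for whose Levi-Civita connection `J` is parallel. -/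
structure IsPseudoKahlerOn (g : BilinField M) (V : Set M) : Prop where
  isMetric : IsMetricOn g V
  hermitian : ∀ x ∈ V, ∀ v w, g x (J x v) (J x w) = g x v w
  kahler : ∃ cov : Conn M, IsLeviCivitaOn cov g V ∧ IsComplexLinearOn cov V

/-- `g` is compatible over `V` with the complex projective structure `[∇]` represented
by `cov`: its Levi-Civita connection is a complex-linear connection belonging to `[∇]`. -/
def IsCompatibleOn (g : BilinField M) (cov : Conn M) (V : Set M) : Prop :=
  ∃ cov' : Conn M, IsLeviCivitaOn cov' g V ∧ IsComplexLinearOn cov' V ∧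
    CProjEquivOn cov cov' V

/-- The holomorphic coordinate systems of a complex surface. -/
def IsHolomorphicChart (z : OpenPartialHomeomorph M CSq) : Prop :=
  z ∈ IsManifold.maximalAtlas 𝓘(ℂ, CSq) ω M

/-- `dz^i` at `x`. -/
def dz (z : OpenPartialHomeomorph M CSq) (x : M) (v : TangentSpace 𝓘(ℝ, CSq) x) (i : Fin 2) : ℂ :=
  (mfderiv 𝓘(ℝ, CSq) 𝓘(ℝ, CSq) z x v : CSq) i

/-- The real coordinate field `∂/∂(Re z^k)`, i.e. the field `X` with `dz^i(X) = δ^i_k`. -/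
def coordField (z : OpenPartialHomeomorph M CSq) (k : Fin 2) : VField M := fun x =>
  (mfderiv 𝓘(ℝ, CSq) 𝓘(ℝ, CSq) z x).inverse (Pi.single k 1 : CSq)

/-- The derivative `∂f/∂z^k = ½ (∂f/∂(Re z^k) - i ∂f/∂(Im z^k))`. -/
def dWirtinger (z : OpenPartialHomeomorph M CSq) (k : Fin 2) (f : M → ℂ) (x : M) : ℂ :=
  (1 / 2 : ℂ) * (mvfderiv 𝓘(ℝ, CSq) f x (coordField z k x)
    - Complex.I * mvfderiv 𝓘(ℝ, CSq) f x (J x (coordField z k x)))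

/-- The complex Christoffel symbols `Γ^i_{jk}` of a complex-linear torsion-free connection.
As `∇_{∂/∂z^j} ∂/∂z^k = Γ^i_{jk} ∂/∂z^i` and `∇_{∂/∂\bar z^j} ∂/∂z^k = 0` for such a connection,
`∇` of the real coordinate fields is `Γ^i_{jk} ∂/∂z^i` plus its complex conjugate. -/
def christoffel (cov : Conn M) (z : OpenPartialHomeomorph M CSq) (i j k : Fin 2) (x : M) : ℂ :=
  dz z x (cov (coordField z k) x (coordField z j x)) i

/-- The complex projective invariants
`Π^i_{jk} = Γ^i_{jk} - ⅓ (Γ^l_{lj} δ^i_k + Γ^l_{lk} δ^i_j)`. -/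
def projInv (cov : Conn M) (z : OpenPartialHomeomorph M CSq) (i j k : Fin 2) (x : M) : ℂ :=
  christoffel cov z i j k x - (1 / 3 : ℂ) *
    ((∑ l, christoffel cov z l l j x) * (if i = k then 1 else 0)
      + (∑ l, christoffel cov z l l k x) * (if i = j then 1 else 0))

/-- `Π_{ij} = Π^k_{il} Π^l_{jk} - ∂Π^k_{ij}/∂z^k`. -/
def projInvLow (cov : Conn M) (z : OpenPartialHomeomorph M CSq) (i j : Fin 2) (x : M) : ℂ :=
  (∑ k, ∑ l, projInv cov z k i l x * projInv cov z l j k x)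
    - ∑ k, dWirtinger z k (projInv cov z k i j) x

end Surface

section Group

/-- `PSL(3, ℂ)`. -/
abbrev PSL3 : Type := Matrix.ProjectiveSpecialLinearGroup (Fin 3) ℂ

/-- `SL(3, ℂ)`. -/
abbrev SL3 : Type := Matrix.SpecialLinearGroup (Fin 3) ℂ

/-- The quotient map `SL(3, ℂ) → PSL(3, ℂ)`. -/
def toPSL : SL3 →* PSL3 := QuotientGroup.mk' (Subgroup.center SL3)

/-- The point `[1, 0, 0]` of the complex projective plane. -/
def basePoint : Projectivization ℂ (Fin 3 → ℂ) :=
  Projectivization.mk ℂ ![1, 0, 0] fun h => by simpa using congrFun h 0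

/-- The stabiliser `P ⊂ PSL(3, ℂ)` of the point `[1, 0, 0]`. -/
def P : Subgroup PSL3 := MulAction.stabilizer PSL3 basePoint

/-- The matrix with rows `(det a⁻¹, v)` and `(0, a)`. -/
def coverMatrix (a : Fin 2 → Fin 2 → ℂ) (v : Fin 2 → ℂ) : Matrix (Fin 3) (Fin 3) ℂ :=
  !![(a 0 0 * a 1 1 - a 0 1 * a 1 0)⁻¹, v 0, v 1; 0, a 0 0, a 0 1; 0, a 1 0, a 1 1]

theorem coverMatrix_det {a : Fin 2 → Fin 2 → ℂ} (ha : a 0 0 * a 1 1 - a 0 1 * a 1 0 ≠ 0)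
    (v : Fin 2 → ℂ) : (coverMatrix a v).det = 1 := by
  rw [Matrix.det_fin_three]
  simp [coverMatrix]
  field_simp

theorem toPSL_mem_P {A : SL3} (h1 : A.1 1 0 = 0) (h2 : A.1 2 0 = 0) : toPSL A ∈ P := by
  rw [P, MulAction.mem_stabilizer_iff]
  change A • basePoint = basePoint
  rw [basePoint, Projectivization.smul_mk, Projectivization.mk_eq_mk_iff']
  refine ⟨A.1 0 0, ?_⟩
  change _ = A.1.mulVec ![1, 0, 0]
  ext i
  fin_cases i <;> simp [Matrix.mulVec, dotProduct, Fin.sum_univ_three] <;> simp_all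

/-- The smooth covering `GL(2, ℂ) × ℂ² → P`, continued by `1` where `a` is singular. -/
def cover (a : Fin 2 → Fin 2 → ℂ) (v : Fin 2 → ℂ) : P := by
  classical
  exact if ha : a 0 0 * a 1 1 - a 0 1 * a 1 0 ≠ 0 then
    ⟨toPSL ⟨coverMatrix a v, coverMatrix_det ha v⟩, toPSL_mem_P rfl rfl⟩ else 1

end Group

section Cartan

variable {M : Type*} [TopologicalSpace M] [ChartedSpace CSq M] [IsManifold 𝓘(ℂ, CSq) ω M]
variable {F : Type*} [NormedAddCommGroup F] [NormedSpace ℝ F]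
variable {B : Type*} [TopologicalSpace B] [ChartedSpace F B] [IsManifold 𝓘(ℝ, F) ∞ B]

/-- A (real) Cartan geometry `(π : B → M, θ)` of type `(PSL(3, ℂ), P)`: a smooth principal right
`P`-bundle over `M` with a Cartan connection `θ`, a `𝔰𝔩(3, ℂ)`-valued one-form on `B`. -/
structure CartanGeometry (M : Type*) [TopologicalSpace M] [ChartedSpace CSq M]
    [IsManifold 𝓘(ℂ, CSq) ω M]
    {F : Type*} [NormedAddCommGroup F] [NormedSpace ℝ F]
    (B : Type*) [TopologicalSpace B] [ChartedSpace F B] [IsManifold 𝓘(ℝ, F) ∞ B] where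
  /-- the bundle projection -/
  proj : B → M
  /-- the right action of `P` -/
  act : B → P → B
  /-- the Cartan connection -/
  form : (b : B) → TangentSpace 𝓘(ℝ, F) b →L[ℝ] Matrix (Fin 3) (Fin 3) ℂ
  proj_smooth : ContMDiff 𝓘(ℝ, F) 𝓘(ℝ, CSq) ∞ proj
  act_one : ∀ b, act b 1 = b
  act_mul : ∀ b p q, act b (p * q) = act (act b p) q
  /-- the action is smooth; `P` carries the smooth structure of its covering `GL(2, ℂ) × ℂ²` -/
  act_smooth : ContMDiffOn (𝓘(ℝ, F).prod 𝓘(ℝ, (Fin 2 → Fin 2 → ℂ) × (Fin 2 → ℂ))) 𝓘(ℝ, F) ∞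
    (fun q : B × ((Fin 2 → Fin 2 → ℂ) × (Fin 2 → ℂ)) => act q.1 (cover q.2.1 q.2.2))
    {q | q.2.1 0 0 * q.2.1 1 1 - q.2.1 0 1 * q.2.1 1 0 ≠ 0}
  /-- the action is free -/
  act_free : ∀ b p, act b p = b → p = 1
  /-- the orbits of the action are the fibres -/
  proj_eq_iff : ∀ b b', proj b = proj b' ↔ ∃ p, act b p = b'
  /-- local triviality: there are smooth local sections -/
  local_section : ∀ x : M, ∃ (V : Set M) (s : M → B), IsOpen V ∧ x ∈ V ∧
    ContMDiffOn 𝓘(ℝ, CSq) 𝓘(ℝ, F) ∞ s V ∧ ∀ y ∈ V, proj (s y) = y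
  form_smooth : ∀ i j, ContMDiff 𝓘(ℝ, F).tangent 𝓘(ℝ, ℂ) ∞
    (fun v : TangentBundle 𝓘(ℝ, F) B => form v.proj v.snd i j)
  /-- `θ_b : T_b B → 𝔰𝔩(3, ℂ)` is an isomorphism -/
  form_trace : ∀ b v, (form b v).trace = 0
  form_injective : ∀ b, Function.Injective (form b)
  form_surjective : ∀ b, ∀ A : Matrix (Fin 3) (Fin 3) ℂ, A.trace = 0 → ∃ v, form b v = A
  /-- `R_p^* θ = Ad(p⁻¹) θ` -/
  form_equivariant : ∀ (A : SL3) (hA : toPSL A ∈ P) (b : B) (v : TangentSpace 𝓘(ℝ, F) b),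
    form (act b ⟨toPSL A, hA⟩) (mfderiv 𝓘(ℝ, F) 𝓘(ℝ, F) (fun b' => act b' ⟨toPSL A, hA⟩) b v) =
      ((A⁻¹ : SL3) : Matrix (Fin 3) (Fin 3) ℂ) * form b v * (A : Matrix (Fin 3) (Fin 3) ℂ)
  /-- `θ` maps the fundamental vector field of an element of the Lie algebra of `P`
  to this element; the latter is the velocity at `1` of a curve in the group. -/
  form_vertical : ∀ (c : ℝ → SL3) (hc : ∀ t, toPSL (c t) ∈ P), c 0 = 1 →
    (∀ i j, ContDiff ℝ ∞ fun t => (c t : Matrix (Fin 3) (Fin 3) ℂ) i j) → ∀ b : B,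
    form (act b ⟨toPSL (c 0), hc 0⟩)
        (mfderiv 𝓘(ℝ, ℝ) 𝓘(ℝ, F) (fun t : ℝ => act b ⟨toPSL (c t), hc t⟩) 0 (1 : ℝ)) =
      Matrix.of fun i j => deriv (fun t => (c t : Matrix (Fin 3) (Fin 3) ℂ) i j) 0

/-- `(B, θ)` is the Cartan geometry of the complex projective structure represented by `cov`:
every holomorphic coordinate system `z` has a section `σ_z` (necessarily unique) that pulls `θ`
back to the matrix with entries `θ^0_0 = 0`, `θ^i_0 = dz^i`, `θ^i_j = Π^i_{jk} dz^k`,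
`θ^0_i = Π_{ik} dz^k`. -/
def CartanGeometry.IsGeometryOf (C : CartanGeometry M (F := F) B) (cov : Conn M) : Prop :=
  ∀ z : OpenPartialHomeomorph M CSq, IsHolomorphicChart z → ∃ s : M → B,
    ContMDiffOn 𝓘(ℝ, CSq) 𝓘(ℝ, F) ∞ s z.source ∧ (∀ x ∈ z.source, C.proj (s x) = x) ∧
    ∀ x ∈ z.source, ∀ v : TangentSpace 𝓘(ℝ, CSq) x,
      let φ : Matrix (Fin 3) (Fin 3) ℂ := C.form (s x) (mfderiv 𝓘(ℝ, CSq) 𝓘(ℝ, F) s x v)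
      φ 0 0 = 0 ∧ (∀ i : Fin 2, φ i.succ 0 = dz z x v i) ∧
      (∀ i j : Fin 2, φ i.succ j.succ = ∑ k, projInv cov z i j k x * dz z x v k) ∧
      (∀ i : Fin 2, φ 0 i.succ = ∑ k, projInvLow cov z i k x * dz z x v k)

/-- The exterior derivative at `b` of a complex-valued one-form on `B`, computed in the chart
at `b`: `dα(u, v) = D_u α̃(v) - D_v α̃(u)`, where `α̃` is `α` read in the chart. -/
def extD (α : (b : B) → TangentSpace 𝓘(ℝ, F) b →L[ℝ] ℂ) (b : B)
    (u v : TangentSpace 𝓘(ℝ, F) b) : ℂ :=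
  let e := extChartAt 𝓘(ℝ, F) b
  let αc : F → (F →L[ℝ] ℂ) := fun y =>
    (α (e.symm y)).comp (mfderiv 𝓘(ℝ, F) 𝓘(ℝ, F) e.symm y)
  let u' : F := mfderiv 𝓘(ℝ, F) 𝓘(ℝ, F) e b u
  let v' : F := mfderiv 𝓘(ℝ, F) 𝓘(ℝ, F) e b v
  fderiv ℝ αc (e b) u' v' - fderiv ℝ αc (e b) v' u'

namespace CartanGeometry

variable (C : CartanGeometry M (F := F) B)

/-- The component `θ^i_j` of the Cartan connection. -/
def comp (i j : Fin 3) (b : B) : TangentSpace 𝓘(ℝ, F) b →L[ℝ] ℂ :=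
  ((ContinuousLinearMap.proj j).comp
    (ContinuousLinearMap.proj (R := ℝ) (φ := fun _ : Fin 3 => Fin 3 → ℂ) i)).comp (C.form b)

/-- The component `Θ^i_j` of the curvature `Θ = dθ + θ ∧ θ`. -/
def curvature (i j : Fin 3) (b : B) (u v : TangentSpace 𝓘(ℝ, F) b) : ℂ :=
  extD (C.comp i j) b u v +
    ∑ k, (C.comp i k b u * C.comp k j b v - C.comp i k b v * C.comp k j b u)

/-- The tangent vector `u` at `b` for which `θ_b(u)` has entry `c` in place `(l, 0)` and
entry `0` elsewhere. -/
def frameVec (b : B) (l : Fin 2) (c : ℂ) : TangentSpace 𝓘(ℝ, F) b :=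
  Function.invFun (C.form b) (Matrix.single l.succ 0 c)

/-- The coefficient of `θ^l_0 ∧ \bar θ^j_0` in the curvature component `Θ^i_k`, i.e. the value of
the complex-bilinear extension of `Θ^i_k` on the complexified tangent vectors `½(X_l - i X'_l)`
and `½(X_j + i X'_j)`, where `X_l`, `X'_l` are dual to the real and imaginary parts of `θ^l_0`. -/
def coeff (i k : Fin 3) (l j : Fin 2) (b : B) : ℂ :=
  (1 / 4 : ℂ) *
    (C.curvature i k b (C.frameVec b l 1) (C.frameVec b j 1)
      + Complex.I * C.curvature i k b (C.frameVec b l 1) (C.frameVec b j Complex.I)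
      - Complex.I * C.curvature i k b (C.frameVec b l Complex.I) (C.frameVec b j 1)
      + C.curvature i k b (C.frameVec b l Complex.I) (C.frameVec b j Complex.I))

/-- `W^i_{kl\bar j}`, from `Θ^i_k = W^i_{kl\bar j} θ^l_0 ∧ \bar θ^j_0`. -/
def W (i k l j : Fin 2) (b : B) : ℂ := C.coeff i.succ k.succ l j b

/-- `K_{il\bar j}`, from `Θ^0_i = L_i θ^1_0 ∧ θ^2_0 + K_{il\bar j} θ^l_0 ∧ \bar θ^j_0`. -/
def K (i l j : Fin 2) (b : B) : ℂ := C.coeff 0 i.succ l j b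

/-- `θ^0_0`. -/
def θ00 (b : B) (v : TangentSpace 𝓘(ℝ, F) b) : ℂ := C.form b v 0 0

/-- `θ^i_0`, for `i = 1, 2`. -/
def θc (i : Fin 2) (b : B) (v : TangentSpace 𝓘(ℝ, F) b) : ℂ := C.form b v i.succ 0

/-- `θ^0_i`, for `i = 1, 2`. -/
def θr (i : Fin 2) (b : B) (v : TangentSpace 𝓘(ℝ, F) b) : ℂ := C.form b v 0 i.succ

/-- `θ^i_j`, for `i, j = 1, 2`. -/
def θm (i j : Fin 2) (b : B) (v : TangentSpace 𝓘(ℝ, F) b) : ℂ := C.form b v i.succ j.succ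

/-- The antisymmetric symbol `ε_{ij}` with `ε_{12} = 1`. -/
def eps (i j : Fin 2) : ℝ := (!![0, 1; -1, 0] : Matrix (Fin 2) (Fin 2) ℝ) i j

/-- The inverse matrix `ε^{ij}` of `ε_{ij}`, so `ε^{12} = -1`. -/
def epsInv (i j : Fin 2) : ℝ := (!![0, -1; 1, 0] : Matrix (Fin 2) (Fin 2) ℝ) i j

/-- `(h_{i\bar j}, h_i, h)` is on `U` a smooth solution of the rank 9 linear system. -/
structure IsSolutionOn (hh : Fin 2 → Fin 2 → B → ℂ) (hv : Fin 2 → B → ℂ) (h : B → ℝ)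
    (U : Set B) : Prop where
  smooth_hh : ∀ i j, ContMDiffOn 𝓘(ℝ, F) 𝓘(ℝ, ℂ) ∞ (hh i j) U
  smooth_hv : ∀ i, ContMDiffOn 𝓘(ℝ, F) 𝓘(ℝ, ℂ) ∞ (hv i) U
  smooth_h : ContMDiffOn 𝓘(ℝ, F) 𝓘(ℝ, ℝ) ∞ h U
  hermitian : ∀ b ∈ U, ∀ i j, hh i j b = conj (hh j i b)
  eq_hh : ∀ b ∈ U, ∀ v : TangentSpace 𝓘(ℝ, F) b, ∀ i j,
    mvfderiv 𝓘(ℝ, F) (hh i j) b v =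
      2 * hh i j b * ((C.θ00 b v).re : ℂ)
      + (∑ s, hh i s b * conj (C.θm s j b v))
      + (∑ s, hh s j b * C.θm s i b v)
      + hv i b * (∑ s, conj (eps s j * C.θc s b v))
      + conj (hv j b) * ∑ s, eps s i * C.θc s b v
  eq_hv : ∀ b ∈ U, ∀ v : TangentSpace 𝓘(ℝ, F) b, ∀ k,
    mvfderiv 𝓘(ℝ, F) (hv k) b v =
      2 * Complex.I * hv k b * ((C.θ00 b v).im : ℂ)
      + (∑ l, hv l b * C.θm l k b v)
      + (∑ i, ∑ j, hh k i b * conj (epsInv i j * C.θr j b v))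
      + ∑ l, (eps k l * h b
          - (1 / 2 : ℂ) * ∑ i, ∑ j, ∑ s, epsInv i j * hh s i b * C.W s k l j b) * C.θc l b v
  eq_h : ∀ b ∈ U, ∀ v : TangentSpace 𝓘(ℝ, F) b,
    mvfderiv 𝓘(ℝ, F) h b v =
      -2 * h b * (C.θ00 b v).re
      - 2 * (∑ l, ∑ k, epsInv l k * (hv l b * C.θr k b v).re)
      + ∑ i, ∑ j, ∑ k, ∑ l, ∑ s,
          epsInv i j * epsInv k l * (hh k i b * C.K l s j b * C.θc s b v).re

/-- `h_{1\bar 1} h_{2\bar 2} - |h_{1\bar 2}|²` (a real number where `h_{i\bar j}` is hermitian). -/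
def hdet (hh : Fin 2 → Fin 2 → B → ℂ) (b : B) : ℝ :=
  (hh 0 0 b * hh 1 1 b).re - ‖hh 0 1 b‖ ^ 2

/-- The quadratic form `h_{i\bar j} θ^i_0 ∘ \bar θ^j_0 / (h_{1\bar 1} h_{2\bar 2} - |h_{1\bar 2}|²)²`,
evaluated on `v`; the sum is real where `h_{i\bar j}` is hermitian. -/
def quadForm (hh : Fin 2 → Fin 2 → B → ℂ) (b : B) (v : TangentSpace 𝓘(ℝ, F) b) : ℝ :=
  (∑ i, ∑ j, hh i j b * C.θc i b v * conj (C.θc j b v)).re / hdet hh b ^ 2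

/-- On the open set `U` of `B`, the quadratic form above is the `π`-pullback of a
(pseudo-)Kähler metric on `π(U)` that is compatible with `[∇]`. -/
def DescendsOn (cov : Conn M) (hh : Fin 2 → Fin 2 → B → ℂ) (U : Set B) : Prop :=
  IsOpen (C.proj '' U) ∧ ∃ g : BilinField M,
    IsPseudoKahlerOn g (C.proj '' U) ∧ IsCompatibleOn g cov (C.proj '' U) ∧
    ∀ b ∈ U, ∀ v : TangentSpace 𝓘(ℝ, F) b,
      C.quadForm hh b v =
        g (C.proj b) (mfderiv 𝓘(ℝ, F) 𝓘(ℝ, CSq) C.proj b v)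
          (mfderiv 𝓘(ℝ, F) 𝓘(ℝ, CSq) C.proj b v)

end CartanGeometry

end Cartan

end CProj

end

/-! The generalised geodesics of `∇` and the Cartan geometry only see `∇` up to the projective
changes `∇_v Y + a(v) Y + a(Y) v` with a complex-linear covector field `a`, so a compatible
metric is a hermitian metric which is parallel for one of these changes.

Through every point of `B` passes an adapted section `τ`, a translate of a section `σ_z` by a
fixed element of the structure group; along it `θ` is expressed by the coordinates and `∇`.

On the fibres only the homogeneous part of the equation for `d h_{i\bar j}` survives; it says
that `h_{i\bar j}` transforms under the structure group like the matrix of a hermitian form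
twisted by the determinant, and dividing by the square of the determinant removes the twist.
Hence `g` is locally constant along the fibres and descends to `M`.

On the base, with `h_i = h_{i\bar j} \bar ψ^j`, the inhomogeneous terms are absorbed into the
matrix of connection forms by adding `ψ^i ε_{sj} θ^s_0`. Read off along `τ`, the modified forms
are those of a projective change of `∇`, and the equation becomes the statement that `g` is
parallel for it. -/

noncomputable section

namespace CProj

/-! ### Charts and covariant derivatives -/

section ChartCalculus

variable {E : Type*} [NormedAddCommGroup E] [NormedSpace ℝ E]
variable {N : Type*} [TopologicalSpace N] [ChartedSpace E N]

/-- The differential at `y` of the preferred chart at `x₀`. -/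
def chartDeriv (x₀ y : N) : TangentSpace 𝓘(ℝ, E) y →L[ℝ] E :=
  mfderiv 𝓘(ℝ, E) 𝓘(ℝ, E) (chartAt E x₀) y

/-- The vector field with constant components `w` in the preferred chart at `x₀`. -/
def constField (x₀ : N) (w : E) (y : N) : TangentSpace 𝓘(ℝ, E) y :=
  (chartDeriv x₀ y).inverse w

variable [IsManifold 𝓘(ℝ, E) ∞ N] {x₀ y : N}

theorem snd_trivializationAt_eq_chartDeriv (hy : y ∈ (chartAt E x₀).source)
    (v : TangentSpace 𝓘(ℝ, E) y) :
    (trivializationAt E (TangentSpace 𝓘(ℝ, E)) x₀ (⟨y, v⟩ : TangentBundle 𝓘(ℝ, E) N)).2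
      = chartDeriv x₀ y v := by
  have h := DFunLike.congr_fun
    (TangentBundle.continuousLinearMapAt_trivializationAt (I := 𝓘(ℝ, E)) hy) v
  rwa [Bundle.Trivialization.continuousLinearMapAt_apply,
    Bundle.Trivialization.linearMapAt_apply, if_pos (by simpa using hy)] at h

theorem isInvertible_chartDeriv (hy : y ∈ (chartAt E x₀).source) :
    (chartDeriv (E := E) x₀ y).IsInvertible :=
  isInvertible_mfderiv_extChartAt (I := 𝓘(ℝ, E)) (x := x₀) (by simpa using hy)

theorem chartDeriv_injective (hy : y ∈ (chartAt E x₀).source) :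
    Function.Injective (chartDeriv (E := E) x₀ y) :=
  (isInvertible_chartDeriv hy).injective

theorem chartDeriv_constField (hy : y ∈ (chartAt E x₀).source) (w : E) :
    chartDeriv x₀ y (constField x₀ w y) = w :=
  (isInvertible_chartDeriv hy).self_apply_inverse w

theorem constField_chartDeriv (hy : y ∈ (chartAt E x₀).source) (v : TangentSpace 𝓘(ℝ, E) y) :
    constField x₀ (chartDeriv x₀ y v) y = v :=
  chartDeriv_injective hy (chartDeriv_constField hy _)

theorem mdifferentiableAt_field_iff (hy : y ∈ (chartAt E x₀).source)
    (Y : (p : N) → TangentSpace 𝓘(ℝ, E) p) :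
    MDifferentiableAt 𝓘(ℝ, E) 𝓘(ℝ, E).tangent
        (fun p => (⟨p, Y p⟩ : TangentBundle 𝓘(ℝ, E) N)) y ↔
      MDifferentiableAt 𝓘(ℝ, E) 𝓘(ℝ, E) (fun p => chartDeriv x₀ p (Y p)) y := by
  refine ((trivializationAt E (TangentSpace 𝓘(ℝ, E)) x₀).mdifferentiableAt_section_iff
    𝓘(ℝ, E) Y (b₀ := y) (by simpa using hy)).trans (EventuallyEq.mdifferentiableAt_iff ?_)
  filter_upwards [(chartAt E x₀).open_source.mem_nhds hy] with p hp
  exact snd_trivializationAt_eq_chartDeriv hp _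

theorem contMDiffOn_field_iff {n : ℕ∞} {V : Set N} (hV : IsOpen V)
    (hVs : V ⊆ (chartAt E x₀).source) (Y : (p : N) → TangentSpace 𝓘(ℝ, E) p) :
    ContMDiffOn 𝓘(ℝ, E) 𝓘(ℝ, E).tangent n
        (fun y => (⟨y, Y y⟩ : TangentBundle 𝓘(ℝ, E) N)) V ↔
      ContMDiffOn 𝓘(ℝ, E) 𝓘(ℝ, E) n (fun p => chartDeriv x₀ p (Y p)) V :=
  have : IsManifold 𝓘(ℝ, E) (n + 1) N := IsManifold.of_le (n := ∞) (by exact_mod_cast le_top)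
  ((trivializationAt E (TangentSpace 𝓘(ℝ, E)) x₀).contMDiffOn_section_iff
    (IB := 𝓘(ℝ, E)) (n := n) (s := Y) hV fun y hy => by simpa using hVs hy).trans
    (contMDiffOn_congr fun _ hp => snd_trivializationAt_eq_chartDeriv (hVs hp) _)

theorem mdifferentiableAt_constField (hy : y ∈ (chartAt E x₀).source) (w : E) :
    MDifferentiableAt 𝓘(ℝ, E) 𝓘(ℝ, E).tangent
      (fun p => (⟨p, constField x₀ w p⟩ : TangentBundle 𝓘(ℝ, E) N)) y := by
  rw [mdifferentiableAt_field_iff hy]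
  apply (mdifferentiableAt_const (c := w)).congr_of_eventuallyEq
  filter_upwards [(chartAt E x₀).open_source.mem_nhds hy] with p hp
  exact chartDeriv_constField hp w

theorem contMDiffOn_constField {n : ℕ∞} (x₀ : N) (w : E) :
    ContMDiffOn 𝓘(ℝ, E) 𝓘(ℝ, E).tangent n
      (fun y => (⟨y, constField x₀ w y⟩ : TangentBundle 𝓘(ℝ, E) N)) (chartAt E x₀).source := by
  rw [contMDiffOn_field_iff (chartAt E x₀).open_source subset_rfl]
  exact (contMDiffOn_const (c := w)).congr fun p hp => chartDeriv_constField hp w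

theorem mlieBracket_const (w w' : E) :
    VectorField.mlieBracket 𝓘(ℝ, E) (fun _ : E => w) (fun _ => w') = 0 := by
  refine (VectorField.mlieBracketWithin_univ (I := 𝓘(ℝ, E)) (V := fun _ : E => w)
    (W := fun _ => w')).symm.trans
    (VectorField.mlieBracketWithin_eq_lieBracketWithin.trans ?_)
  funext p
  exact (by simp [VectorField.lieBracketWithin] :
    VectorField.lieBracketWithin ℝ (fun _ : E => w) (fun _ => w') univ p = 0)

theorem mlieBracket_constField [CompleteSpace E] (hy : y ∈ (chartAt E x₀).source)
    (w w' : E) :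
    VectorField.mlieBracket 𝓘(ℝ, E) (constField x₀ w) (constField x₀ w') y = 0 := by
  have hchart : ContMDiffAt 𝓘(ℝ, E) 𝓘(ℝ, E) 2 (chartAt E x₀) y :=
    contMDiffAt_of_mem_maximalAtlas (IsManifold.chart_mem_maximalAtlas x₀) hy
  have hconst (u : E) : MDifferentiableAt 𝓘(ℝ, E) 𝓘(ℝ, E).tangent
      (fun p => (⟨p, u⟩ : TangentBundle 𝓘(ℝ, E) E)) (chartAt E x₀ y) :=
    ((contMDiff_vectorSpace_iff_contDiff (V := fun _ => u)).2 contDiff_const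
      |>.mdifferentiable (n := 1) one_ne_zero) _
  have : IsManifold 𝓘(ℝ, E) (minSmoothness ℝ 2) N := by
    rw [minSmoothness_of_isRCLikeNormedField]; infer_instance
  refine (VectorField.mpullback_mlieBracket (I := 𝓘(ℝ, E)) (I' := 𝓘(ℝ, E))
    (V := fun _ => w) (W := fun _ => w') (hconst w) (hconst w') hchart
    (by rw [minSmoothness_of_isRCLikeNormedField])).symm.trans ?_
  exact (congrArg (fun X => VectorField.mpullback 𝓘(ℝ, E) 𝓘(ℝ, E) (chartAt E x₀) X y)
    (mlieBracket_const w w')).trans (congrFun VectorField.mpullback_zero y)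

end ChartCalculus

section ChartLines

variable {E : Type*} [NormedAddCommGroup E] [NormedSpace ℝ E]
variable {N : Type*} [TopologicalSpace N] [ChartedSpace E N]
variable {G : Type*} [NormedAddCommGroup G] [NormedSpace ℝ G]

/-- The straight line of the preferred chart at `y` through `y` with velocity `v`; it turns
derivatives of functions on `N` into derivatives of functions of one real variable. -/
def chartLine (y : N) (v : E) (t : ℝ) : N :=
  (chartAt E y).symm (chartAt E y y + t • v)

@[simp] theorem chartLine_zero (y : N) (v : E) : chartLine y v 0 = y := by
  simp only [chartLine, zero_smul, add_zero]
  exact (chartAt E y).left_inv (mem_chart_source E y)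

theorem hasDerivAt_comp_chartLine {f : N → G} {y : N}
    (hf : MDifferentiableAt 𝓘(ℝ, E) 𝓘(ℝ, G) f y) (v : TangentSpace 𝓘(ℝ, E) y) :
    HasDerivAt (fun t => f (chartLine (E := E) y v t)) (mvfderiv 𝓘(ℝ, E) f y v) 0 := by
  change E at v
  have hf' := hf.hasMFDerivAt.2
  simp only [mfld_simps] at hf'
  have hline : HasDerivAt (fun t : ℝ => chartAt E y y + t • v) v 0 := by
    simpa only [id, one_smul] using
      ((hasDerivAt_id (0 : ℝ)).smul_const v).const_add (chartAt E y y)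
  have hstart : chartAt E y y + (0 : ℝ) • v = chartAt E y y := by rw [zero_smul, add_zero]
  have hf'' := (hasFDerivWithinAt_univ (𝕜 := ℝ) (E := E) (F := G)).1 hf'
  exact HasFDerivAt.comp_hasDerivAt (f := fun t : ℝ => chartAt E y y + t • v) (0 : ℝ)
    (by rw [hstart]; exact hf'') hline

theorem mvfderiv_eq_of_hasDerivAt {f : N → G} {y : N}
    (hf : MDifferentiableAt 𝓘(ℝ, E) 𝓘(ℝ, G) f y) {v : TangentSpace 𝓘(ℝ, E) y} {c : G}
    (h : HasDerivAt (fun t => f (chartLine (E := E) y v t)) c 0) : mvfderiv 𝓘(ℝ, E) f y v = c :=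
  (hasDerivAt_comp_chartLine hf v).unique h

theorem mvfderiv_clm_comp {G' : Type*} [NormedAddCommGroup G'] [NormedSpace ℝ G']
    (L : G →L[ℝ] G') {f : N → G} {y : N}
    (hf : MDifferentiableAt 𝓘(ℝ, E) 𝓘(ℝ, G) f y) (v : TangentSpace 𝓘(ℝ, E) y) :
    mvfderiv 𝓘(ℝ, E) (fun p => L (f p)) y v = L (mvfderiv 𝓘(ℝ, E) f y v) :=
  mvfderiv_eq_of_hasDerivAt (L.differentiable.comp_mdifferentiableAt hf)
    (L.hasFDerivAt.comp_hasDerivAt (0 : ℝ) (hasDerivAt_comp_chartLine hf v))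

end ChartLines

section CovariantDerivatives

variable {E : Type*} [NormedAddCommGroup E] [NormedSpace ℝ E] [FiniteDimensional ℝ E]
variable {H : Type*} [TopologicalSpace H] {I : ModelWithCorners ℝ E H}
variable {N : Type*} [TopologicalSpace N] [T2Space N] [ChartedSpace H N] [IsManifold I ∞ N]
variable {G : Type*} [NormedAddCommGroup G] [NormedSpace ℝ G]
variable {V : N → Type*} [TopologicalSpace (Bundle.TotalSpace G V)] [∀ x, AddCommGroup (V x)]
  [∀ x, Module ℝ (V x)] [∀ x, TopologicalSpace (V x)] [∀ x, IsTopologicalAddGroup (V x)]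
  [∀ x, ContinuousSMul ℝ (V x)] [FiberBundle G V] [VectorBundle ℝ G V]
variable {cov : ((x : N) → V x) → (x : N) → TangentSpace I x →L[ℝ] V x}

theorem contMDiffCovariantDerivativeOn_of_univ (hc : IsCovariantDerivativeOn G cov univ)
    (hs : ContMDiffCovariantDerivativeOn G ∞ cov univ) {W : Set N} (hW : IsOpen W) :
    ContMDiffCovariantDerivativeOn G ∞ cov W where
  contMDiff {σ} hσ x hx := by
    obtain ⟨f, -, hf⟩ := (SmoothBumpFunction.nhds_basis_tsupport (I := I) x).mem_iff.1
      (hW.mem_nhds hx)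
    have hcut : ContMDiff I (I.prod 𝓘(ℝ, G)) (∞ + 1)
        (fun y => (⟨y, (⇑f • σ) y⟩ : Bundle.TotalSpace G V)) :=
      ContMDiffOn.smul_section_of_tsupport (n := ∞ + 1) f.contMDiff.contMDiffOn hW hf hσ
    refine (((hs.contMDiff hcut.contMDiffOn).contMDiffAt (x := x) univ_mem).congr_of_eventuallyEq
      ?_).contMDiffWithinAt
    filter_upwards [f.eventuallyEq_one.eventuallyEq_nhds, hW.mem_nhds hx] with y hy hyW
    congr 1
    refine hc.congr_of_eventuallyEq
      (((hσ y hyW).contMDiffAt (hW.mem_nhds hyW)).mdifferentiableAt (by simp))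
      (hcut.mdifferentiable (by simp) y) univ_mem ?_
    filter_upwards [hy] with p hp
    simp [hp]

end CovariantDerivatives

section HomBundle

variable {E : Type*} [NormedAddCommGroup E] [NormedSpace ℝ E]
variable {N : Type*} [TopologicalSpace N] [ChartedSpace E N] [IsManifold 𝓘(ℝ, E) ∞ N]

theorem contMDiffAt_hom_of_chartDeriv {n : ℕ∞} {x₀ : N}
    {φ : (y : N) → TangentSpace 𝓘(ℝ, E) y →L[ℝ] TangentSpace 𝓘(ℝ, E) y}
    {φ' : N → E →L[ℝ] E} (hφ' : ContMDiffAt 𝓘(ℝ, E) 𝓘(ℝ, E →L[ℝ] E) n φ' x₀)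
    (h : ∀ᶠ y in 𝓝 x₀, ∀ v, chartDeriv x₀ y (φ y v) = φ' y (chartDeriv x₀ y v)) :
    ContMDiffAt 𝓘(ℝ, E) (𝓘(ℝ, E).prod 𝓘(ℝ, E →L[ℝ] E)) n
      (fun y => (⟨y, φ y⟩ : Bundle.TotalSpace (E →L[ℝ] E)
        fun y : N => TangentSpace 𝓘(ℝ, E) y →L[ℝ] TangentSpace 𝓘(ℝ, E) y)) x₀ := by
  rw [contMDiffAt_hom_bundle]
  refine ⟨contMDiffAt_id, hφ'.congr_of_eventuallyEq ?_⟩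
  filter_upwards [h, (chartAt E x₀).open_source.mem_nhds (mem_chart_source E x₀)] with y hφ hy
  let e := trivializationAt E (TangentSpace 𝓘(ℝ, E)) x₀
  have hchart (u : TangentSpace 𝓘(ℝ, E) y) : e.continuousLinearMapAt ℝ y u = chartDeriv x₀ y u :=
    DFunLike.congr_fun (TangentBundle.continuousLinearMapAt_trivializationAt hy) u
  ext1 w
  have hw := e.continuousLinearMapAt_symmL (R := ℝ) (by simpa [e] using hy) w
  rw [hchart] at hw
  exact (hchart _).trans ((hφ _).trans (congrArg (φ' y) hw))

end HomBundle

section FlatConnection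

variable {E : Type*} [NormedAddCommGroup E] [NormedSpace ℝ E]
variable {N : Type*} [TopologicalSpace N] [ChartedSpace E N] {x₀ y : N}

/-- The flat connection of the preferred chart at `x₀`, which differentiates components. -/
def flatCov (x₀ : N) (Y : (p : N) → TangentSpace 𝓘(ℝ, E) p) (y : N) :
    TangentSpace 𝓘(ℝ, E) y →L[ℝ] TangentSpace 𝓘(ℝ, E) y :=
  (chartDeriv x₀ y).inverse ∘L mvfderiv 𝓘(ℝ, E) (fun p => chartDeriv x₀ p (Y p)) y

variable [IsManifold 𝓘(ℝ, E) ∞ N]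

theorem chartDeriv_flatCov (hy : y ∈ (chartAt E x₀).source)
    (Y : (p : N) → TangentSpace 𝓘(ℝ, E) p) (v : TangentSpace 𝓘(ℝ, E) y) :
    chartDeriv x₀ y (flatCov x₀ Y y v) =
      mvfderiv 𝓘(ℝ, E) (fun p => chartDeriv x₀ p (Y p)) y v :=
  (isInvertible_chartDeriv hy).self_apply_inverse _

theorem flatCov_constField (hy : y ∈ (chartAt E x₀).source) (w : E) :
    flatCov x₀ (constField x₀ w) y = 0 := by
  have hconst : (fun p => chartDeriv x₀ p (constField x₀ w p)) =ᶠ[𝓝 y] fun _ => w := by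
    filter_upwards [(chartAt E x₀).open_source.mem_nhds hy] with p hp
    exact chartDeriv_constField hp w
  have hderiv : mvfderiv 𝓘(ℝ, E) (fun p => chartDeriv x₀ p (constField x₀ w p)) y = 0 :=
    (EventuallyEq.mfderiv_eq hconst).trans mfderiv_const
  rw [flatCov, hderiv, ContinuousLinearMap.comp_zero]

theorem isCovariantDerivativeOn_flatCov (x₀ : N) :
    IsCovariantDerivativeOn E (flatCov (E := E) x₀) (chartAt E x₀).source where
  add {Y Y' y} hY hY' hy := by
    rw [mdifferentiableAt_field_iff hy] at hY hY'
    ext v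
    apply chartDeriv_injective hy
    rw [add_apply, map_add, chartDeriv_flatCov hy, chartDeriv_flatCov hy, chartDeriv_flatCov hy,
      ← add_apply, ← mvfderiv_add hY hY']
    simp only [Pi.add_apply, map_add, Pi.add_def]
  leibniz {Y f y} hY hf hy := by
    rw [mdifferentiableAt_field_iff hy] at hY
    ext v
    apply chartDeriv_injective hy
    rw [add_apply, map_add, smul_apply, map_smul, chartDeriv_flatCov hy, chartDeriv_flatCov hy,
      ContinuousLinearMap.smulRight_apply, map_smul]
    have h := congrArg (fun L => L v) (mvfderiv_smul hf hY)
    simp only [Pi.smul_apply', map_smul, Pi.smul_def'] at h ⊢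
    exact h

theorem chartDeriv_cov [FiniteDimensional ℝ E]
    {cov : ((p : N) → TangentSpace 𝓘(ℝ, E) p) →
      (p : N) → TangentSpace 𝓘(ℝ, E) p →L[ℝ] TangentSpace 𝓘(ℝ, E) p}
    (hcov : IsCovariantDerivativeOn E cov (chartAt E x₀).source)
    (hy : y ∈ (chartAt E x₀).source) {Y : (p : N) → TangentSpace 𝓘(ℝ, E) p}
    (hY : MDifferentiableAt 𝓘(ℝ, E) 𝓘(ℝ, E).tangent
      (fun p => (⟨p, Y p⟩ : TangentBundle 𝓘(ℝ, E) N)) y) (v : TangentSpace 𝓘(ℝ, E) y) :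
    chartDeriv x₀ y (cov Y y v) =
      mvfderiv 𝓘(ℝ, E) (fun p => chartDeriv x₀ p (Y p)) y v +
        chartDeriv x₀ y (cov (constField x₀ (chartDeriv x₀ y (Y y))) y v) := by
  have hdiff := hcov.difference_apply (isCovariantDerivativeOn_flatCov x₀) hy
    (mdifferentiableAt_constField hy (chartDeriv x₀ y (Y y)))
  rw [constField_chartDeriv hy, flatCov_constField hy, sub_zero,
    hcov.difference_apply (isCovariantDerivativeOn_flatCov x₀) hy hY, sub_eq_iff_eq_add'] at hdiff
  rw [hdiff, add_apply, map_add, chartDeriv_flatCov hy]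

end FlatConnection

section ComplexStructure

theorem complex_smul_eq_re_add_im {E : Type*} [AddCommGroup E] [Module ℂ E] [Module ℝ E]
    [IsScalarTower ℝ ℂ E] (a : ℂ) (v : E) : a • v = a.re • v + a.im • (Complex.I • v) := by
  conv_lhs => rw [← Complex.re_add_im a]
  simp only [add_smul, mul_smul, ← Complex.coe_algebraMap, algebraMap_smul]

theorem apply_eq_sum_of_map_I_smul {ι : Type*} [Fintype ι] [DecidableEq ι]
    {E : Type*} [AddCommGroup E] [Module ℂ E] [Module ℝ E] [IsScalarTower ℝ ℂ E]
    (L : (ι → ℂ) →ₗ[ℝ] E) (hL : ∀ w, L (Complex.I • w) = Complex.I • L w) (w : ι → ℂ) :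
    L w = ∑ j, w j • L (Pi.single j 1) := by
  have hsmul (a : ℂ) (u : ι → ℂ) : L (a • u) = a • L u := by
    rw [complex_smul_eq_re_add_im, map_add, map_smul, map_smul, hL, ← complex_smul_eq_re_add_im]
  conv_lhs => rw [pi_eq_sum_univ' w]
  simp only [map_sum, hsmul]

variable {M : Type*} [TopologicalSpace M] [ChartedSpace CSq M]

theorem dz_chartAt (x₀ y : M) (v : TangentSpace 𝓘(ℝ, CSq) y) (i : Fin 2) :
    dz (chartAt CSq x₀) y v i = chartDeriv x₀ y v i := rfl

theorem coordField_chartAt (x₀ : M) (k : Fin 2) :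
    coordField (chartAt CSq x₀) k = constField x₀ (Pi.single k 1) := rfl

variable [IsManifold 𝓘(ℂ, CSq) ω M] {x₀ y : M}

theorem isHolomorphicChart_chartAt (x₀ : M) : IsHolomorphicChart (chartAt CSq x₀) :=
  IsManifold.chart_mem_maximalAtlas x₀

theorem chartDeriv_J (hy : y ∈ (chartAt CSq x₀).source) (v : TangentSpace 𝓘(ℝ, CSq) y) :
    chartDeriv x₀ y (J y v) = Complex.I • chartDeriv x₀ y v := by
  have : IsManifold 𝓘(ℂ, CSq) 1 M := IsManifold.of_le (n := ω) le_top
  have hreal := (mdifferentiableAt_atlas (I := 𝓘(ℝ, CSq)) (chart_mem_atlas _ x₀) hy).hasMFDerivAt.2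
  have hcomplex :=
    (mdifferentiableAt_atlas (I := 𝓘(ℂ, CSq)) (chart_mem_atlas _ x₀) hy).hasMFDerivAt.2
  simp only [mfld_simps] at hreal hcomplex
  -- the real differential of a holomorphic chart underlies its complex differential
  have hderiv := HasFDerivAt.unique
    ((hasFDerivWithinAt_univ (𝕜 := ℝ) (E := CSq) (F := CSq)).1 hreal)
    (((hasFDerivWithinAt_univ (𝕜 := ℂ) (E := CSq) (F := CSq)).1 hcomplex).restrictScalars ℝ)
  refine (congrArg (fun L => L (J y v)) hderiv).trans
    (Eq.trans ?_ (congrArg (fun L : CSq →L[ℝ] CSq => Complex.I • L v) hderiv.symm))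
  exact (show CSq →L[ℂ] CSq from mfderiv 𝓘(ℂ, CSq) 𝓘(ℂ, CSq) (chartAt CSq x₀) y).map_smul
    Complex.I (show CSq from v)

theorem J_constField (hy : y ∈ (chartAt CSq x₀).source) (w : CSq) :
    J y (constField x₀ w y) = constField x₀ (Complex.I • w) y :=
  chartDeriv_injective hy (by rw [chartDeriv_J hy, chartDeriv_constField hy,
    chartDeriv_constField hy])

/-- The coordinate `w ↦ w k` of `ℂ²` as a real-linear map. -/
def coordL (k : Fin 2) : CSq →L[ℝ] ℂ := ContinuousLinearMap.proj (R := ℝ) (φ := fun _ => ℂ) k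

end ComplexStructure

section Christoffel

open Matrix

variable {M : Type*} [TopologicalSpace M] [ChartedSpace CSq M] [IsManifold 𝓘(ℂ, CSq) ω M]
variable {cov : Conn M} {x₀ y : M}

theorem cov_constField_symm (hcov : IsComplexLinearOn cov univ)
    (hy : y ∈ (chartAt CSq x₀).source) (w w' : CSq) :
    cov (constField x₀ w') y (constField x₀ w y) =
      cov (constField x₀ w) y (constField x₀ w' y) := by
  have h := hcov.torsion_free y trivial _ _ (mdifferentiableAt_constField hy w)
    (mdifferentiableAt_constField hy w')
  rw [mlieBracket_constField hy] at h
  exact sub_eq_zero.1 h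

theorem cov_constField_I_smul (hcov : IsComplexLinearOn cov univ)
    (hy : y ∈ (chartAt CSq x₀).source) (w : CSq) (v : TangentSpace 𝓘(ℝ, CSq) y) :
    cov (constField x₀ (Complex.I • w)) y v = J y (cov (constField x₀ w) y v) := by
  rw [← hcov.complex_linear y trivial _ (mdifferentiableAt_constField hy w)]
  have hdiff : DiffFieldAt (constField x₀ (Complex.I • w)) y := mdifferentiableAt_constField hy _
  have hev : ∀ᶠ p in 𝓝 y, constField x₀ (Complex.I • w) p = J p (constField x₀ w p) := by
    filter_upwards [(chartAt CSq x₀).open_source.mem_nhds hy] with p hp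
    exact (J_constField hp w).symm
  have hdiff' : DiffFieldAt (fun p => J p (constField x₀ w p)) y :=
    hdiff.congr_of_eventuallyEq (hev.mono fun _ hp => congrArg _ hp.symm)
  rw [hcov.isCov.congr_of_eventuallyEq hdiff hdiff' univ_mem hev]

theorem chartDeriv_cov_constField_I_smul (hcov : IsComplexLinearOn cov univ)
    (hy : y ∈ (chartAt CSq x₀).source) (w u : CSq) :
    chartDeriv x₀ y (cov (constField x₀ w) y (constField x₀ (Complex.I • u) y)) =
      Complex.I • chartDeriv x₀ y (cov (constField x₀ w) y (constField x₀ u y)) := by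
  rw [cov_constField_symm hcov hy, cov_constField_I_smul hcov hy, chartDeriv_J hy,
    cov_constField_symm hcov hy]

theorem chartDeriv_cov_constField_eq_sum (hcov : IsComplexLinearOn cov univ)
    (hy : y ∈ (chartAt CSq x₀).source) (w u : CSq) :
    chartDeriv x₀ y (cov (constField x₀ w) y (constField x₀ u y)) =
      ∑ j, u j • chartDeriv x₀ y (cov (constField x₀ w) y (constField x₀ (Pi.single j 1) y)) :=
  apply_eq_sum_of_map_I_smul
    (chartDeriv x₀ y ∘L cov (constField x₀ w) y ∘L (chartDeriv x₀ y).inverse).toLinearMap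
    (chartDeriv_cov_constField_I_smul hcov hy w) u

theorem christoffel_symm (hcov : IsComplexLinearOn cov univ)
    (hy : y ∈ (chartAt CSq x₀).source) (i j k : Fin 2) :
    christoffel cov (chartAt CSq x₀) i j k y = christoffel cov (chartAt CSq x₀) i k j y := by
  simp only [christoffel, coordField_chartAt, cov_constField_symm hcov hy (Pi.single j 1)]

theorem chartDeriv_cov_constField (hcov : IsComplexLinearOn cov univ)
    (hy : y ∈ (chartAt CSq x₀).source) (w : CSq) (v : TangentSpace 𝓘(ℝ, CSq) y) (i : Fin 2) :
    chartDeriv x₀ y (cov (constField x₀ w) y v) i =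
      ∑ j, ∑ k, christoffel cov (chartAt CSq x₀) i j k y * chartDeriv x₀ y v j * w k := by
  conv_lhs => rw [← constField_chartDeriv hy v, chartDeriv_cov_constField_eq_sum hcov hy]
  simp only [cov_constField_symm hcov hy (Pi.single _ 1) w,
    chartDeriv_cov_constField_eq_sum hcov hy (Pi.single _ 1) w, Finset.sum_apply, Pi.smul_apply,
    smul_eq_mul, Finset.mul_sum]
  refine Finset.sum_congr rfl fun j _ => Finset.sum_congr rfl fun k _ => ?_
  rw [christoffel_symm hcov hy, christoffel, coordField_chartAt, coordField_chartAt, dz_chartAt]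
  ring

/-- The matrix of the `1`-forms `Π^i_{jk} dz^k`, evaluated on a vector with components `v` in the
chart at `x₀`. -/
def projInvMatrix (cov : Conn M) (x₀ y : M) (v : CSq) : Matrix (Fin 2) (Fin 2) ℂ :=
  Matrix.of fun i k => ∑ l, projInv cov (chartAt CSq x₀) i k l y * v l

/-- The components `Γ^l_{lk} / 3` in the chart at `x₀`. -/
def traceCoeff (cov : Conn M) (x₀ y : M) : CSq :=
  fun k => 1 / 3 * ∑ l, christoffel cov (chartAt CSq x₀) l l k y

theorem sum_christoffel_eq (hcov : IsComplexLinearOn cov univ)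
    (hy : y ∈ (chartAt CSq x₀).source) (v w : CSq) (i : Fin 2) :
    ∑ j, ∑ k, christoffel cov (chartAt CSq x₀) i j k y * v j * w k =
      (projInvMatrix cov x₀ y v *ᵥ w + (traceCoeff cov x₀ y ⬝ᵥ v) • w
        + (traceCoeff cov x₀ y ⬝ᵥ w) • v) i := by
  have hsymm := christoffel_symm hcov hy i 0 1
  fin_cases i <;>
  · simp only [Fin.zero_eta, Fin.mk_one, Pi.add_apply, Pi.smul_apply, smul_eq_mul, mulVec,
      dotProduct, projInvMatrix, traceCoeff, Matrix.of_apply, projInv, Fin.sum_univ_two, if_true,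
      one_ne_zero, zero_ne_one, if_false] at hsymm ⊢
    linear_combination (v 0 * w 1 - v 1 * w 0) * hsymm

theorem chartDeriv_cov_eq (hcov : IsComplexLinearOn cov univ)
    (hy : y ∈ (chartAt CSq x₀).source) {Y : VField M} (hY : DiffFieldAt Y y)
    (v : TangentSpace 𝓘(ℝ, CSq) y) :
    chartDeriv x₀ y (cov Y y v) =
      mvfderiv 𝓘(ℝ, CSq) (fun p => chartDeriv x₀ p (Y p)) y v +
        (projInvMatrix cov x₀ y (chartDeriv x₀ y v) *ᵥ chartDeriv x₀ y (Y y)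
          + (traceCoeff cov x₀ y ⬝ᵥ chartDeriv x₀ y v) • chartDeriv x₀ y (Y y)
          + (traceCoeff cov x₀ y ⬝ᵥ chartDeriv x₀ y (Y y)) • chartDeriv x₀ y v) := by
  rw [chartDeriv_cov (hcov.isCov.mono (subset_univ _)) hy hY]
  exact congrArg _ (funext fun i =>
    (chartDeriv_cov_constField hcov hy _ v i).trans (sum_christoffel_eq hcov hy _ _ i))

theorem contMDiffOn_christoffel [T2Space M] (hcov : IsComplexLinearOn cov univ) (x₀ : M)
    (i j k : Fin 2) :
    ContMDiffOn 𝓘(ℝ, CSq) 𝓘(ℝ, ℂ) ∞ (christoffel cov (chartAt CSq x₀) i j k)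
      (chartAt CSq x₀).source := by
  have hopen := (chartAt CSq x₀).open_source
  have hcoord (l : Fin 2) := contMDiffOn_constField (n := ⊤) x₀ (Pi.single l 1 : CSq)
  have hsection := ((contMDiffCovariantDerivativeOn_of_univ hcov.isCov hcov.smooth hopen).contMDiff
    (hcoord k)).clm_bundle_apply (hcoord j)
  exact (coordL i).contMDiff.comp_contMDiffOn
    ((contMDiffOn_field_iff (n := ⊤) hopen subset_rfl _).1 hsection)

end Christoffel

/-! ### Complex projective changes -/

section ProjectiveChange

variable {M : Type*} [TopologicalSpace M] [ChartedSpace CSq M]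

/-- Complex scalar multiplication on `ℂ²`, as a real-bilinear map. -/
def smulL : ℂ →L[ℝ] CSq →L[ℝ] CSq := ContinuousLinearMap.lsmul ℝ ℂ

/-- Multiplication of tangent vectors by a complex number, `i` acting as `J`. -/
def csmul (x : M) (a : ℂ) : TangentSpace 𝓘(ℝ, CSq) x →L[ℝ] TangentSpace 𝓘(ℝ, CSq) x := smulL a

theorem csmul_eq (x : M) (a : ℂ) (v : TangentSpace 𝓘(ℝ, CSq) x) :
    csmul x a v = a.re • v + a.im • J x v :=
  complex_smul_eq_re_add_im (E := CSq) a v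

theorem csmul_eq_zero {x : M} {a : ℂ} {v : TangentSpace 𝓘(ℝ, CSq) x} :
    csmul x a v = 0 ↔ a = 0 ∨ v = 0 := by
  change a • (show CSq from v) = 0 ↔ a = 0 ∨ (show CSq from v) = 0
  exact smul_eq_zero

/-- The bilinear map `(w, v) ↦ a(w) v + a(v) w` on `ℂ²`. -/
def symTensor (a : CSq →L[ℝ] ℂ) : CSq →L[ℝ] CSq →L[ℝ] CSq :=
  smulL.comp a + (smulL.comp a).flip

theorem symTensor_eq (a : CSq →L[ℝ] ℂ) (w : CSq) :
    symTensor a w = smulL (a w) + (smulL.flip w).comp a := rfl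

theorem symTensor_apply (a : CSq →L[ℝ] ℂ) (w v : CSq) :
    symTensor a w v = a w • v + a v • w := rfl

/-- The bilinear map `(w, v) ↦ A(w) v + A(v) w` on a tangent space. -/
def projTensor (x : M) (A : TangentSpace 𝓘(ℝ, CSq) x →L[ℝ] ℂ) :
    TangentSpace 𝓘(ℝ, CSq) x →L[ℝ] TangentSpace 𝓘(ℝ, CSq) x →L[ℝ] TangentSpace 𝓘(ℝ, CSq) x :=
  symTensor A

theorem projTensor_apply (x : M) (A : TangentSpace 𝓘(ℝ, CSq) x →L[ℝ] ℂ)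
    (w v : TangentSpace 𝓘(ℝ, CSq) x) :
    projTensor x A w v = csmul x (A w) v + csmul x (A v) w := rfl

theorem projTensor_comm (x : M) (A : TangentSpace 𝓘(ℝ, CSq) x →L[ℝ] ℂ)
    (w v : TangentSpace 𝓘(ℝ, CSq) x) : projTensor x A w v = projTensor x A v w := by
  rw [projTensor_apply, projTensor_apply, add_comm]

theorem projTensor_J {x : M} {A : TangentSpace 𝓘(ℝ, CSq) x →L[ℝ] ℂ}
    (hA : ∀ v, A (J x v) = Complex.I * A v) (w v : TangentSpace 𝓘(ℝ, CSq) x) :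
    projTensor x A (J x w) v = J x (projTensor x A w v) := by
  rw [projTensor_apply, projTensor_apply, hA, map_add]
  exact congrArg₂ _ (mul_smul (β := CSq) Complex.I (A w) v)
    (smul_comm (α := CSq) (A v) Complex.I w)

theorem projTensor_self_mem_span (x : M) (A : TangentSpace 𝓘(ℝ, CSq) x →L[ℝ] ℂ)
    (v : TangentSpace 𝓘(ℝ, CSq) x) : projTensor x A v v ∈ Submodule.span ℝ {v, J x v} := by
  have h := Submodule.mem_span_pair.2 ⟨(A v).re, (A v).im, (csmul_eq x (A v) v).symm⟩
  exact add_mem h h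

theorem projTensor_injective (x : M) : Function.Injective (projTensor x) := by
  intro A A' h
  ext u
  have hu : (2 : ℝ) • csmul x (A u - A' u) u = 0 := by
    have hAA' := DFunLike.congr_fun (DFunLike.congr_fun h u) u
    rw [projTensor_apply, projTensor_apply, ← sub_eq_zero] at hAA'
    rw [← hAA', csmul_eq, csmul_eq, csmul_eq, Complex.sub_re, Complex.sub_im]
    module
  rcases csmul_eq_zero.1 ((smul_eq_zero_iff_right two_ne_zero).1 hu) with hA | rfl
  · exact sub_eq_zero.1 hA
  · rw [map_zero, map_zero]

/-- The change of a connection by a field of complex covectors. When the covectors are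
complex-linear, this is the general way to change a connection within its complex projective
class. -/
def projChange (cov : Conn M) (A : (x : M) → TangentSpace 𝓘(ℝ, CSq) x →L[ℝ] ℂ) : Conn M :=
  fun Y x => cov Y x + projTensor x (A x) (Y x)

theorem projChange_apply (cov : Conn M) (A : (x : M) → TangentSpace 𝓘(ℝ, CSq) x →L[ℝ] ℂ)
    (Y : VField M) (x : M) (v : TangentSpace 𝓘(ℝ, CSq) x) :
    projChange cov A Y x v = cov Y x v + projTensor x (A x) (Y x) v := rfl

variable [IsManifold 𝓘(ℂ, CSq) ω M]

theorem chartDeriv_csmul {x₀ y : M} (hy : y ∈ (chartAt CSq x₀).source) (a : ℂ)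
    (v : TangentSpace 𝓘(ℝ, CSq) y) : chartDeriv x₀ y (csmul y a v) = a • chartDeriv x₀ y v := by
  rw [csmul_eq, map_add, map_smul, map_smul, chartDeriv_J hy, ← complex_smul_eq_re_add_im]

variable {cov : Conn M} {A : (x : M) → TangentSpace 𝓘(ℝ, CSq) x →L[ℝ] ℂ} {V : Set M}

/-- Smoothness over `V` of a field of complex covectors, expressed through its components in the
preferred charts. -/
def SmoothCovectorOn (A : (x : M) → TangentSpace 𝓘(ℝ, CSq) x →L[ℝ] ℂ) (V : Set M) : Prop :=
  ∀ x ∈ V, ∃ a : M → CSq →L[ℝ] ℂ, ContMDiffAt 𝓘(ℝ, CSq) 𝓘(ℝ, CSq →L[ℝ] ℂ) ∞ a x ∧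
    ∀ᶠ y in 𝓝 x, ∀ v, A y v = a y (chartDeriv x y v)

theorem contMDiffCovariantDerivativeOn_projChange [T2Space M] (hcov : IsComplexLinearOn cov univ)
    (hV : IsOpen V) (hA : SmoothCovectorOn A V) :
    ContMDiffCovariantDerivativeOn CSq ∞ (projChange cov A) V where
  contMDiff {σ} hσ := by
    refine ((contMDiffCovariantDerivativeOn_of_univ hcov.isCov hcov.smooth hV).contMDiff
      hσ).add_section fun x hx => ?_
    obtain ⟨a, ha, hAa⟩ := hA x hx
    have hchart := (chartAt CSq x).open_source.mem_nhds (mem_chart_source CSq x)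
    obtain ⟨N, hNsub, hNo, hxN⟩ := mem_nhds_iff.1 (inter_mem hchart (hV.mem_nhds hx))
    have hσx : ContMDiffAt 𝓘(ℝ, CSq) 𝓘(ℝ, CSq) ∞ (fun y => chartDeriv x y (σ y)) x :=
      ((contMDiffOn_field_iff (n := ⊤) hNo (fun y hy => (hNsub hy).1) σ).1
        (hσ.mono fun y hy => (hNsub hy).2)).contMDiffAt (hNo.mem_nhds hxN)
    refine (contMDiffAt_hom_of_chartDeriv (n := ⊤)
      (φ' := fun y => symTensor (a y) (chartDeriv x y (σ y))) ?_ ?_).contMDiffWithinAt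
    · simp only [symTensor_eq]
      exact (smulL.contMDiff.contMDiffAt.comp x (ha.clm_apply hσx)).add
        ((smulL.flip.contMDiff.contMDiffAt.comp x hσx).clm_comp ha)
    · filter_upwards [hAa, hchart] with y hAy hy v
      rw [projTensor_apply, map_add, chartDeriv_csmul hy, chartDeriv_csmul hy, hAy, hAy,
        symTensor_apply]

theorem isComplexLinearOn_projChange [T2Space M] (hcov : IsComplexLinearOn cov univ)
    (hV : IsOpen V) (hA : SmoothCovectorOn A V)
    (hJ : ∀ x ∈ V, ∀ v, A x (J x v) = Complex.I * A x v) :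
    IsComplexLinearOn (projChange cov A) V where
  isCov := (hcov.isCov.mono (subset_univ V)).add_one_form fun x => projTensor x (A x)
  smooth := contMDiffCovariantDerivativeOn_projChange hcov hV hA
  torsion_free x _ X Y hX hY := by
    rw [← hcov.torsion_free x trivial X Y hX hY, projChange_apply, projChange_apply,
      projTensor_comm, add_sub_add_right_eq_sub]
  complex_linear x hx Y hY v := by
    rw [projChange_apply, projChange_apply, hcov.complex_linear x trivial Y hY,
      projTensor_J (hJ x hx), map_add]

theorem cprojEquivOn_projChange : CProjEquivOn cov (projChange cov A) V := by
  have hplanar (γ : ℝ → M) (t : ℝ) (X : VField M)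
      (hX : ∀ᶠ s in 𝓝 t, X (γ s) = velocity γ s) :
      projChange cov A X (γ t) (velocity γ t) ∈
          Submodule.span ℝ {velocity γ t, J (γ t) (velocity γ t)} ↔
        cov X (γ t) (velocity γ t) ∈
          Submodule.span ℝ {velocity γ t, J (γ t) (velocity γ t)} := by
    rw [projChange_apply, hX.self_of_nhds]
    exact Submodule.add_mem_iff_left _ (projTensor_self_mem_span _ _ _)
  exact fun γ a b =>
    ⟨fun h => ⟨h.smooth, h.mapsTo, h.immersed, fun t ht X hX hγ =>
      (hplanar γ t X hγ).2 (h.planar t ht X hX hγ)⟩,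
    fun h => ⟨h.smooth, h.mapsTo, h.immersed, fun t ht X hX hγ =>
      (hplanar γ t X hγ).1 (h.planar t ht X hX hγ)⟩⟩

end ProjectiveChange

section MetricCovector

theorem eq_zero_of_symm_of_skew {E : Type*} [Zero E] {T : E → E → E} {g : E → E → ℝ}
    (hsymm : ∀ u v, T u v = T v u) (hskew : ∀ u v w, g (T u v) w + g (T w v) u = 0)
    (hnondeg : ∀ v, (∀ w, g v w = 0) → v = 0) (u v : E) : T u v = 0 := by
  refine hnondeg _ fun w => ?_
  have huvw := hskew u v w
  have hvuw := hskew v u w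
  have hwvu := hskew u w v
  rw [hsymm w v] at huvw
  rw [hsymm v u, hsymm w u] at hvuw
  linarith

variable {M : Type*} [TopologicalSpace M] [ChartedSpace CSq M] [IsManifold 𝓘(ℂ, CSq) ω M]
variable {cov : Conn M} {g : BilinField M} {V : Set M}

/-- The change of `cov` by the complex-linear covector `A` makes `g` parallel at `x`. -/
structure IsMetricCovector (g : BilinField M) (cov : Conn M) (x : M)
    (A : TangentSpace 𝓘(ℝ, CSq) x →L[ℝ] ℂ) : Prop where
  complex_linear : ∀ v, A (J x v) = Complex.I * A v
  metric : ∀ Y Z : VField M, DiffFieldAt Y x → DiffFieldAt Z x → ∀ v,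
    mvfderiv 𝓘(ℝ, CSq) (fun y => g y (Y y) (Z y)) x v =
      g x (cov Y x v + projTensor x A (Y x) v) (Z x) +
        g x (Y x) (cov Z x v + projTensor x A (Z x) v)

theorem exists_diffFieldAt (x : M) (u : TangentSpace 𝓘(ℝ, CSq) x) :
    ∃ Y : VField M, DiffFieldAt Y x ∧ Y x = u :=
  ⟨constField x (chartDeriv x x u), mdifferentiableAt_constField (mem_chart_source CSq x) _,
    constField_chartDeriv (mem_chart_source CSq x) u⟩

theorem IsMetricCovector.unique {x : M} {A A' : TangentSpace 𝓘(ℝ, CSq) x →L[ℝ] ℂ}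
    (hA : IsMetricCovector g cov x A) (hA' : IsMetricCovector g cov x A')
    (hsymm : ∀ v w, g x v w = g x w v) (hnondeg : ∀ v, (∀ w, g x v w = 0) → v = 0) :
    A = A' := by
  have hskew (u v w) : g x (projTensor x A u v - projTensor x A' u v) w +
      g x (projTensor x A w v - projTensor x A' w v) u = 0 := by
    obtain ⟨Y, hY, rfl⟩ := exists_diffFieldAt x u
    obtain ⟨Z, hZ, rfl⟩ := exists_diffFieldAt x w
    have h := (hA.metric Y Z hY hZ v).symm.trans (hA'.metric Y Z hY hZ v)
    rw [hsymm (Y x), hsymm (Y x)] at h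
    simp only [map_add, add_apply, map_sub, sub_apply] at h ⊢
    linarith
  refine projTensor_injective x (ContinuousLinearMap.ext fun u => ContinuousLinearMap.ext fun v =>
    sub_eq_zero.1 ?_)
  refine eq_zero_of_symm_of_skew
    (T := fun u v => projTensor x A u v - projTensor x A' u v) (g := fun v w => g x v w)
    (fun u v => ?_) hskew hnondeg u v
  rw [projTensor_comm, projTensor_comm x A']

open Classical in
/-- The covector at `x` whose projective change makes `g` parallel, where it exists, and `0`
elsewhere; over a set where it exists it changes `cov` to the Levi-Civita connection of `g`. -/
def metricCovector (g : BilinField M) (cov : Conn M) (x : M) : TangentSpace 𝓘(ℝ, CSq) x →L[ℝ] ℂ :=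
  if h : ∃ A, IsMetricCovector g cov x A then h.choose else 0

theorem IsMetricCovector.metricCovector_eq {x : M} {A : TangentSpace 𝓘(ℝ, CSq) x →L[ℝ] ℂ}
    (hA : IsMetricCovector g cov x A)
    (hsymm : ∀ v w, g x v w = g x w v) (hnondeg : ∀ v, (∀ w, g x v w = 0) → v = 0) :
    metricCovector g cov x = A := by
  have h : ∃ A, IsMetricCovector g cov x A := ⟨A, hA⟩
  rw [metricCovector, dif_pos h]
  exact h.choose_spec.unique hA hsymm hnondeg

theorem isPseudoKahlerOn_and_isCompatibleOn [T2Space M] (hcov : IsComplexLinearOn cov univ)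
    (hV : IsOpen V) (hg : IsMetricOn g V)
    (hherm : ∀ x ∈ V, ∀ v w, g x (J x v) (J x w) = g x v w)
    (hloc : ∀ x ∈ V, ∃ a : M → CSq →L[ℝ] ℂ,
      ContMDiffAt 𝓘(ℝ, CSq) 𝓘(ℝ, CSq →L[ℝ] ℂ) ∞ a x ∧
      ∀ᶠ y in 𝓝 x, IsMetricCovector g cov y ((a y).comp (chartDeriv x y))) :
    IsPseudoKahlerOn g V ∧ IsCompatibleOn g cov V := by
  have hmetric : ∀ x ∈ V, IsMetricCovector g cov x (metricCovector g cov x) := by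
    intro x hx
    obtain ⟨a, -, ha⟩ := hloc x hx
    rw [ha.self_of_nhds.metricCovector_eq (hg.symm x hx) (hg.nondegenerate x hx)]
    exact ha.self_of_nhds
  have hsmooth : SmoothCovectorOn (metricCovector g cov) V := by
    intro x hx
    obtain ⟨a, ha, hev⟩ := hloc x hx
    refine ⟨a, ha, ?_⟩
    filter_upwards [hev, hV.mem_nhds hx] with y hy hyV v
    rw [hy.metricCovector_eq (hg.symm y hyV) (hg.nondegenerate y hyV)]
    rfl
  have hlinear :=
    isComplexLinearOn_projChange hcov hV hsmooth fun x hx => (hmetric x hx).complex_linear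
  have hLeviCivita : IsLeviCivitaOn (projChange cov (metricCovector g cov)) g V :=
    ⟨hlinear.isCov, hlinear.smooth, hlinear.torsion_free, fun x hx => (hmetric x hx).metric⟩
  exact ⟨⟨hg, hherm, _, hLeviCivita, hlinear⟩, _, hLeviCivita, hlinear, cprojEquivOn_projChange⟩

end MetricCovector

/-! ### The structure group and its orbits -/

section GroupParameters

/-- The parameters `(a, v)` of the covering `GL(2, ℂ) × ℂ² → P`; the matrix `a` may be singular. -/
abbrev Par : Type := (Fin 2 → Fin 2 → ℂ) × (Fin 2 → ℂ)

/-- The determinant of the matrix part of a parameter. -/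
def pdet (q : Par) : ℂ := q.1 0 0 * q.1 1 1 - q.1 0 1 * q.1 1 0

/-- The parameter of the identity. -/
def parOne : Par := (fun i j => if i = j then 1 else 0, 0)

@[simp] theorem pdet_parOne : pdet parOne = 1 := by simp [pdet, parOne]

/-- The element of `SL(3, ℂ)` with the given parameters. -/
def coverSL (q : Par) (h : pdet q ≠ 0) : SL3 := ⟨coverMatrix q.1 q.2, coverMatrix_det h q.2⟩

theorem toPSL_coverSL_mem (q : Par) (h : pdet q ≠ 0) : toPSL (coverSL q h) ∈ P :=
  toPSL_mem_P rfl rfl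

theorem cover_eq (q : Par) (h : pdet q ≠ 0) :
    cover q.1 q.2 = ⟨toPSL (coverSL q h), toPSL_coverSL_mem q h⟩ := dif_pos h

theorem entries_of_toPSL_mem {A : SL3} (h : toPSL A ∈ P) : A.1 1 0 = 0 ∧ A.1 2 0 = 0 := by
  rw [P, MulAction.mem_stabilizer_iff] at h
  change A • basePoint = basePoint at h
  rw [basePoint, Projectivization.smul_mk, Projectivization.mk_eq_mk_iff'] at h
  obtain ⟨c, hc⟩ := h
  have hcol (i : Fin 3) : (c • ![1, 0, 0] : Fin 3 → ℂ) i = A.1 i 0 := by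
    rw [hc]
    change A.1.mulVec ![1, 0, 0] i = A.1 i 0
    simp [Matrix.mulVec, dotProduct, Fin.sum_univ_three]
  exact ⟨by simp [← hcol 1], by simp [← hcol 2]⟩

/-- The parameters of a matrix in the preimage of `P`. -/
def parOf (A : SL3) : Par := (fun i j => A.1 i.succ j.succ, fun j => A.1 0 j.succ)

theorem mul_pdet_parOf {A : SL3} (h : toPSL A ∈ P) : A.1 0 0 * pdet (parOf A) = 1 := by
  obtain ⟨h1, h2⟩ := entries_of_toPSL_mem h
  have hdet := A.2
  rw [Matrix.det_fin_three, h1, h2] at hdet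
  simp only [pdet, parOf, Fin.succ_zero_eq_one, Fin.succ_one_eq_two]
  linear_combination hdet

theorem pdet_parOf_ne_zero {A : SL3} (h : toPSL A ∈ P) : pdet (parOf A) ≠ 0 :=
  right_ne_zero_of_mul (mul_pdet_parOf h ▸ one_ne_zero)

theorem coverSL_parOf {A : SL3} (h : toPSL A ∈ P) :
    coverSL (parOf A) (pdet_parOf_ne_zero h) = A := by
  obtain ⟨h1, h2⟩ := entries_of_toPSL_mem h
  have h0 : A.1 0 0 = (pdet (parOf A))⁻¹ := eq_inv_of_mul_eq_one_left (mul_pdet_parOf h)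
  ext i j
  fin_cases i <;> fin_cases j
  exacts [h0.symm, rfl, rfl, h1.symm, rfl, rfl, h2.symm, rfl, rfl]

theorem cover_parOf {A : SL3} (h : toPSL A ∈ P) :
    cover (parOf A).1 (parOf A).2 = ⟨toPSL A, h⟩ := by
  rw [cover_eq _ (pdet_parOf_ne_zero h)]
  simp only [coverSL_parOf h]

theorem coverMatrix_parOne : coverMatrix parOne.1 parOne.2 = 1 := by
  ext i j
  fin_cases i <;> fin_cases j <;> simp [coverMatrix, parOne]

theorem cover_parOne : cover parOne.1 parOne.2 = 1 := by
  rw [cover_eq _ (by simp)]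
  have hone : coverSL parOne (by simp) = 1 := Subtype.ext coverMatrix_parOne
  exact Subtype.ext ((congrArg toPSL hone).trans (map_one toPSL))

theorem continuous_pdet : Continuous pdet := by
  unfold pdet
  fun_prop

/-- The derivative of `coverMatrix` at `q` in the direction `δ`. -/
def coverDeriv (q δ : Par) : Matrix (Fin 3) (Fin 3) ℂ :=
  !![-(q.1 0 0 * δ.1 1 1 + δ.1 0 0 * q.1 1 1 - (q.1 0 1 * δ.1 1 0 + δ.1 0 1 * q.1 1 0))
      / pdet q ^ 2, δ.2 0, δ.2 1; 0, δ.1 0 0, δ.1 0 1; 0, δ.1 1 0, δ.1 1 1]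

variable {ℓ : ℝ → Par}

theorem hasDerivAt_coverMatrix {δ : Par} {t : ℝ} (hℓt : pdet (ℓ t) ≠ 0)
    (hℓ : HasDerivAt ℓ δ t) (i j : Fin 3) :
    HasDerivAt (fun s => coverMatrix (ℓ s).1 (ℓ s).2 i j) (coverDeriv (ℓ t) δ i j) t := by
  have hmat (i j : Fin 2) : HasDerivAt (fun s => (ℓ s).1 i j) (δ.1 i j) t :=
    hasDerivAt_pi.1 (hasDerivAt_pi.1 hℓ.fst i) j
  have hrow (j : Fin 2) : HasDerivAt (fun s => (ℓ s).2 j) (δ.2 j) t := hasDerivAt_pi.1 hℓ.snd j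
  have hdet : HasDerivAt (fun s => (pdet (ℓ s))⁻¹) (coverDeriv (ℓ t) δ 0 0) t := by
    refine ((((hmat 0 0).mul (hmat 1 1)).sub ((hmat 0 1).mul (hmat 1 0))).inv hℓt).congr_deriv ?_
    change _ / pdet (ℓ t) ^ 2 = _ / pdet (ℓ t) ^ 2
    congr 1
    ring
  fin_cases i <;> fin_cases j
  exacts [hdet, hrow 0, hrow 1, hasDerivAt_const _ _, hmat 0 0, hmat 0 1, hasDerivAt_const _ _,
    hmat 1 0, hmat 1 1]

theorem contDiff_coverMatrix (hℓt : ∀ t, pdet (ℓ t) ≠ 0) (hℓ : ContDiff ℝ ∞ ℓ) (i j : Fin 3) :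
    ContDiff ℝ ∞ fun t => coverMatrix (ℓ t).1 (ℓ t).2 i j := by
  have hmat (i j : Fin 2) : ContDiff ℝ ∞ fun s => (ℓ s).1 i j :=
    contDiff_pi.1 (contDiff_pi.1 hℓ.fst i) j
  have hrow (j : Fin 2) : ContDiff ℝ ∞ fun s => (ℓ s).2 j := contDiff_pi.1 hℓ.snd j
  have hdet : ContDiff ℝ ∞ fun s => (pdet (ℓ s))⁻¹ :=
    (((hmat 0 0).mul (hmat 1 1)).sub ((hmat 0 1).mul (hmat 1 0))).inv hℓt
  fin_cases i <;> fin_cases j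
  exacts [hdet, hrow 0, hrow 1, contDiff_const, hmat 0 0, hmat 0 1, contDiff_const, hmat 1 0,
    hmat 1 1]

theorem exists_curve_pdet_ne_zero {q : Par} (hq : pdet q ≠ 0) (δ : Par) :
    ∃ ℓ : ℝ → Par, ContDiff ℝ ∞ ℓ ∧ ℓ 0 = q ∧ HasDerivAt ℓ δ 0 ∧ ∀ t, pdet (ℓ t) ≠ 0 := by
  have hnear : ∀ᶠ s : ℝ in 𝓝 0, pdet (q + s • δ) ≠ 0 :=
    (continuous_pdet.comp (by fun_prop)).continuousAt.eventually_ne (by simpa using hq)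
  obtain ⟨r, hr, hball⟩ := Metric.eventually_nhds_iff.1 hnear
  refine ⟨fun t => q + (r / 2 * Real.sin (t / (r / 2))) • δ, by fun_prop, by simp, ?_,
    fun t => hball ?_⟩
  · have hsin : HasDerivAt (fun t => r / 2 * Real.sin (t / (r / 2))) 1 0 := by
      refine ((((hasDerivAt_id (0 : ℝ)).div_const (r / 2)).sin).const_mul (r / 2)).congr_deriv ?_
      simp [hr.ne']
    simpa using (hsin.smul_const δ).const_add q
  · rw [dist_zero_right, norm_mul, Real.norm_of_nonneg (half_pos hr).le, Real.norm_eq_abs]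
    nlinarith [Real.abs_sin_le_one (t / (r / 2))]

end GroupParameters

section Orbits

variable {M : Type*} [TopologicalSpace M] [ChartedSpace CSq M] [IsManifold 𝓘(ℂ, CSq) ω M]
variable {F : Type*} [NormedAddCommGroup F] [NormedSpace ℝ F]
variable {B : Type*} [TopologicalSpace B] [ChartedSpace F B] [IsManifold 𝓘(ℝ, F) ∞ B]

namespace CartanGeometry

variable (C : CartanGeometry M (F := F) B)

/-- The orbit map of the structure group, in terms of the parameters of the covering. -/
def orbit (b : B) (q : Par) : B := C.act b (cover q.1 q.2)

@[simp] theorem orbit_parOne (b : B) : C.orbit b parOne = b := by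
  rw [orbit, cover_parOne, C.act_one]

theorem proj_act (b : B) (p : P) : C.proj (C.act b p) = C.proj b :=
  ((C.proj_eq_iff _ _).2 ⟨p, rfl⟩).symm

theorem contMDiffAt_orbit_uncurry (b : B) {q : Par} (hq : pdet q ≠ 0) :
    ContMDiffAt (𝓘(ℝ, F).prod 𝓘(ℝ, Par)) 𝓘(ℝ, F) ∞
      (fun r : B × Par => C.orbit r.1 r.2) (b, q) := by
  have hopen : IsOpen {r : B × Par | pdet r.2 ≠ 0} :=
    isOpen_ne_fun (continuous_pdet.comp continuous_snd) continuous_const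
  exact (C.act_smooth (b, q) hq).contMDiffAt (hopen.mem_nhds hq)

theorem contMDiffAt_orbit (b : B) {q : Par} (hq : pdet q ≠ 0) :
    ContMDiffAt 𝓘(ℝ, Par) 𝓘(ℝ, F) ∞ (C.orbit b) q :=
  (C.contMDiffAt_orbit_uncurry b hq).comp q (contMDiffAt_const.prodMk contMDiffAt_id)

theorem contMDiff_act {A : SL3} (hA : toPSL A ∈ P) :
    ContMDiff 𝓘(ℝ, F) 𝓘(ℝ, F) ∞ (fun b' => C.act b' ⟨toPSL A, hA⟩) := by
  intro b
  have h := (C.contMDiffAt_orbit_uncurry b (pdet_parOf_ne_zero hA)).comp b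
    (contMDiffAt_id.prodMk contMDiffAt_const)
  simpa only [orbit, Function.comp_def, id_eq, cover_parOf hA] using h

theorem mfderiv_orbit_comp (b : B) {ℓ : ℝ → Par} {δ : Par} {t : ℝ} (hℓt : pdet (ℓ t) ≠ 0)
    (hℓ : HasDerivAt ℓ δ t) :
    mfderiv 𝓘(ℝ, ℝ) 𝓘(ℝ, F) (fun s => C.orbit b (ℓ s)) t (1 : ℝ) =
      mfderiv 𝓘(ℝ, Par) 𝓘(ℝ, F) (C.orbit b) (ℓ t) δ := by
  have horbit := ((C.contMDiffAt_orbit b hℓt).mdifferentiableAt (by simp)).hasMFDerivAt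
  have hcurve : HasMFDerivAt 𝓘(ℝ, ℝ) 𝓘(ℝ, Par) ℓ t (ContinuousLinearMap.toSpanSingleton ℝ δ) :=
    hℓ.hasFDerivAt.hasMFDerivAt
  refine (DFunLike.congr_fun (horbit.comp t hcurve).mfderiv (1 : ℝ)).trans ?_
  change mfderiv 𝓘(ℝ, Par) 𝓘(ℝ, F) (C.orbit b) (ℓ t) ((1 : ℝ) • δ) = _
  rw [one_smul]

theorem act_orbit (b : B) {q q' : Par} (hq : pdet q ≠ 0) (hq' : pdet q' ≠ 0)
    (h : toPSL ((coverSL q hq)⁻¹ * coverSL q' hq') ∈ P) :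
    C.act (C.orbit b q) ⟨_, h⟩ = C.orbit b q' := by
  rw [orbit, orbit, ← C.act_mul, cover_eq _ hq, cover_eq _ hq']
  congr 1
  apply Subtype.ext
  simp only [map_mul, map_inv, Subgroup.coe_mul]
  exact mul_inv_cancel_left _ _

/-- Along the orbit map, the Cartan form is the Maurer–Cartan form of `P`. -/
theorem coverMatrix_mul_form_orbit (b : B) {q : Par} (hq : pdet q ≠ 0) (δ : Par) :
    coverMatrix q.1 q.2 * C.form (C.orbit b q) (mfderiv 𝓘(ℝ, Par) 𝓘(ℝ, F) (C.orbit b) q δ)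
      = coverDeriv q δ := by
  obtain ⟨ℓ, hℓ, rfl, hδ, hne⟩ := exists_curve_pdet_ne_zero hq δ
  let N := coverSL (ℓ 0) hq
  let c : ℝ → SL3 := fun t => N⁻¹ * coverSL (ℓ t) (hne t)
  have hcP (t) : toPSL (c t) ∈ P := by
    simp only [c, map_mul, map_inv]
    exact P.mul_mem (P.inv_mem (toPSL_coverSL_mem _ _)) (toPSL_coverSL_mem _ _)
  have hc0 : c 0 = 1 := inv_mul_cancel N
  have hentry (t i j) : (c t : Matrix (Fin 3) (Fin 3) ℂ) i j =
      ∑ k, (N⁻¹).1 i k * coverMatrix (ℓ t).1 (ℓ t).2 k j := by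
    simp only [c, Matrix.SpecialLinearGroup.coe_mul, Matrix.mul_apply]
    rfl
  have hc (i j) : ContDiff ℝ ∞ fun t => (c t : Matrix (Fin 3) (Fin 3) ℂ) i j := by
    simp only [hentry]
    exact ContDiff.sum fun k _ => contDiff_const.mul (contDiff_coverMatrix hne hℓ k j)
  have hderiv : (Matrix.of fun i j => deriv (fun t => (c t : Matrix (Fin 3) (Fin 3) ℂ) i j) 0)
      = (N⁻¹).1 * coverDeriv (ℓ 0) δ := by
    ext i j
    rw [Matrix.of_apply, Matrix.mul_apply]
    simp only [hentry]
    exact (HasDerivAt.fun_sum fun k _ => (hasDerivAt_coverMatrix hq hδ k j).const_mul _).deriv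
  have hact (t) : C.act (C.orbit b (ℓ 0)) ⟨toPSL (c t), hcP t⟩ = C.orbit b (ℓ t) :=
    C.act_orbit b hq (hne t) (hcP t)
  have hvertical := C.form_vertical c hcP hc0 hc (C.orbit b (ℓ 0))
  have hform (f : ℝ → B) (hf : f = fun t => C.orbit b (ℓ t)) :
      C.form (f 0) (mfderiv 𝓘(ℝ, ℝ) 𝓘(ℝ, F) f 0 (1 : ℝ)) =
        C.form (C.orbit b (ℓ 0)) (mfderiv 𝓘(ℝ, Par) 𝓘(ℝ, F) (C.orbit b) (ℓ 0) δ) := by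
    subst hf
    exact congrArg _ (C.mfderiv_orbit_comp b hq hδ)
  have hinv : coverMatrix (ℓ 0).1 (ℓ 0).2 * (N⁻¹).1 = 1 := congrArg Subtype.val (mul_inv_cancel N)
  rw [← hform _ (funext hact), hvertical, hderiv, ← Matrix.mul_assoc, hinv, Matrix.one_mul]

end CartanGeometry
end Orbits

/-! ### Adapted sections -/

section AdaptedSections

variable {M : Type*} [TopologicalSpace M] [ChartedSpace CSq M] [IsManifold 𝓘(ℂ, CSq) ω M]
variable {F : Type*} [NormedAddCommGroup F] [NormedSpace ℝ F]
variable {B : Type*} [TopologicalSpace B] [ChartedSpace F B] [IsManifold 𝓘(ℝ, F) ∞ B]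

theorem eq_of_sum_mul_eq {A : SL3} (hA : toPSL A ∈ P) {x y : Fin 2 → ℂ}
    (h : ∀ i : Fin 2, ∑ k, A.1 i.succ k.succ * x k = ∑ k, A.1 i.succ k.succ * y k) : x = y := by
  have hdet := pdet_parOf_ne_zero hA
  have hrow₀ := h 0
  have hrow₁ := h 1
  simp only [Fin.sum_univ_two] at hrow₀ hrow₁
  simp only [pdet, parOf] at hdet
  refine funext (Fin.forall_fin_two.2 ⟨mul_left_cancel₀ hdet ?_, mul_left_cancel₀ hdet ?_⟩)
  · linear_combination A.1 (Fin.succ 1) (Fin.succ 1) * hrow₀ - A.1 (Fin.succ 0) (Fin.succ 1) * hrow₁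
  · linear_combination A.1 (Fin.succ 0) (Fin.succ 0) * hrow₁ - A.1 (Fin.succ 1) (Fin.succ 0) * hrow₀

namespace CartanGeometry

theorem mul_form_mfderiv_act (C : CartanGeometry M (F := F) B) {A : SL3} (hA : toPSL A ∈ P) (b : B)
    (v : TangentSpace 𝓘(ℝ, F) b) :
    A.1 * C.form (C.act b ⟨toPSL A, hA⟩)
        (mfderiv 𝓘(ℝ, F) 𝓘(ℝ, F) (fun b' => C.act b' ⟨toPSL A, hA⟩) b v) =
      C.form b v * A.1 := by
  have hinv : A.1 * (A⁻¹ : SL3).1 = 1 := congrArg Subtype.val (mul_inv_cancel A)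
  rw [C.form_equivariant, ← Matrix.mul_assoc, ← Matrix.mul_assoc, hinv, Matrix.one_mul]

/-- `τ` is the translate by `A` of a section as in `IsGeometryOf` for the preferred chart at `x₀`;
the last three fields express this through the pull-back of the Cartan form by `τ`. Such sections
pass through every point of `B`. -/
structure IsAdaptedSection (C : CartanGeometry M (F := F) B) (cov : Conn M) (x₀ : M) (A : SL3)
    (τ : M → B) : Prop where
  mem : toPSL A ∈ P
  smooth : ContMDiffOn 𝓘(ℝ, CSq) 𝓘(ℝ, F) ∞ τ (chartAt CSq x₀).source
  proj_eq : ∀ y ∈ (chartAt CSq x₀).source, C.proj (τ y) = y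
  form_zero : ∀ y ∈ (chartAt CSq x₀).source, ∀ v,
    A.1 0 0 * C.θ00 (τ y) (mfderiv 𝓘(ℝ, CSq) 𝓘(ℝ, F) τ y v)
      + ∑ k : Fin 2, A.1 0 k.succ * C.θc k (τ y) (mfderiv 𝓘(ℝ, CSq) 𝓘(ℝ, F) τ y v) = 0
  form_col : ∀ y ∈ (chartAt CSq x₀).source, ∀ v, ∀ i : Fin 2,
    ∑ k : Fin 2, A.1 i.succ k.succ * C.θc k (τ y) (mfderiv 𝓘(ℝ, CSq) 𝓘(ℝ, F) τ y v)
      = A.1 0 0 * chartDeriv x₀ y v i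
  form_block : ∀ y ∈ (chartAt CSq x₀).source, ∀ v, ∀ i j : Fin 2,
    ∑ k : Fin 2, A.1 i.succ k.succ * C.θm k j (τ y) (mfderiv 𝓘(ℝ, CSq) 𝓘(ℝ, F) τ y v)
      = chartDeriv x₀ y v i * A.1 0 j.succ
        + ∑ k : Fin 2, (∑ l, projInv cov (chartAt CSq x₀) i k l y * chartDeriv x₀ y v l)
          * A.1 k.succ j.succ

variable {C : CartanGeometry M (F := F) B} {cov : Conn M}

theorem IsGeometryOf.exists_isAdaptedSection (hC : C.IsGeometryOf cov) (b : B) :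
    ∃ A τ, C.IsAdaptedSection cov (C.proj b) A τ ∧ τ (C.proj b) = b := by
  obtain ⟨s, hs, hproj, hform⟩ := hC _ (isHolomorphicChart_chartAt (C.proj b))
  obtain ⟨⟨p, hp⟩, hpb⟩ := (C.proj_eq_iff (s (C.proj b)) b).1 (hproj _ (mem_chart_source CSq _))
  obtain ⟨A, rfl⟩ : ∃ A : SL3, toPSL A = p := QuotientGroup.mk'_surjective _ p
  obtain ⟨h10, h20⟩ := entries_of_toPSL_mem hp
  have hi0 : ∀ i : Fin 2, A.1 i.succ 0 = 0 := Fin.forall_fin_two.2 ⟨h10, h20⟩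
  let τ : M → B := fun y => C.act (s y) ⟨toPSL A, hp⟩
  have hτ : ∀ y ∈ (chartAt CSq (C.proj b)).source, ∀ v, ∀ i j,
      (A.1 * C.form (τ y) (mfderiv 𝓘(ℝ, CSq) 𝓘(ℝ, F) τ y v)) i j =
        (C.form (s y) (mfderiv 𝓘(ℝ, CSq) 𝓘(ℝ, F) s y v) * A.1) i j := by
    intro y hy v i j
    have hsy : MDifferentiableAt 𝓘(ℝ, CSq) 𝓘(ℝ, F) s y :=
      ((hs y hy).contMDiffAt ((chartAt CSq _).open_source.mem_nhds hy)).mdifferentiableAt (by simp)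
    have hchain :=
      mfderiv_comp_apply y ((C.contMDiff_act hp (s y)).mdifferentiableAt (by simp)) hsy v
    rw [← C.mul_form_mfderiv_act hp]
    exact congrArg (fun w => (A.1 * C.form (τ y) w) i j) hchain
  refine ⟨A, τ, ⟨hp, (C.contMDiff_act hp).comp_contMDiffOn hs,
    fun y hy => (C.proj_act _ _).trans (hproj y hy), fun y hy v => ?_, fun y hy v i => ?_,
    fun y hy v i j => ?_⟩, hpb⟩
  all_goals obtain ⟨f00, fcol, fblock, -⟩ := hform y hy v
  · have h := hτ y hy v 0 0
    simp only [Matrix.mul_apply, Fin.sum_univ_succ (n := 2), hi0, f00, mul_zero, zero_mul,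
      Finset.sum_const_zero, add_zero] at h
    exact h
  · have h := hτ y hy v i.succ 0
    simp only [Matrix.mul_apply, Fin.sum_univ_succ (n := 2), hi0, fcol, dz_chartAt, mul_zero,
      zero_mul, Finset.sum_const_zero, add_zero, zero_add] at h
    exact h.trans (mul_comm _ _)
  · have h := hτ y hy v i.succ j.succ
    simp only [Matrix.mul_apply, Fin.sum_univ_succ (n := 2), hi0, fcol, fblock, dz_chartAt,
      zero_mul, zero_add] at h
    exact h

/-- The value at `b` of the fundamental vector field of `δ`, a vector in the Lie algebra of the
covering of `P`. -/
def fundVec (C : CartanGeometry M (F := F) B) (b : B) (δ : Par) : TangentSpace 𝓘(ℝ, F) b :=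
  (mfderiv 𝓘(ℝ, Par) 𝓘(ℝ, F) (C.orbit b) parOne δ : F)

theorem form_fundVec (b : B) (δ : Par) : C.form b (C.fundVec b δ) = coverDeriv parOne δ := by
  have hform : (C.form (C.orbit b parOne) : F →L[ℝ] Matrix (Fin 3) (Fin 3) ℂ) = C.form b := by
    rw [orbit_parOne]
  have h := C.coverMatrix_mul_form_orbit b (q := parOne) (by simp) δ
  rw [coverMatrix_parOne, Matrix.one_mul] at h
  exact (DFunLike.congr_fun hform _).symm.trans h

theorem mfderiv_proj_fundVec (b : B) (δ : Par) :
    mfderiv 𝓘(ℝ, F) 𝓘(ℝ, CSq) C.proj b (C.fundVec b δ) = 0 := by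
  have horbit := ((C.contMDiffAt_orbit b (q := parOne) (by simp)).mdifferentiableAt
    (by simp)).hasMFDerivAt
  have hproj := ((C.proj_smooth (C.orbit b parOne)).mdifferentiableAt (by simp)).hasMFDerivAt
  have hcomp := hproj.comp parOne horbit
  have hconst : C.proj ∘ C.orbit b = fun _ => C.proj b := funext fun q => C.proj_act _ _
  rw [hconst, C.orbit_parOne] at hcomp
  exact DFunLike.congr_fun
    (hcomp.mfderiv.symm.trans (hasMFDerivAt_const (C.proj b) parOne).mfderiv) δ

theorem exists_fundVec_eq {b : B} {w : TangentSpace 𝓘(ℝ, F) b} (hw : ∀ i, C.θc i b w = 0) :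
    ∃ δ, C.fundVec b δ = w := by
  refine ⟨(fun i j => C.form b w i.succ j.succ, fun j => C.form b w 0 j.succ),
    C.form_injective b ?_⟩
  rw [form_fundVec]
  have htrace := C.form_trace b w
  rw [Matrix.trace_fin_three] at htrace
  ext i j
  fin_cases i <;> fin_cases j
  · change -(1 * C.form b w 2 2 + C.form b w 1 1 * 1 - (0 * C.form b w 2 1 + C.form b w 1 2 * 0))
      / pdet parOne ^ 2 = C.form b w 0 0
    rw [pdet_parOne]
    linear_combination -htrace
  exacts [rfl, rfl, (hw 0).symm, rfl, rfl, (hw 1).symm, rfl, rfl]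

namespace IsAdaptedSection

variable {x₀ y : M} {A : SL3} {τ : M → B}

theorem contMDiffAt (h : C.IsAdaptedSection cov x₀ A τ) (hy : y ∈ (chartAt CSq x₀).source) :
    ContMDiffAt 𝓘(ℝ, CSq) 𝓘(ℝ, F) ∞ τ y :=
  (h.smooth y hy).contMDiffAt ((chartAt CSq x₀).open_source.mem_nhds hy)

theorem mfderiv_proj (h : C.IsAdaptedSection cov x₀ A τ) (hy : y ∈ (chartAt CSq x₀).source)
    (u : TangentSpace 𝓘(ℝ, CSq) y) :
    mfderiv 𝓘(ℝ, F) 𝓘(ℝ, CSq) C.proj (τ y) (mfderiv 𝓘(ℝ, CSq) 𝓘(ℝ, F) τ y u) = u := by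
  have hchain := mfderiv_comp_apply y ((C.proj_smooth (τ y)).mdifferentiableAt (by simp))
    ((h.contMDiffAt hy).mdifferentiableAt (by simp)) u
  have hid : C.proj ∘ τ =ᶠ[𝓝 y] id :=
    ((chartAt CSq x₀).open_source.eventually_mem hy).mono h.proj_eq
  have hmfderiv := ((hasMFDerivAt_id (I := 𝓘(ℝ, CSq)) y).congr_of_eventuallyEq hid).mfderiv
  exact hchain.symm.trans (DFunLike.congr_fun hmfderiv u)

theorem exists_decomposition (h : C.IsAdaptedSection cov x₀ A τ)
    (hy : y ∈ (chartAt CSq x₀).source) (w : TangentSpace 𝓘(ℝ, F) (τ y)) :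
    ∃ u δ, w = mfderiv 𝓘(ℝ, CSq) 𝓘(ℝ, F) τ y u + C.fundVec (τ y) δ := by
  have hA : A.1 0 0 ≠ 0 := left_ne_zero_of_mul (mul_pdet_parOf h.mem ▸ one_ne_zero)
  obtain ⟨u, hu⟩ : ∃ u, chartDeriv x₀ y u =
      fun i : Fin 2 => (A.1 0 0)⁻¹ * ∑ k : Fin 2, A.1 i.succ k.succ * C.θc k (τ y) w :=
    ⟨_, chartDeriv_constField hy _⟩
  have hθ : (fun k => C.θc k (τ y) (mfderiv 𝓘(ℝ, CSq) 𝓘(ℝ, F) τ y u)) =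
      fun k => C.θc k (τ y) w :=
    eq_of_sum_mul_eq h.mem fun i => by rw [h.form_col y hy u i, hu, mul_inv_cancel_left₀ hA]
  obtain ⟨δ, hδ⟩ : ∃ δ, C.fundVec (τ y) δ = w - mfderiv 𝓘(ℝ, CSq) 𝓘(ℝ, F) τ y u := by
    refine C.exists_fundVec_eq fun i => ?_
    rw [θc, map_sub, Matrix.sub_apply, sub_eq_zero]
    exact (congrFun hθ i).symm
  exact ⟨u, δ, by rw [hδ, add_sub_cancel]⟩

theorem sum_mul_θc (h : C.IsAdaptedSection cov x₀ A τ) (hy : y ∈ (chartAt CSq x₀).source)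
    (w : TangentSpace 𝓘(ℝ, F) (τ y)) (i : Fin 2) :
    ∑ k : Fin 2, A.1 i.succ k.succ * C.θc k (τ y) w
      = A.1 0 0 * chartDeriv x₀ y (mfderiv 𝓘(ℝ, F) 𝓘(ℝ, CSq) C.proj (τ y) w) i := by
  obtain ⟨u, δ, rfl⟩ := h.exists_decomposition hy w
  have hproj : mfderiv 𝓘(ℝ, F) 𝓘(ℝ, CSq) C.proj (τ y)
      (mfderiv 𝓘(ℝ, CSq) 𝓘(ℝ, F) τ y u + C.fundVec (τ y) δ) = u := by
    rw [map_add, h.mfderiv_proj hy, mfderiv_proj_fundVec]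
    exact add_zero (M := CSq) u
  have hθ (k : Fin 2) : C.θc k (τ y) (mfderiv 𝓘(ℝ, CSq) 𝓘(ℝ, F) τ y u + C.fundVec (τ y) δ) =
      C.θc k (τ y) (mfderiv 𝓘(ℝ, CSq) 𝓘(ℝ, F) τ y u) := by
    rw [θc, θc, map_add, form_fundVec, Matrix.add_apply]
    fin_cases k <;> exact add_zero _
  simp only [hθ]
  rw [h.form_col y hy u i]
  exact congrArg (fun v : TangentSpace 𝓘(ℝ, CSq) y => A.1 0 0 * chartDeriv x₀ y v i) hproj.symm

end IsAdaptedSection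
end CartanGeometry
end AdaptedSections

section Submersions

variable {E : Type*} [NormedAddCommGroup E] [NormedSpace ℝ E]
variable {H : Type*} [TopologicalSpace H] {I : ModelWithCorners ℝ E H} [I.Boundaryless]
variable {N : Type*} [TopologicalSpace N] [ChartedSpace H N]
variable {E' : Type*} [NormedAddCommGroup E'] [NormedSpace ℝ E']
variable {H' : Type*} [TopologicalSpace H'] {I' : ModelWithCorners ℝ E' H'} [I'.Boundaryless]
variable {N' : Type*} [TopologicalSpace N'] [ChartedSpace H' N']

theorem map_extChartAt_symm_nhds_of_boundaryless (p : N) :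
    map (extChartAt I p).symm (𝓝 (extChartAt I p p)) = 𝓝 p := by
  rw [← nhdsWithin_univ, ← I.range_eq_univ, map_extChartAt_symm_nhdsWithin_range]

theorem map_nhds_eq_of_surjective_mfderiv [CompleteSpace E] [CompleteSpace E'] {f : N → N'}
    {p : N} (hf : ContMDiffAt I I' 1 f p) (hsurj : Function.Surjective (mfderiv I I' f p)) :
    map f (𝓝 p) = 𝓝 (f p) := by
  have hsmooth := (contMDiffAt_iff.1 hf).2
  have hderiv := (hf.mdifferentiableAt one_ne_zero).hasMFDerivAt.2
  rw [I.range_eq_univ] at hsmooth hderiv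
  have hmap := (hsmooth.contDiffAt univ_mem |>.hasStrictFDerivAt'
    (hasFDerivWithinAt_univ.1 hderiv) one_ne_zero).map_nhds_eq_of_surj
      (LinearMap.range_eq_top.2 hsurj)
  rw [← map_map, ← map_map, map_extChartAt_symm_nhds_of_boundaryless, Function.comp_apply,
    Function.comp_apply, extChartAt_to_inv] at hmap
  have hleft : (extChartAt I' (f p)).symm ∘ extChartAt I' (f p) ∘ f =ᶠ[𝓝 p] f :=
    (hf.continuousAt.eventually (extChartAt_source_mem_nhds (f p))).mono
      fun e he => (extChartAt I' (f p)).left_inv he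
  rw [← map_extChartAt_symm_nhds_of_boundaryless (I := I') (f p), ← hmap, map_map, map_map,
    Function.comp_assoc, map_congr hleft]

end Submersions

section Fibres

variable {M : Type*} [TopologicalSpace M] [ChartedSpace CSq M] [IsManifold 𝓘(ℂ, CSq) ω M]
variable {F : Type*} [NormedAddCommGroup F] [NormedSpace ℝ F]
variable {B : Type*} [TopologicalSpace B] [ChartedSpace F B] [IsManifold 𝓘(ℝ, F) ∞ B]

namespace CartanGeometry

theorem finiteDimensional (C : CartanGeometry M (F := F) B) (b : B) : FiniteDimensional ℝ F :=
  FiniteDimensional.of_injective (C.form b : F →L[ℝ] Matrix (Fin 3) (Fin 3) ℂ).toLinearMap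
    (C.form_injective b)

variable {C : CartanGeometry M (F := F) B} {cov : Conn M} {x₀ y : M} {A : SL3} {τ : M → B}

theorem IsAdaptedSection.map_orbit_nhds (h : C.IsAdaptedSection cov x₀ A τ)
    (hy : y ∈ (chartAt CSq x₀).source) :
    map (fun r : M × Par => C.orbit (τ r.1) r.2) (𝓝 (y, parOne)) = 𝓝 (τ y) := by
  have := C.finiteDimensional (τ y)
  have : CompleteSpace F := FiniteDimensional.complete ℝ F
  have hsmooth : ContMDiffAt (𝓘(ℝ, CSq).prod 𝓘(ℝ, Par)) 𝓘(ℝ, F) ∞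
      (fun r : M × Par => C.orbit (τ r.1) r.2) (y, parOne) :=
    (C.contMDiffAt_orbit_uncurry (τ y) (q := parOne) (by simp)).comp (y, parOne)
      (((h.contMDiffAt hy).comp (y, parOne) contMDiffAt_fst).prodMk contMDiffAt_snd)
  have hmap := map_nhds_eq_of_surjective_mfderiv (hsmooth.of_le (by simp)) fun w => by
    obtain ⟨u, δ, hw⟩ := h.exists_decomposition hy w
    refine ⟨(u, δ), ?_⟩
    refine (mfderiv_prod_eq_add_apply (hsmooth.mdifferentiableAt (by simp))).trans ?_
    have horbit : (fun x => C.orbit (τ x) parOne) = τ := funext fun x => C.orbit_parOne (τ x)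
    have hmfderiv := congrArg
      (fun f : M → B => (mfderiv 𝓘(ℝ, CSq) 𝓘(ℝ, F) f y : CSq →L[ℝ] F) u) horbit
    exact (congrArg (· + (C.fundVec (τ y) δ : F)) hmfderiv).trans hw.symm
  rw [hmap, orbit_parOne]

end CartanGeometry
end Fibres

/-! ### Metrics from hermitian matrices -/

section SesquilinearForms

open Matrix

variable {n : Type*} [Fintype n]

/-- The sesquilinear form with matrix `K` on `ℂⁿ`, linear in the first argument. -/
def sesqForm (K : Matrix n n ℂ) (x y : n → ℂ) : ℂ := x ⬝ᵥ K *ᵥ star y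

variable (K : Matrix n n ℂ) (x y z : n → ℂ)

theorem sesqForm_eq_sum : sesqForm K x y = ∑ i, ∑ j, K i j * x i * conj (y j) := by
  simp only [sesqForm, dotProduct, mulVec, Finset.mul_sum, Pi.star_apply]
  exact Finset.sum_congr rfl fun i _ => Finset.sum_congr rfl fun j _ => by
    rw [starRingEnd_apply]
    ring

theorem sesqForm_add_left : sesqForm K (x + y) z = sesqForm K x z + sesqForm K y z :=
  add_dotProduct _ _ _

theorem sesqForm_add_right : sesqForm K x (y + z) = sesqForm K x y + sesqForm K x z := by
  simp only [sesqForm, star_add, mulVec_add, dotProduct_add]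

theorem sesqForm_smul_left (c : ℂ) : sesqForm K (c • x) y = c * sesqForm K x y :=
  smul_dotProduct _ _ _

theorem sesqForm_smul_right (c : ℂ) : sesqForm K x (c • y) = conj c * sesqForm K x y := by
  simp only [sesqForm, star_smul, mulVec_smul, dotProduct_smul, smul_eq_mul, starRingEnd_apply]

theorem conj_sesqForm {K : Matrix n n ℂ} (hK : K.IsHermitian) :
    conj (sesqForm K x y) = sesqForm K y x := by
  rw [starRingEnd_apply, sesqForm, ← star_dotProduct_star, star_mulVec, star_star, hK.eq,
    ← dotProduct_mulVec, sesqForm]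

theorem ext_sesqForm {K K' : Matrix n n ℂ} (h : ∀ x y, sesqForm K x y = sesqForm K' x y) :
    K = K' := by
  classical
  ext i j
  have hstar : star (Pi.single j 1 : n → ℂ) = Pi.single j 1 := by
    rw [← Pi.single_star, star_one]
  simpa [sesqForm, hstar] using h (Pi.single i 1) (Pi.single j 1)

theorem sesqForm_mulVec_left (N : Matrix n n ℂ) :
    sesqForm K (N *ᵥ x) y = sesqForm (Nᵀ * K) x y := by
  rw [sesqForm, sesqForm, ← mulVec_mulVec, dotProduct_mulVec x, vecMul_transpose]

theorem sesqForm_mulVec_right (N : Matrix n n ℂ) :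
    sesqForm K x (N *ᵥ y) = sesqForm (K * Nᵀᴴ) x y := by
  rw [sesqForm, sesqForm, ← mulVec_mulVec, star_mulVec, ← mulVec_transpose,
    conjTranspose_transpose_eq_transpose_conjTranspose]

theorem sesqForm_add (K' : Matrix n n ℂ) :
    sesqForm (K + K') x y = sesqForm K x y + sesqForm K' x y := by
  rw [sesqForm, add_mulVec, dotProduct_add]
  rfl

open scoped ComplexOrder in
theorem eq_zero_of_sesqForm_re_eq_zero [DecidableEq n] {K : Matrix n n ℂ} (hK : K.det ≠ 0)
    {x : n → ℂ} (h : ∀ y, (sesqForm K x y).re = 0) : x = 0 := by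
  have hself : sesqForm K x (x ᵥ* K) = (x ᵥ* K) ⬝ᵥ star (x ᵥ* K) := dotProduct_mulVec _ _ _
  have hnonneg : 0 ≤ sesqForm K x (x ᵥ* K) := hself ▸ dotProduct_self_star_nonneg _
  refine eq_zero_of_vecMul_eq_zero hK (dotProduct_self_star_eq_zero.1 ?_)
  rw [← hself]
  exact Complex.ext (h _) (Complex.nonneg_iff.1 hnonneg).2.symm

theorem hasDerivAt_sesqForm {K : ℝ → Matrix n n ℂ} {K' : Matrix n n ℂ} {x y : ℝ → n → ℂ}
    {x' y' : n → ℂ} {t : ℝ} (hK : ∀ i j, HasDerivAt (fun s => K s i j) (K' i j) t)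
    (hx : HasDerivAt x x' t) (hy : HasDerivAt y y' t) :
    HasDerivAt (fun s => sesqForm (K s) (x s) (y s))
      (sesqForm K' (x t) (y t) + sesqForm (K t) x' (y t) + sesqForm (K t) (x t) y') t := by
  simp only [sesqForm_eq_sum, ← Finset.sum_add_distrib]
  refine HasDerivAt.fun_sum fun i _ => HasDerivAt.fun_sum fun j _ => ?_
  refine (((hK i j).fun_mul (hasDerivAt_pi.1 hx i)).fun_mul
    (hasDerivAt_pi.1 hy j).star).congr_deriv ?_
  simp only [starRingEnd_apply]
  ring

end SesquilinearForms

section MetricForm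

open Matrix

/-- The real part of the sesquilinear form of `K`, divided by the square of the determinant. -/
def metricForm (K : Matrix (Fin 2) (Fin 2) ℂ) : CSq →L[ℝ] CSq →L[ℝ] ℝ :=
  (LinearMap.mk₂ ℝ (fun x y => (sesqForm K x y).re / K.det.re ^ 2)
    (fun x y z => by rw [sesqForm_add_left, Complex.add_re, add_div])
    (fun c x y => by
      rw [← Complex.coe_smul, sesqForm_smul_left, Complex.re_ofReal_mul, mul_div_assoc,
        smul_eq_mul])
    (fun x y z => by rw [sesqForm_add_right, Complex.add_re, add_div])
    (fun c x y => by
      rw [← Complex.coe_smul, sesqForm_smul_right, Complex.conj_ofReal, Complex.re_ofReal_mul,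
        mul_div_assoc, smul_eq_mul])).toContinuousBilinearMap

variable {K : Matrix (Fin 2) (Fin 2) ℂ}

theorem metricForm_apply (x y : CSq) :
    metricForm K x y = (sesqForm K x y).re / K.det.re ^ 2 := rfl

theorem metricForm_comm (hK : K.IsHermitian) (x y : CSq) : metricForm K x y = metricForm K y x := by
  rw [metricForm_apply, metricForm_apply, ← conj_sesqForm x y hK, Complex.conj_re]

theorem metricForm_I_smul_I_smul (x y : CSq) :
    metricForm K (Complex.I • x) (Complex.I • y) = metricForm K x y := by
  rw [metricForm_apply, sesqForm_smul_left, sesqForm_smul_right, ← mul_assoc, Complex.mul_conj,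
    Complex.normSq_I, Complex.ofReal_one, one_mul, metricForm_apply]

theorem eq_zero_of_metricForm_eq_zero (hK : K.det.re ≠ 0) {x : CSq}
    (h : ∀ y, metricForm K x y = 0) : x = 0 :=
  eq_zero_of_sesqForm_re_eq_zero (ne_of_apply_ne Complex.re hK) fun y =>
    (div_eq_zero_iff.1 (h y)).resolve_right (pow_ne_zero 2 hK)

theorem contDiffAt_metricForm {r : (Fin 2 → Fin 2 → ℂ) × CSq × CSq}
    (hr : (Matrix.of r.1).det.re ≠ 0) :
    ContDiffAt ℝ ∞ (fun r : (Fin 2 → Fin 2 → ℂ) × CSq × CSq =>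
      metricForm (Matrix.of r.1) r.2.1 r.2.2) r := by
  simp only [metricForm_apply, sesqForm_eq_sum, det_fin_two, of_apply] at hr ⊢
  have hentry (i j : Fin 2) : ContDiff ℝ ∞ fun r : (Fin 2 → Fin 2 → ℂ) × CSq × CSq => r.1 i j := by
    fun_prop
  have hleft (i : Fin 2) : ContDiff ℝ ∞ fun r : (Fin 2 → Fin 2 → ℂ) × CSq × CSq => r.2.1 i := by
    fun_prop
  have hright (j : Fin 2) :
      ContDiff ℝ ∞ fun r : (Fin 2 → Fin 2 → ℂ) × CSq × CSq => conj (r.2.2 j) :=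
    Complex.conjCLE.contDiff.comp (by fun_prop)
  refine ContDiffAt.div ?_ ?_ (pow_ne_zero 2 hr)
  · have hsum : ContDiff ℝ ∞ fun r : (Fin 2 → Fin 2 → ℂ) × CSq × CSq =>
        ∑ i, ∑ j, r.1 i j * r.2.1 i * conj (r.2.2 j) :=
      ContDiff.sum fun i _ => ContDiff.sum fun j _ => ((hentry i j).mul (hleft i)).mul (hright j)
    exact (Complex.reCLM.contDiff.comp hsum).contDiffAt
  · exact ((Complex.reCLM.contDiff.comp (((hentry 0 0).mul (hentry 1 1)).sub
      ((hentry 0 1).mul (hentry 1 0)))).pow 2).contDiffAt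

/-- The trace terms come from the determinant in the denominator of `metricForm`. -/
theorem hasDerivAt_metricForm {K : ℝ → Matrix (Fin 2) (Fin 2) ℂ} {N : Matrix (Fin 2) (Fin 2) ℂ}
    {y z : ℝ → CSq} {y' z' : CSq} {t : ℝ}
    (hK : ∀ i j, HasDerivAt (fun s => K s i j) ((Nᵀ * K t + K t * Nᵀᴴ) i j) t)
    (hy : HasDerivAt y y' t) (hz : HasDerivAt z z' t) (hdet : (K t).det.re ≠ 0) :
    HasDerivAt (fun s => metricForm (K s) (y s) (z s))
      (metricForm (K t) (y' + N *ᵥ y t - (2 * N.trace) • y t) (z t) +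
        metricForm (K t) (y t) (z' + N *ᵥ z t - (2 * N.trace) • z t)) t := by
  have hdetK : HasDerivAt (fun s => (K s).det.re) (2 * N.trace.re * (K t).det.re) t := by
    have hminors := ((hK 0 0).fun_mul (hK 1 1)).fun_sub ((hK 0 1).fun_mul (hK 1 0))
    simp only [det_fin_two]
    refine (Complex.reCLM.hasFDerivAt.comp_hasDerivAt t hminors).congr_deriv ?_
    have htrace : ((2 * N.trace.re : ℝ) : ℂ) = N.trace + star N.trace := by
      rw [← starRingEnd_apply, Complex.add_conj]
    rw [← Complex.re_ofReal_mul, htrace, Complex.reCLM_apply, trace_fin_two]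
    congr 1
    simp only [Matrix.add_apply, mul_apply, Fin.sum_univ_two, transpose_apply, conjTranspose_apply,
      star_add]
    ring
  have hform := Complex.reCLM.hasFDerivAt.comp_hasDerivAt t (hasDerivAt_sesqForm hK hy hz)
  refine (hform.fun_div (hdetK.fun_pow 2) (pow_ne_zero 2 hdet)).congr_deriv ?_
  have htrace (s : ℂ) : (2 * N.trace * s).re + (s * conj (2 * N.trace)).re =
      4 * N.trace.re * s.re := by
    rw [mul_comm s, ← Complex.add_re, ← add_mul, Complex.add_conj, Complex.re_ofReal_mul,
      two_mul N.trace, Complex.add_re]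
    ring
  simp only [metricForm_apply, sesqForm_add, ← sesqForm_mulVec_left, ← sesqForm_mulVec_right,
    sub_eq_add_neg, ← neg_smul, sesqForm_add_left, sesqForm_add_right, sesqForm_smul_left,
    sesqForm_smul_right, Complex.reCLM_apply, map_neg, neg_mul, Complex.add_re, Complex.neg_re,
    Function.comp_apply]
  field_simp
  linear_combination (K t).det.re * htrace (sesqForm (K t) (y t) (z t))

end MetricForm

/-! ### Solutions along the fibres -/

section Invariance

open Matrix

variable {M : Type*} [TopologicalSpace M] [ChartedSpace CSq M] [IsManifold 𝓘(ℂ, CSq) ω M]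
variable {F : Type*} [NormedAddCommGroup F] [NormedSpace ℝ F]
variable {B : Type*} [TopologicalSpace B] [ChartedSpace F B] [IsManifold 𝓘(ℝ, F) ∞ B]

namespace CartanGeometry

/-- The vector `ε_{si} x^s`. -/
def epsVec (x : CSq) : CSq := ![-x 1, x 0]

/-- The matrix of the functions `h_{i\bar j}` at `b`. -/
def hermMatrix {B : Type*} (hh : Fin 2 → Fin 2 → B → ℂ) (b : B) : Matrix (Fin 2) (Fin 2) ℂ :=
  of fun i j => hh i j b

variable {hh : Fin 2 → Fin 2 → B → ℂ} {hv : Fin 2 → B → ℂ} {U : Set B}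

variable (C : CartanGeometry M (F := F) B)

variable (hh hv U) in
/-- `(h_{i\bar j}, h_i)` is on `U` a smooth solution of the first equation of the rank 9 system, the
metrisability equation that the other two prolong. -/
structure IsHermitianSolutionOn : Prop where
  smooth_hh : ∀ i j, ContMDiffOn 𝓘(ℝ, F) 𝓘(ℝ, ℂ) ∞ (hh i j) U
  smooth_hv : ∀ i, ContMDiffOn 𝓘(ℝ, F) 𝓘(ℝ, ℂ) ∞ (hv i) U
  hermitian : ∀ b ∈ U, ∀ i j, hh i j b = conj (hh j i b)
  eq_hh : ∀ b ∈ U, ∀ v : TangentSpace 𝓘(ℝ, F) b, ∀ i j,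
    mvfderiv 𝓘(ℝ, F) (hh i j) b v =
      2 * hh i j b * ((C.θ00 b v).re : ℂ)
      + (∑ s, hh i s b * conj (C.θm s j b v))
      + (∑ s, hh s j b * C.θm s i b v)
      + hv i b * (∑ s, conj (eps s j * C.θc s b v))
      + conj (hv j b) * ∑ s, eps s i * C.θc s b v

theorem IsSolutionOn.isHermitianSolutionOn {C : CartanGeometry M (F := F) B} {h : B → ℝ}
    (hsol : C.IsSolutionOn hh hv h U) : C.IsHermitianSolutionOn hh hv U :=
  ⟨hsol.smooth_hh, hsol.smooth_hv, hsol.hermitian, hsol.eq_hh⟩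

/-- The matrix of the forms `θ^i_j`, `i, j = 1, 2`. -/
def connMatrix (b : B) (w : TangentSpace 𝓘(ℝ, F) b) : Matrix (Fin 2) (Fin 2) ℂ :=
  (C.form b w).submatrix Fin.succ Fin.succ

/-- The matrix of the forms `θ^i_j + θ^0_0 δ^i_j`; it acts on the weighted tensor `h_{i\bar j}`. -/
def twistedConn (b : B) (w : TangentSpace 𝓘(ℝ, F) b) : Matrix (Fin 2) (Fin 2) ℂ :=
  C.connMatrix b w + C.θ00 b w • 1

/-- The soldering form `(θ^1_0, θ^2_0)`. -/
def solderForm (b : B) (w : TangentSpace 𝓘(ℝ, F) b) : CSq := fun i => C.θc i b w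

theorem trace_connMatrix (b : B) (w : TangentSpace 𝓘(ℝ, F) b) :
    (C.connMatrix b w).trace = -C.θ00 b w := by
  have htrace := C.form_trace b w
  rw [trace_fin_three] at htrace
  rw [trace_fin_two]
  exact eq_neg_of_add_eq_zero_right ((add_assoc _ _ _).symm.trans htrace)

theorem trace_twistedConn (b : B) (w : TangentSpace 𝓘(ℝ, F) b) :
    (C.twistedConn b w).trace = C.θ00 b w := by
  rw [twistedConn, trace_add, C.trace_connMatrix, trace_smul, trace_one, smul_eq_mul]
  norm_num
  ring

theorem adjugate_connMatrix (b : B) (w : TangentSpace 𝓘(ℝ, F) b) :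
    (C.connMatrix b w).adjugate = -C.twistedConn b w := by
  have htrace := C.trace_connMatrix b w
  rw [trace_fin_two] at htrace
  rw [adjugate_fin_two, twistedConn, ← neg_eq_iff_eq_neg.2 htrace]
  ext i j
  fin_cases i <;> fin_cases j <;> simp

variable {C}

namespace IsHermitianSolutionOn

theorem isHermitian (hsol : C.IsHermitianSolutionOn hh hv U) {b : B} (hb : b ∈ U) :
    (hermMatrix hh b).IsHermitian :=
  Matrix.ext fun i j => (hsol.hermitian b hb i j).symm

theorem det_hermMatrix (hsol : C.IsHermitianSolutionOn hh hv U) {b : B} (hb : b ∈ U) :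
    (hermMatrix hh b).det = hdet hh b := by
  have hdiag (i : Fin 2) : ((hh i i b).re : ℂ) = hh i i b :=
    Complex.conj_eq_iff_re.1 (hsol.hermitian b hb i i).symm
  rw [det_fin_two]
  change hh 0 0 b * hh 1 1 b - hh 0 1 b * hh 1 0 b = _
  rw [hsol.hermitian b hb 1 0, Complex.mul_conj, Complex.normSq_eq_norm_sq, hdet,
    Complex.ofReal_sub, ← hdiag 0, ← hdiag 1, ← Complex.ofReal_mul, Complex.ofReal_re]

theorem contMDiffAt (hsol : C.IsHermitianSolutionOn hh hv U) (hUo : IsOpen U) {b : B} (hb : b ∈ U)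
    (i j : Fin 2) : ContMDiffAt 𝓘(ℝ, F) 𝓘(ℝ, ℂ) ∞ (hh i j) b :=
  (hsol.smooth_hh i j b hb).contMDiffAt (hUo.mem_nhds hb)

theorem mvfderiv_hermMatrix (hsol : C.IsHermitianSolutionOn hh hv U) {b : B} (hb : b ∈ U)
    (w : TangentSpace 𝓘(ℝ, F) b) (i j : Fin 2) :
    mvfderiv 𝓘(ℝ, F) (hh i j) b w =
      ((C.twistedConn b w)ᵀ * hermMatrix hh b + hermMatrix hh b * (C.twistedConn b w)ᵀᴴ
        + vecMulVec (fun k => hv k b) (star (epsVec (C.solderForm b w)))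
        + vecMulVec (epsVec (C.solderForm b w)) (star fun k => hv k b) :
          Matrix (Fin 2) (Fin 2) ℂ) i j := by
  have hre : 2 * ((C.θ00 b w).re : ℂ) = C.θ00 b w + conj (C.θ00 b w) := by
    rw [Complex.add_conj, Complex.ofReal_mul, Complex.ofReal_ofNat]
  rw [hsol.eq_hh b hb, mul_right_comm, hre]
  simp only [Matrix.add_apply, mul_apply, Fin.sum_univ_two, vecMulVec_apply]
  fin_cases i <;> fin_cases j <;>
    simp [epsVec, solderForm, twistedConn, connMatrix, hermMatrix, eps, θm] <;> ring

end IsHermitianSolutionOn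

theorem connMatrix_orbit (b : B) {q : Par} (hq : pdet q ≠ 0) (δ : Par) :
    Matrix.of q.1 * C.connMatrix (C.orbit b q) (mfderiv 𝓘(ℝ, Par) 𝓘(ℝ, F) (C.orbit b) q δ)
      = Matrix.of δ.1 := by
  have hform := C.coverMatrix_mul_form_orbit b hq δ
  ext i j
  have hij := congrFun (congrFun hform i.succ) j.succ
  rw [mul_apply, Fin.sum_univ_succ] at hij
  fin_cases i <;> fin_cases j <;>
    simpa [mul_apply, coverMatrix, coverDeriv, connMatrix] using hij

theorem solderForm_orbit (b : B) {q : Par} (hq : pdet q ≠ 0) (δ : Par) :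
    C.solderForm (C.orbit b q) (mfderiv 𝓘(ℝ, Par) 𝓘(ℝ, F) (C.orbit b) q δ) = 0 := by
  refine eq_zero_of_mulVec_eq_zero (M := Matrix.of q.1) (by rwa [det_fin_two]) (funext fun i => ?_)
  have hi := congrFun (congrFun (C.coverMatrix_mul_form_orbit b hq δ) i.succ) 0
  rw [mul_apply, Fin.sum_univ_succ] at hi
  fin_cases i <;>
    simpa [mulVec, dotProduct, coverMatrix, coverDeriv, solderForm, θc] using hi

theorem epsVec_zero : epsVec 0 = 0 := by
  ext i
  fin_cases i <;> simp [epsVec]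

theorem hasDerivAt_comp_orbit {f : B → ℂ} (b : B) {ℓ : ℝ → Par} {δ : Par} {t : ℝ}
    (hℓt : pdet (ℓ t) ≠ 0) (hℓ : HasDerivAt ℓ δ t)
    (hf : MDifferentiableAt 𝓘(ℝ, F) 𝓘(ℝ, ℂ) f (C.orbit b (ℓ t))) :
    HasDerivAt (fun s => f (C.orbit b (ℓ s)))
      (mvfderiv 𝓘(ℝ, F) f (C.orbit b (ℓ t)) (mfderiv 𝓘(ℝ, Par) 𝓘(ℝ, F) (C.orbit b) (ℓ t) δ)) t :=
  have horbit := ((C.contMDiffAt_orbit b hℓt).mdifferentiableAt (by simp)).hasMFDerivAt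
  (hf.hasMFDerivAt.comp (ℓ t) horbit).hasFDerivAt.comp_hasDerivAt t hℓ

theorem hasDerivAt_adjugate_mulVec {ℓ : ℝ → Par} {δ : Par} {t : ℝ} (hℓ : HasDerivAt ℓ δ t)
    (x : CSq) :
    HasDerivAt (fun s => (Matrix.of (ℓ s).1).adjugate *ᵥ x) ((Matrix.of δ.1).adjugate *ᵥ x) t := by
  have hentry (i j : Fin 2) : HasDerivAt (fun s => (ℓ s).1 i j) (δ.1 i j) t :=
    hasDerivAt_pi.1 (hasDerivAt_pi.1 hℓ.fst i) j
  refine hasDerivAt_pi.2 (Fin.forall_fin_two.2 ⟨?_, ?_⟩) <;>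
    simp only [adjugate_fin_two, mulVec, dotProduct, Fin.sum_univ_two, of_apply, cons_val_zero,
      cons_val_one]
  · exact ((hentry 1 1).mul_const _).fun_add ((hentry 0 1).fun_neg.mul_const _)
  · exact ((hentry 1 0).fun_neg.mul_const _).fun_add ((hentry 0 0).mul_const _)

namespace IsHermitianSolutionOn

theorem hasDerivAt_sesqForm_orbit (hsol : C.IsHermitianSolutionOn hh hv U) (hUo : IsOpen U) (b : B)
    {ℓ : ℝ → Par} {δ : Par} {t : ℝ} (hℓt : pdet (ℓ t) ≠ 0) (hℓ : HasDerivAt ℓ δ t)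
    (hU : C.orbit b (ℓ t) ∈ U) (x y : CSq) :
    HasDerivAt (fun s => sesqForm (hermMatrix hh (C.orbit b (ℓ s)))
      ((Matrix.of (ℓ s).1).adjugate *ᵥ x) ((Matrix.of (ℓ s).1).adjugate *ᵥ y)) 0 t := by
  set w := mfderiv 𝓘(ℝ, Par) 𝓘(ℝ, F) (C.orbit b) (ℓ t) δ
  set N := C.twistedConn (C.orbit b (ℓ t)) w
  have hadj (z : CSq) : (Matrix.of δ.1).adjugate *ᵥ z =
      -(N *ᵥ (Matrix.of (ℓ t).1).adjugate *ᵥ z) := by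
    rw [← C.connMatrix_orbit b hℓt δ, adjugate_mul_distrib, adjugate_connMatrix, neg_mul,
      neg_mulVec, mulVec_mulVec]
  have hK (i j : Fin 2) : HasDerivAt (fun s => hermMatrix hh (C.orbit b (ℓ s)) i j)
      ((Nᵀ * hermMatrix hh (C.orbit b (ℓ t)) + hermMatrix hh (C.orbit b (ℓ t)) * Nᵀᴴ) i j) t := by
    refine (C.hasDerivAt_comp_orbit b hℓt hℓ
      ((hsol.contMDiffAt hUo hU i j).mdifferentiableAt (by simp))).congr_deriv ?_
    rw [hsol.mvfderiv_hermMatrix hU, C.solderForm_orbit b hℓt δ, epsVec_zero, star_zero,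
      vecMulVec_zero, zero_vecMulVec, add_zero, add_zero]
  refine (hasDerivAt_sesqForm hK (hasDerivAt_adjugate_mulVec hℓ x)
    (hasDerivAt_adjugate_mulVec hℓ y)).congr_deriv ?_
  rw [hadj, hadj, sesqForm_add, ← sesqForm_mulVec_left, ← sesqForm_mulVec_right, add_assoc,
    add_add_add_comm, ← sesqForm_add_left, ← sesqForm_add_right, add_neg_cancel, add_neg_cancel]
  simp [sesqForm]

theorem sesqForm_hermMatrix_orbit (hsol : C.IsHermitianSolutionOn hh hv U) (hUo : IsOpen U) (b : B)
    {q : Par} (hq : ∀ t ∈ Icc (0 : ℝ) 1, pdet (parOne + t • (q - parOne)) ≠ 0 ∧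
      C.orbit b (parOne + t • (q - parOne)) ∈ U) (x y : CSq) :
    sesqForm (hermMatrix hh (C.orbit b q)) ((Matrix.of q.1).adjugate *ᵥ x)
      ((Matrix.of q.1).adjugate *ᵥ y) = sesqForm (hermMatrix hh b) x y := by
  let ℓ : ℝ → Par := fun t => parOne + t • (q - parOne)
  have hℓ (t : ℝ) : HasDerivAt ℓ (q - parOne) t :=
    (((hasDerivAt_id t).smul_const _).const_add _).congr_deriv (one_smul ℝ _)
  have hder (t : ℝ) (ht : t ∈ Icc (0 : ℝ) 1) :=
    hsol.hasDerivAt_sesqForm_orbit hUo b (hq t ht).1 (hℓ t) (hq t ht).2 x y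
  have hone : Matrix.of parOne.1 = 1 := by
    ext i j
    fin_cases i <;> fin_cases j <;> simp [parOne]
  have hconst := constant_of_has_deriv_right_zero
    (fun t ht => (hder t ht).continuousAt.continuousWithinAt)
    (fun t ht => (hder t (Ico_subset_Icc_self ht)).hasDerivWithinAt) 1 (right_mem_Icc.2 zero_le_one)
  simpa [ℓ, hone] using hconst

theorem det_hermMatrix_orbit (hsol : C.IsHermitianSolutionOn hh hv U) (hUo : IsOpen U) (b : B)
    {q : Par} (hq : ∀ t ∈ Icc (0 : ℝ) 1, pdet (parOne + t • (q - parOne)) ≠ 0 ∧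
      C.orbit b (parOne + t • (q - parOne)) ∈ U) :
    (hermMatrix hh b).det = pdet q * conj (pdet q) * (hermMatrix hh (C.orbit b q)).det := by
  set N := (Matrix.of q.1).adjugate
  have hcongr : hermMatrix hh b = Nᵀ * hermMatrix hh (C.orbit b q) * Nᵀᴴ :=
    ext_sesqForm fun x y => by
      rw [← sesqForm_mulVec_right, ← sesqForm_mulVec_left, hsol.sesqForm_hermMatrix_orbit hUo b hq]
  have hdet : N.det = pdet q := by
    rw [det_adjugate, Fintype.card_fin, pow_one, det_fin_two]
    rfl
  rw [hcongr, det_mul, det_mul, det_conjTranspose, det_transpose, hdet, starRingEnd_apply]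
  ring

end IsHermitianSolutionOn

end CartanGeometry
end Invariance

section Soldering

open Matrix

variable {M : Type*} [TopologicalSpace M] [ChartedSpace CSq M] [IsManifold 𝓘(ℂ, CSq) ω M]
variable {F : Type*} [NormedAddCommGroup F] [NormedSpace ℝ F]
variable {B : Type*} [TopologicalSpace B] [ChartedSpace F B] [IsManifold 𝓘(ℝ, F) ∞ B]

/-- The map `w ↦ A₀₀ a⁻¹ w`, where `a` is the lower right block of `A`: it is the soldering form
`(θ^i_0)` along an adapted section, in the coordinates of the chart. -/
def solderL (A : SL3) : CSq →L[ℂ] CSq :=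
  (A.1 0 0 • (A.1.submatrix Fin.succ Fin.succ)⁻¹.mulVecLin).toContinuousLinearMap

theorem solderL_apply (A : SL3) (w : CSq) :
    solderL A w = A.1 0 0 • (A.1.submatrix Fin.succ Fin.succ)⁻¹ *ᵥ w := rfl

theorem mulVec_eq_smul_iff {A : SL3} (hA : toPSL A ∈ P) {x w : CSq} :
    A.1.submatrix Fin.succ Fin.succ *ᵥ x = A.1 0 0 • w ↔ x = solderL A w := by
  have hunit : IsUnit (A.1.submatrix Fin.succ Fin.succ).det := by
    rw [isUnit_iff_ne_zero, det_fin_two]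
    exact pdet_parOf_ne_zero hA
  rw [solderL_apply, ← mulVec_smul]
  constructor
  · intro h
    rw [← h, mulVec_mulVec, nonsing_inv_mul _ hunit, one_mulVec]
  · rintro rfl
    rw [mulVec_mulVec, mul_nonsing_inv _ hunit, one_mulVec]

theorem solderL_bijective {A : SL3} (hA : toPSL A ∈ P) : Function.Bijective (solderL A) := by
  have hA₀ : A.1 0 0 ≠ 0 := left_ne_zero_of_mul (mul_pdet_parOf hA ▸ one_ne_zero)
  refine ⟨fun w w' h => smul_right_injective CSq hA₀
    (((mulVec_eq_smul_iff hA).2 rfl).symm.trans ((mulVec_eq_smul_iff hA).2 h)), fun x =>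
    ⟨(A.1 0 0)⁻¹ • A.1.submatrix Fin.succ Fin.succ *ᵥ x, ((mulVec_eq_smul_iff hA).1 ?_).symm⟩⟩
  rw [smul_inv_smul₀ hA₀]

namespace CartanGeometry

variable (C : CartanGeometry M (F := F) B)

open Classical in
/-- The map `T_x M → ℂ²`, `x = π b`, through which the soldering form at `b` factors. -/
def solder (b : B) : CSq →L[ℝ] CSq :=
  if h : ∃ L : CSq →L[ℝ] CSq, ∀ w,
    L (mfderiv 𝓘(ℝ, F) 𝓘(ℝ, CSq) C.proj b w) = C.solderForm b w
  then h.choose else 0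

theorem mulVec_solderForm_orbit (b : B) {q : Par} (hq : pdet q ≠ 0)
    (w : TangentSpace 𝓘(ℝ, F) b) :
    Matrix.of q.1 *ᵥ C.solderForm (C.orbit b q)
        (mfderiv 𝓘(ℝ, F) 𝓘(ℝ, F) (fun b' => C.orbit b' q) b w) =
      (pdet q)⁻¹ • C.solderForm b w := by
  have hform : coverMatrix q.1 q.2 * C.form (C.orbit b q)
        (mfderiv 𝓘(ℝ, F) 𝓘(ℝ, F) (fun b' => C.orbit b' q) b w) =
      C.form b w * coverMatrix q.1 q.2 := by
    unfold orbit
    rw [cover_eq q hq]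
    exact C.mul_form_mfderiv_act (toPSL_coverSL_mem q hq) b w
  ext i
  have hi := congrFun (congrFun hform i.succ) 0
  simp only [mul_apply, Fin.sum_univ_succ] at hi
  fin_cases i <;>
    simpa [mulVec, dotProduct, coverMatrix, solderForm, θc, pdet, mul_comm] using hi

variable {C} {cov : Conn M}

namespace IsAdaptedSection

variable {x₀ y : M} {A : SL3} {τ : M → B}

theorem solderForm_eq (h : C.IsAdaptedSection cov x₀ A τ) (hy : y ∈ (chartAt CSq x₀).source)
    (w : TangentSpace 𝓘(ℝ, F) (τ y)) :
    C.solderForm (τ y) w =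
      solderL A (chartDeriv x₀ y (mfderiv 𝓘(ℝ, F) 𝓘(ℝ, CSq) C.proj (τ y) w)) :=
  (mulVec_eq_smul_iff h.mem).1 (funext (h.sum_mul_θc hy w))

theorem solder_eq (h : C.IsAdaptedSection cov x₀ A τ) (hy : y ∈ (chartAt CSq x₀).source)
    (u : CSq) : C.solder (τ y) u = solderL A (chartDeriv x₀ y u) := by
  have hex : ∃ L : CSq →L[ℝ] CSq, ∀ w,
      L (mfderiv 𝓘(ℝ, F) 𝓘(ℝ, CSq) C.proj (τ y) w) = C.solderForm (τ y) w :=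
    ⟨((solderL A).restrictScalars ℝ).comp (chartDeriv x₀ y),
      fun w => (h.solderForm_eq hy w).symm⟩
  have hspec := (hex.choose_spec (mfderiv 𝓘(ℝ, CSq) 𝓘(ℝ, F) τ y u)).trans (h.solderForm_eq hy _)
  rw [h.mfderiv_proj hy u] at hspec
  rw [solder, dif_pos hex]
  exact hspec

end IsAdaptedSection

namespace IsGeometryOf

theorem solder_mfderiv_proj (hC : C.IsGeometryOf cov) (b : B) (w : TangentSpace 𝓘(ℝ, F) b) :
    C.solder b (mfderiv 𝓘(ℝ, F) 𝓘(ℝ, CSq) C.proj b w) = C.solderForm b w := by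
  obtain ⟨A, τ, hτ, hb⟩ := hC.exists_isAdaptedSection b
  have hx := mem_chart_source CSq (C.proj b)
  generalize C.proj b = x at *
  subst hb
  exact (hτ.solder_eq hx _).trans (hτ.solderForm_eq hx w).symm

theorem mfderiv_proj_surjective (hC : C.IsGeometryOf cov) (b : B) :
    Function.Surjective (mfderiv 𝓘(ℝ, F) 𝓘(ℝ, CSq) C.proj b) := by
  obtain ⟨A, τ, hτ, hb⟩ := hC.exists_isAdaptedSection b
  have hx := mem_chart_source CSq (C.proj b)
  generalize C.proj b = x at *
  subst hb
  exact fun u => ⟨_, hτ.mfderiv_proj hx u⟩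

theorem solder_orbit (hC : C.IsGeometryOf cov) (b : B) {q : Par} (hq : pdet q ≠ 0) (u : CSq) :
    C.solder b u = pdet q • Matrix.of q.1 *ᵥ C.solder (C.orbit b q) u := by
  obtain ⟨w, rfl⟩ := hC.mfderiv_proj_surjective b u
  have hact : MDifferentiableAt 𝓘(ℝ, F) 𝓘(ℝ, F) (fun b' => C.orbit b' q) b := by
    simp only [orbit, cover_eq q hq]
    exact (C.contMDiff_act (toPSL_coverSL_mem q hq) b).mdifferentiableAt (by simp)
  have hproj := mfderiv_comp_apply b
    ((C.proj_smooth (C.orbit b q)).mdifferentiableAt (by simp)) hact w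
  have hinv : (C.proj ∘ fun b' => C.orbit b' q) = C.proj := funext fun b' => C.proj_act _ _
  rw [hinv] at hproj
  have horbit := (congrArg (C.solder (C.orbit b q)) hproj).trans
    (hC.solder_mfderiv_proj (C.orbit b q) _)
  rw [horbit, C.mulVec_solderForm_orbit b hq, smul_inv_smul₀ hq]
  exact hC.solder_mfderiv_proj b w

end IsGeometryOf

/-- The bilinear form on the tangent space of `M` at `π b` whose pullback to `b` is the
polarisation of `quadForm`. -/
def bform (C : CartanGeometry M (F := F) B) (hh : Fin 2 → Fin 2 → B → ℂ) (b : B) :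
    CSq →L[ℝ] CSq →L[ℝ] ℝ :=
  (metricForm (hermMatrix hh b)).bilinearComp (C.solder b) (C.solder b)

theorem bform_apply (C : CartanGeometry M (F := F) B) (hh : Fin 2 → Fin 2 → B → ℂ) (b : B)
    (u v : CSq) :
    C.bform hh b u v = metricForm (hermMatrix hh b) (C.solder b u) (C.solder b v) := rfl

namespace IsGeometryOf

variable {hh : Fin 2 → Fin 2 → B → ℂ} {hv : Fin 2 → B → ℂ} {U : Set B} {b : B}

theorem quadForm_eq_bform (hC : C.IsGeometryOf cov)
    (hsol : C.IsHermitianSolutionOn hh hv U) (hb : b ∈ U) (w : TangentSpace 𝓘(ℝ, F) b) :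
    C.quadForm hh b w = C.bform hh b (mfderiv 𝓘(ℝ, F) 𝓘(ℝ, CSq) C.proj b w)
      (mfderiv 𝓘(ℝ, F) 𝓘(ℝ, CSq) C.proj b w) := by
  have hbform := congrArg (fun x : CSq => metricForm (hermMatrix hh b) x x)
    (hC.solder_mfderiv_proj b w)
  refine Eq.trans ?_ hbform.symm
  rw [metricForm_apply, sesqForm_eq_sum, hsol.det_hermMatrix hb, Complex.ofReal_re]
  rfl

theorem bform_orbit (hC : C.IsGeometryOf cov) (hsol : C.IsHermitianSolutionOn hh hv U)
    (hUo : IsOpen U) {q : Par} (hq : ∀ t ∈ Icc (0 : ℝ) 1, pdet (parOne + t • (q - parOne)) ≠ 0 ∧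
      C.orbit b (parOne + t • (q - parOne)) ∈ U) :
    C.bform hh (C.orbit b q) = C.bform hh b := by
  have hpdet : pdet q ≠ 0 := by simpa using (hq 1 (by simp)).1
  have hadj (u : CSq) : (Matrix.of q.1).adjugate *ᵥ C.solder b u =
      pdet q ^ 2 • C.solder (C.orbit b q) u := by
    rw [hC.solder_orbit b hpdet, mulVec_smul, mulVec_mulVec, adjugate_mul, smul_mulVec, one_mulVec,
      smul_smul, det_fin_two, pow_two]
    rfl
  have hdet := hsol.det_hermMatrix_orbit hUo b hq
  rw [Complex.mul_conj] at hdet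
  ext u v
  simp only [bform, ContinuousLinearMap.bilinearComp_apply, metricForm_apply]
  rw [← hsol.sesqForm_hermMatrix_orbit hUo b hq, hadj, hadj, sesqForm_smul_left,
    sesqForm_smul_right, ← mul_assoc, Complex.mul_conj, hdet, Complex.re_ofReal_mul,
    Complex.re_ofReal_mul, map_pow]
  have hpos : Complex.normSq (pdet q) ≠ 0 := by simpa using hpdet
  field_simp

end IsGeometryOf
end CartanGeometry
end Soldering

/-! ### Solutions along adapted sections -/

section MetricDerivative

open Matrix

variable {E : Type*} [NormedAddCommGroup E] [NormedSpace ℝ E]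
variable {N : Type*} [TopologicalSpace N] [ChartedSpace E N]

theorem mvfderiv_metricForm {K : N → Matrix (Fin 2) (Fin 2) ℂ} {y z : N → CSq} {p : N}
    {A : Matrix (Fin 2) (Fin 2) ℂ} {v : TangentSpace 𝓘(ℝ, E) p}
    (hK : MDifferentiableAt 𝓘(ℝ, E) 𝓘(ℝ, Fin 2 → Fin 2 → ℂ) (fun q i j => K q i j) p)
    (hKA : ∀ i j, mvfderiv 𝓘(ℝ, E) (fun q => K q i j) p v = (Aᵀ * K p + K p * Aᵀᴴ) i j)
    (hy : MDifferentiableAt 𝓘(ℝ, E) 𝓘(ℝ, CSq) y p) (hz : MDifferentiableAt 𝓘(ℝ, E) 𝓘(ℝ, CSq) z p)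
    (hdet : (K p).det.re ≠ 0) :
    mvfderiv 𝓘(ℝ, E) (fun q => metricForm (K q) (y q) (z q)) p v =
      metricForm (K p) (mvfderiv 𝓘(ℝ, E) y p v + A *ᵥ y p - (2 * A.trace) • y p) (z p) +
        metricForm (K p) (y p) (mvfderiv 𝓘(ℝ, E) z p v + A *ᵥ z p - (2 * A.trace) • z p) := by
  change E at v
  have hline : chartLine p v 0 = p := chartLine_zero p v
  have hentry (i j : Fin 2) :
      HasDerivAt (fun t => K (chartLine p v t) i j) ((Aᵀ * K p + K p * Aᵀᴴ) i j) 0 := by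
    rw [← hKA]
    have hproj : Differentiable ℝ fun k : Fin 2 → Fin 2 → ℂ => k i j := by fun_prop
    exact hasDerivAt_comp_chartLine (hproj.comp_mdifferentiableAt hK) v
  have hderiv := hasDerivAt_metricForm (K := fun t => K (chartLine p v t)) (N := A) (t := 0)
    (by rwa [hline]) (hasDerivAt_comp_chartLine hy v) (hasDerivAt_comp_chartLine hz v)
    (by rwa [hline])
  rw [hline] at hderiv
  exact mvfderiv_eq_of_hasDerivAt (((contDiffAt_metricForm (r := (fun i j => K p i j, y p, z p))
    hdet).differentiableAt (by simp)).comp_mdifferentiableAt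
      (f := fun q => (fun i j => K q i j, y q, z q))
      (hK.prodMk_space (hy.prodMk_space hz))) hderiv

end MetricDerivative

section MetricAlongSection

open Matrix

variable {M : Type*} [TopologicalSpace M] [ChartedSpace CSq M] [IsManifold 𝓘(ℂ, CSq) ω M]
variable {F : Type*} [NormedAddCommGroup F] [NormedSpace ℝ F]
variable {B : Type*} [TopologicalSpace B] [ChartedSpace F B] [IsManifold 𝓘(ℝ, F) ∞ B]

namespace CartanGeometry

theorem epsVec_dotProduct_smul_add (x y z : CSq) :
    (epsVec x ⬝ᵥ z) • y + (epsVec z ⬝ᵥ y) • x = (epsVec x ⬝ᵥ y) • z := by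
  ext i
  fin_cases i <;> simp [epsVec, dotProduct, Fin.sum_univ_two] <;> ring

variable {C : CartanGeometry M (F := F) B}
variable {hh : Fin 2 → Fin 2 → B → ℂ} {hv : Fin 2 → B → ℂ} {U : Set B}

/-- The vector `ψ` with `h_i = h_{i\bar j} \bar ψ^j`. -/
def hermDual (hh : Fin 2 → Fin 2 → B → ℂ) (hv : Fin 2 → B → ℂ) (b : B) : CSq :=
  star ((hermMatrix hh b)⁻¹ *ᵥ fun k => hv k b)

variable (C hh hv) in
/-- The forms `θ^i_j + θ^0_0 δ^i_j + ψ^i ε_{sj} θ^s_0`, for which the equation for `d h_{i\bar j}`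
has no inhomogeneous term. -/
def metricConn (b : B) (w : TangentSpace 𝓘(ℝ, F) b) : Matrix (Fin 2) (Fin 2) ℂ :=
  C.twistedConn b w + vecMulVec (hermDual hh hv b) (epsVec (C.solderForm b w))

theorem metricConn_mulVec_sub (b : B) (w : TangentSpace 𝓘(ℝ, F) b) (x : CSq) :
    C.metricConn hh hv b w *ᵥ x - (2 * (C.metricConn hh hv b w).trace) • x =
      C.connMatrix b w *ᵥ x + (epsVec (hermDual hh hv b) ⬝ᵥ C.solderForm b w - C.θ00 b w) • x
        + (epsVec (hermDual hh hv b) ⬝ᵥ x) • C.solderForm b w := by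
  have hswap : hermDual hh hv b ⬝ᵥ epsVec (C.solderForm b w) =
      -(epsVec (hermDual hh hv b) ⬝ᵥ C.solderForm b w) := by
    simp only [epsVec, dotProduct, Fin.sum_univ_two, cons_val_zero, cons_val_one]
    ring
  rw [← epsVec_dotProduct_smul_add, metricConn, trace_add, C.trace_twistedConn, trace_vecMulVec,
    hswap, twistedConn, add_mulVec, add_mulVec, vecMulVec_mulVec, op_smul_eq_smul, smul_mulVec,
    one_mulVec]
  module

namespace IsHermitianSolutionOn

theorem mvfderiv_hermMatrix_eq_metricConn (hsol : C.IsHermitianSolutionOn hh hv U) {b : B}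
    (hb : b ∈ U) (hdet : hdet hh b ≠ 0) (w : TangentSpace 𝓘(ℝ, F) b) (i j : Fin 2) :
    mvfderiv 𝓘(ℝ, F) (hh i j) b w =
      ((C.metricConn hh hv b w)ᵀ * hermMatrix hh b
        + hermMatrix hh b * (C.metricConn hh hv b w)ᵀᴴ) i j := by
  have hunit : IsUnit (hermMatrix hh b).det := by
    rw [hsol.det_hermMatrix hb, isUnit_iff_ne_zero]
    exact Complex.ofReal_ne_zero.2 hdet
  have hdual : hermMatrix hh b *ᵥ star (hermDual hh hv b) = fun k => hv k b := by
    rw [hermDual, star_star, mulVec_mulVec, mul_nonsing_inv _ hunit, one_mulVec]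
  have hdual' : hermDual hh hv b ᵥ* hermMatrix hh b = star fun k => hv k b := by
    rw [← hdual, star_mulVec, star_star, (hsol.isHermitian hb).eq]
  rw [hsol.mvfderiv_hermMatrix hb, ← hdual', ← hdual, metricConn, transpose_add, conjTranspose_add,
    transpose_vecMulVec, conjTranspose_vecMulVec, add_mul, mul_add, vecMulVec_mul, mul_vecMulVec]
  exact congrArg (fun X : Matrix (Fin 2) (Fin 2) ℂ => X i j) (by abel)

end IsHermitianSolutionOn

end CartanGeometry

end MetricAlongSection

section LeviCivitaCovector

open Matrix

theorem contDiff_det {n : Type*} [Fintype n] [DecidableEq n] {E : Type*} [NormedAddCommGroup E]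
    [NormedSpace ℝ E] {K : E → Matrix n n ℂ} (hK : ∀ i j, ContDiff ℝ ∞ fun r => K r i j) :
    ContDiff ℝ ∞ fun r => (K r).det := by
  simp only [det_apply, Units.smul_def, zsmul_eq_mul]
  exact ContDiff.sum fun σ _ => contDiff_const.mul (contDiff_prod fun i _ => hK (σ i) i)

theorem contDiffAt_star_inv_mulVec {n : Type*} [Fintype n] [DecidableEq n]
    {r : (n → n → ℂ) × (n → ℂ)} (hr : (of r.1).det ≠ 0) :
    ContDiffAt ℝ ∞ (fun r : (n → n → ℂ) × (n → ℂ) => star ((of r.1)⁻¹ *ᵥ r.2)) r := by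
  have hentry (i j : n) : ContDiff ℝ ∞ fun r : (n → n → ℂ) × (n → ℂ) => of r.1 i j := by
    simp only [of_apply]
    fun_prop
  refine contDiffAt_pi.2 fun i => ContDiffAt.comp r Complex.conjCLE.contDiff.contDiffAt ?_
  have hcramer : ContDiff ℝ ∞ fun r : (n → n → ℂ) × (n → ℂ) => ((of r.1).updateCol i r.2).det := by
    refine contDiff_det fun j k => ?_
    simp only [updateCol_apply]
    split_ifs
    · fun_prop
    · exact hentry j k
  have heq (r : (n → n → ℂ) × (n → ℂ)) : ((of r.1)⁻¹ *ᵥ r.2) i =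
      ((of r.1).det)⁻¹ * ((of r.1).updateCol i r.2).det := by
    rw [inv_def, smul_mulVec, ← cramer_eq_adjugate_mulVec, Pi.smul_apply, cramer_apply,
      Ring.inverse_eq_inv', smul_eq_mul]
  simp only [heq]
  exact ((contDiff_det hentry).contDiffAt.inv hr).mul hcramer.contDiffAt

namespace CartanGeometry

/-- The row vector `A₀₀⁻¹ (A₀₁, A₀₂)`, which relates `θ^0_0` to the soldering form along an adapted
section. -/
def shiftVec (A : SL3) : CSq := (A.1 0 0)⁻¹ • fun k : Fin 2 => A.1 0 k.succ

/-- The complex-bilinear pairing `a ⬝ᵥ w` as a real-bilinear map. -/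
def dotL : CSq →L[ℝ] CSq →L[ℝ] ℂ := (dotProductBilin ℝ ℝ).toContinuousBilinearMap

theorem smul_shiftVec {A : SL3} (hA : toPSL A ∈ P) :
    A.1 0 0 • shiftVec A = fun k : Fin 2 => A.1 0 k.succ :=
  smul_inv_smul₀ (left_ne_zero_of_mul (mul_pdet_parOf hA ▸ one_ne_zero)) _

variable {M : Type*} [TopologicalSpace M] [ChartedSpace CSq M] {B : Type*}

/-- The covector, in the coordinates of the chart at `x₀`, by which `cov` has to be changed to
obtain the Levi-Civita connection of the metric read off along the adapted section `τ`. -/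
def leviCivitaCovector (cov : Conn M) (hh : Fin 2 → Fin 2 → B → ℂ) (hv : Fin 2 → B → ℂ) (x₀ : M)
    (A : SL3) (τ : M → B) (y : M) : CSq →L[ℝ] ℂ :=
  (dotL (epsVec (hermDual hh hv (τ y)) + shiftVec A)).comp ((solderL A).restrictScalars ℝ)
    - dotL (traceCoeff cov x₀ y)

theorem leviCivitaCovector_apply (cov : Conn M) (hh : Fin 2 → Fin 2 → B → ℂ) (hv : Fin 2 → B → ℂ)
    (x₀ : M) (A : SL3) (τ : M → B) (y : M) (w : CSq) :
    leviCivitaCovector cov hh hv x₀ A τ y w =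
      (epsVec (hermDual hh hv (τ y)) + shiftVec A) ⬝ᵥ solderL A w - traceCoeff cov x₀ y ⬝ᵥ w := rfl

variable [IsManifold 𝓘(ℂ, CSq) ω M]

theorem leviCivitaCovector_J {x₀ y : M} (hy : y ∈ (chartAt CSq x₀).source) (cov : Conn M)
    (hh : Fin 2 → Fin 2 → B → ℂ) (hv : Fin 2 → B → ℂ) (A : SL3) (τ : M → B)
    (v : TangentSpace 𝓘(ℝ, CSq) y) :
    leviCivitaCovector cov hh hv x₀ A τ y (chartDeriv x₀ y (J y v)) =
      Complex.I * leviCivitaCovector cov hh hv x₀ A τ y (chartDeriv x₀ y v) := by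
  rw [leviCivitaCovector_apply, leviCivitaCovector_apply, chartDeriv_J hy, map_smul,
    dotProduct_smul, dotProduct_smul, smul_eq_mul, smul_eq_mul, mul_sub]

variable {F : Type*} [NormedAddCommGroup F] [NormedSpace ℝ F]
variable [TopologicalSpace B] [ChartedSpace F B] [IsManifold 𝓘(ℝ, F) ∞ B]
variable {C : CartanGeometry M (F := F) B} {cov : Conn M}
variable {hh : Fin 2 → Fin 2 → B → ℂ} {hv : Fin 2 → B → ℂ} {U : Set B}
variable {x₀ y : M} {A : SL3} {τ : M → B}

namespace IsAdaptedSection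

theorem solderForm_mfderiv (hτ : C.IsAdaptedSection cov x₀ A τ) (hy : y ∈ (chartAt CSq x₀).source)
    (v : TangentSpace 𝓘(ℝ, CSq) y) :
    C.solderForm (τ y) (mfderiv 𝓘(ℝ, CSq) 𝓘(ℝ, F) τ y v) = solderL A (chartDeriv x₀ y v) :=
  (mulVec_eq_smul_iff hτ.mem).1 (funext (hτ.form_col y hy v))

theorem θ00_mfderiv (hτ : C.IsAdaptedSection cov x₀ A τ) (hy : y ∈ (chartAt CSq x₀).source)
    (v : TangentSpace 𝓘(ℝ, CSq) y) :
    C.θ00 (τ y) (mfderiv 𝓘(ℝ, CSq) 𝓘(ℝ, F) τ y v) =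
      -(shiftVec A ⬝ᵥ solderL A (chartDeriv x₀ y v)) := by
  have hA₀ : A.1 0 0 ≠ 0 := left_ne_zero_of_mul (mul_pdet_parOf hτ.mem ▸ one_ne_zero)
  refine mul_left_cancel₀ hA₀ ?_
  rw [mul_neg, ← smul_eq_mul (A.1 0 0) (shiftVec A ⬝ᵥ _), ← smul_dotProduct, smul_shiftVec hτ.mem,
    ← hτ.solderForm_mfderiv hy]
  exact eq_neg_of_add_eq_zero_left (hτ.form_zero y hy v)

theorem solderL_projInvMatrix_mulVec (hτ : C.IsAdaptedSection cov x₀ A τ)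
    (hy : y ∈ (chartAt CSq x₀).source) (v : TangentSpace 𝓘(ℝ, CSq) y) (w : CSq) :
    solderL A (projInvMatrix cov x₀ y (chartDeriv x₀ y v) *ᵥ w) =
      C.connMatrix (τ y) (mfderiv 𝓘(ℝ, CSq) 𝓘(ℝ, F) τ y v) *ᵥ solderL A w
        - (shiftVec A ⬝ᵥ solderL A w) • solderL A (chartDeriv x₀ y v) := by
  have hblock : A.1.submatrix Fin.succ Fin.succ *
        C.connMatrix (τ y) (mfderiv 𝓘(ℝ, CSq) 𝓘(ℝ, F) τ y v) =
      vecMulVec (chartDeriv x₀ y v) (fun k : Fin 2 => A.1 0 k.succ)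
        + projInvMatrix cov x₀ y (chartDeriv x₀ y v) * A.1.submatrix Fin.succ Fin.succ :=
    Matrix.ext (hτ.form_block y hy v)
  refine ((mulVec_eq_smul_iff hτ.mem).1 ?_).symm
  rw [mulVec_sub, mulVec_smul, mulVec_mulVec, hblock, add_mulVec, ← mulVec_mulVec,
    (mulVec_eq_smul_iff hτ.mem).2 rfl, (mulVec_eq_smul_iff hτ.mem).2 rfl, vecMulVec_mulVec,
    op_smul_eq_smul, ← smul_shiftVec hτ.mem, smul_dotProduct, mulVec_smul, smul_eq_mul, smul_smul,
    mul_comm, add_sub_cancel_left]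

theorem bform_eq (hτ : C.IsAdaptedSection cov x₀ A τ) (hy : y ∈ (chartAt CSq x₀).source)
    (hh : Fin 2 → Fin 2 → B → ℂ) (u v : TangentSpace 𝓘(ℝ, CSq) y) :
    C.bform hh (τ y) u v = metricForm (hermMatrix hh (τ y)) (solderL A (chartDeriv x₀ y u))
      (solderL A (chartDeriv x₀ y v)) := by
  refine (C.bform_apply hh (τ y) u v).trans ?_
  exact congrArg₂ (fun a b : CSq => metricForm (hermMatrix hh (τ y)) a b) (hτ.solder_eq hy u)
    (hτ.solder_eq hy v)

end IsAdaptedSection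

theorem mdifferentiableAt_solderL_chartDeriv (A : SL3) (hy : y ∈ (chartAt CSq x₀).source)
    {Y : VField M} (hY : DiffFieldAt Y y) :
    MDifferentiableAt 𝓘(ℝ, CSq) 𝓘(ℝ, CSq) (fun p => solderL A (chartDeriv x₀ p (Y p))) y :=
  ((solderL A).restrictScalars ℝ).differentiable.differentiableAt.mdifferentiableAt.comp y
    ((mdifferentiableAt_field_iff hy Y).1 hY)

theorem IsAdaptedSection.solderL_chartDeriv_cov (hτ : C.IsAdaptedSection cov x₀ A τ)
    (hcov : IsComplexLinearOn cov univ) (hy : y ∈ (chartAt CSq x₀).source) {Y : VField M}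
    (hY : DiffFieldAt Y y) (v : TangentSpace 𝓘(ℝ, CSq) y) :
    solderL A (chartDeriv x₀ y (cov Y y v + projTensor y
        ((leviCivitaCovector cov hh hv x₀ A τ y).comp (chartDeriv x₀ y)) (Y y) v)) =
      mvfderiv 𝓘(ℝ, CSq) (fun p => solderL A (chartDeriv x₀ p (Y p))) y v
        + C.metricConn hh hv (τ y) (mfderiv 𝓘(ℝ, CSq) 𝓘(ℝ, F) τ y v) *ᵥ
          solderL A (chartDeriv x₀ y (Y y))
        - (2 * (C.metricConn hh hv (τ y) (mfderiv 𝓘(ℝ, CSq) 𝓘(ℝ, F) τ y v)).trace) •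
          solderL A (chartDeriv x₀ y (Y y)) := by
  have hderiv := mvfderiv_clm_comp ((solderL A).restrictScalars ℝ)
    ((mdifferentiableAt_field_iff hy Y).1 hY) v
  rw [ContinuousLinearMap.coe_restrictScalars'] at hderiv
  rw [add_sub_assoc, metricConn_mulVec_sub, hτ.solderForm_mfderiv hy, hτ.θ00_mfderiv hy, map_add,
    map_add, projTensor_apply, map_add, chartDeriv_csmul hy, chartDeriv_csmul hy,
    chartDeriv_cov_eq hcov hy hY, hderiv]
  simp only [map_add, map_smul, hτ.solderL_projInvMatrix_mulVec hy, ContinuousLinearMap.comp_apply,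
    leviCivitaCovector_apply, add_dotProduct]
  module

namespace IsHermitianSolutionOn

theorem contMDiffAt_hermMatrix_comp (hsol : C.IsHermitianSolutionOn hh hv U) (hUo : IsOpen U)
    (hτ : C.IsAdaptedSection cov x₀ A τ) (hy : y ∈ (chartAt CSq x₀).source) (hyU : τ y ∈ U) :
    ContMDiffAt 𝓘(ℝ, CSq) 𝓘(ℝ, Fin 2 → Fin 2 → ℂ) ∞ (fun p i j => hermMatrix hh (τ p) i j) y :=
  contMDiffAt_pi_space.2 fun i => contMDiffAt_pi_space.2 fun j =>
    (hsol.contMDiffAt hUo hyU i j).comp y (hτ.contMDiffAt hy)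

theorem mvfderiv_hermMatrix_comp (hsol : C.IsHermitianSolutionOn hh hv U) (hUo : IsOpen U)
    (hτ : C.IsAdaptedSection cov x₀ A τ) (hy : y ∈ (chartAt CSq x₀).source) (hyU : τ y ∈ U)
    (v : TangentSpace 𝓘(ℝ, CSq) y) (i j : Fin 2) :
    mvfderiv 𝓘(ℝ, CSq) (fun p => hermMatrix hh (τ p) i j) y v =
      mvfderiv 𝓘(ℝ, F) (fun b => hermMatrix hh b i j) (τ y)
        (mfderiv 𝓘(ℝ, CSq) 𝓘(ℝ, F) τ y v) :=
  mfderiv_comp_apply (f := τ) (g := fun b => hermMatrix hh b i j) y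
    ((hsol.contMDiffAt hUo hyU i j).mdifferentiableAt (by simp))
    ((hτ.contMDiffAt hy).mdifferentiableAt (by simp)) v

theorem isMetricCovector (hsol : C.IsHermitianSolutionOn hh hv U) (hUo : IsOpen U)
    (hτ : C.IsAdaptedSection cov x₀ A τ) (hcov : IsComplexLinearOn cov univ)
    (hy : y ∈ (chartAt CSq x₀).source) (hyU : τ y ∈ U) (hdet : hdet hh (τ y) ≠ 0)
    {g : BilinField M} (hg : ∀ᶠ p in 𝓝 y, ∀ u v, g p u v = C.bform hh (τ p) u v) :
    IsMetricCovector g cov y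
      ((leviCivitaCovector cov hh hv x₀ A τ y).comp (chartDeriv x₀ y)) where
  complex_linear v := leviCivitaCovector_J hy cov hh hv A τ v
  metric Y Z hY hZ v := by
    have hder := mvfderiv_metricForm
      ((hsol.contMDiffAt_hermMatrix_comp hUo hτ hy hyU).mdifferentiableAt (by simp))
      (fun i j => (hsol.mvfderiv_hermMatrix_comp hUo hτ hy hyU v i j).trans
        (hsol.mvfderiv_hermMatrix_eq_metricConn hyU hdet _ i j))
      (mdifferentiableAt_solderL_chartDeriv A hy hY)
      (mdifferentiableAt_solderL_chartDeriv A hy hZ) (by rwa [hsol.det_hermMatrix hyU])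
    have hg' : ∀ᶠ p in 𝓝 y, ∀ u v, g p u v = metricForm (hermMatrix hh (τ p))
        (solderL A (chartDeriv x₀ p u)) (solderL A (chartDeriv x₀ p v)) := by
      filter_upwards [hg, (chartAt CSq x₀).open_source.mem_nhds hy] with p hp hpx u v
      exact (hp u v).trans (hτ.bform_eq hpx hh u v)
    rw [hg'.self_of_nhds, hg'.self_of_nhds, hτ.solderL_chartDeriv_cov hcov hy hY,
      hτ.solderL_chartDeriv_cov hcov hy hZ]
    refine Eq.trans ?_ hder
    have hYZ : (fun p => g p (Y p) (Z p)) =ᶠ[𝓝 y] fun p => metricForm (hermMatrix hh (τ p))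
        (solderL A (chartDeriv x₀ p (Y p))) (solderL A (chartDeriv x₀ p (Z p))) :=
      hg'.mono fun p hp => hp _ _
    exact DFunLike.congr_fun hYZ.mfderiv_eq v

theorem contMDiffAt_hermDual_comp (hsol : C.IsHermitianSolutionOn hh hv U) (hUo : IsOpen U)
    (hτ : C.IsAdaptedSection cov x₀ A τ) (hy : y ∈ (chartAt CSq x₀).source) (hyU : τ y ∈ U)
    (hdet : hdet hh (τ y) ≠ 0) :
    ContMDiffAt 𝓘(ℝ, CSq) 𝓘(ℝ, CSq) ∞ (fun p => hermDual hh hv (τ p)) y := by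
  have hhv : ContMDiffAt 𝓘(ℝ, CSq) 𝓘(ℝ, CSq) ∞ (fun p j => hv j (τ p)) y :=
    contMDiffAt_pi_space.2 fun j =>
      ((hsol.smooth_hv j _ hyU).contMDiffAt (hUo.mem_nhds hyU)).comp y (hτ.contMDiffAt hy)
  have hdet' : (hermMatrix hh (τ y)).det ≠ 0 := by
    rw [hsol.det_hermMatrix hyU]
    exact Complex.ofReal_ne_zero.2 hdet
  exact ContMDiffAt.comp y (f := fun p => (fun i j => hermMatrix hh (τ p) i j, fun j => hv j (τ p)))
    (contDiffAt_star_inv_mulVec (r := (fun i j => hermMatrix hh (τ y) i j, fun j => hv j (τ y)))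
      hdet').contMDiffAt
    ((hsol.contMDiffAt_hermMatrix_comp hUo hτ hy hyU).prodMk_space hhv)

theorem contMDiffAt_leviCivitaCovector [T2Space M] (hsol : C.IsHermitianSolutionOn hh hv U)
    (hUo : IsOpen U) (hτ : C.IsAdaptedSection cov x₀ A τ) (hcov : IsComplexLinearOn cov univ)
    (hy : y ∈ (chartAt CSq x₀).source) (hyU : τ y ∈ U) (hdet : hdet hh (τ y) ≠ 0) :
    ContMDiffAt 𝓘(ℝ, CSq) 𝓘(ℝ, CSq →L[ℝ] ℂ) ∞ (leviCivitaCovector cov hh hv x₀ A τ) y := by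
  have hdual := hsol.contMDiffAt_hermDual_comp hUo hτ hy hyU hdet
  have hΓ (i j k : Fin 2) := (contMDiffOn_christoffel hcov x₀ i j k).contMDiffAt
    ((chartAt CSq x₀).open_source.mem_nhds hy)
  have htrace : ContMDiffAt 𝓘(ℝ, CSq) 𝓘(ℝ, CSq) ∞ (traceCoeff cov x₀) y :=
    contMDiffAt_pi_space.2 fun k =>
      (ContinuousLinearMap.mul ℝ ℂ (1 / 3)).contMDiff.contMDiffAt.comp y
        (contMDiffAt_finsetSum fun l _ => hΓ l l k)
  have heps : ContDiff ℝ ∞ fun a : CSq => epsVec a + shiftVec A :=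
    (contDiff_pi.2 (Fin.forall_fin_two.2
      ⟨(contDiff_apply ℝ ℂ 1).neg, contDiff_apply ℝ ℂ 0⟩)).add contDiff_const
  have hpair : ContDiff ℝ ∞ fun a : CSq =>
      (dotL (epsVec a + shiftVec A)).comp ((solderL A).restrictScalars ℝ) :=
    (dotL.contDiff.comp heps).clm_comp contDiff_const
  exact (hpair.contMDiff.contMDiffAt.comp y hdual).sub (dotL.contMDiff.contMDiffAt.comp y htrace)

end IsHermitianSolutionOn

end CartanGeometry

end LeviCivitaCovector

/-! ### Descent -/

section Descent

variable {M : Type*} [TopologicalSpace M] [ChartedSpace CSq M] [IsManifold 𝓘(ℂ, CSq) ω M]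
variable {F : Type*} [NormedAddCommGroup F] [NormedSpace ℝ F]
variable {B : Type*} [TopologicalSpace B] [ChartedSpace F B] [IsManifold 𝓘(ℝ, F) ∞ B]

namespace CartanGeometry

variable {C : CartanGeometry M (F := F) B} {cov : Conn M}
variable {hh : Fin 2 → Fin 2 → B → ℂ} {hv : Fin 2 → B → ℂ} {U U' : Set B}
variable {g : BilinField M} {x₀ y : M} {A : SL3} {τ : M → B} {b : B}

namespace IsGeometryOf

theorem exists_isAdaptedSection_eventually_mem (hC : C.IsGeometryOf cov) (hU' : IsOpen U') {x : M}
    (hx : x ∈ C.proj '' U') : ∃ A τ, C.IsAdaptedSection cov x A τ ∧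
      ∀ᶠ y in 𝓝 x, y ∈ (chartAt CSq x).source ∧ τ y ∈ U' := by
  obtain ⟨b, hb, rfl⟩ := hx
  obtain ⟨A, τ, hτ, hτb⟩ := hC.exists_isAdaptedSection b
  have hsource := mem_chart_source CSq (C.proj b)
  exact ⟨A, τ, hτ, inter_mem ((chartAt CSq (C.proj b)).open_source.mem_nhds hsource)
    ((hτ.contMDiffAt hsource).continuousAt.preimage_mem_nhds (hU'.mem_nhds (hτb.symm ▸ hb)))⟩

theorem isOpen_image_proj (hC : C.IsGeometryOf cov) (hU' : IsOpen U') :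
    IsOpen (C.proj '' U') := by
  refine isOpen_iff_mem_nhds.2 fun x hx => ?_
  obtain ⟨A, τ, hτ, hτU'⟩ := hC.exists_isAdaptedSection_eventually_mem hU' hx
  exact hτU'.mono fun y hy => ⟨τ y, hy.2, hτ.proj_eq y hy.1⟩

end IsGeometryOf

variable (C hh) in
/-- The field `g` is the common value of the forms `bform` on each fibre of `U'`. -/
def IsPushforward (U' : Set B) (g : BilinField M) : Prop :=
  ∀ b ∈ U', (g (C.proj b) : CSq →L[ℝ] CSq →L[ℝ] ℝ) = C.bform hh b

theorem exists_isPushforward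
    (hinv : ∀ b ∈ U', ∀ b' ∈ U', C.proj b = C.proj b' → C.bform hh b = C.bform hh b') :
    ∃ g : BilinField M, C.IsPushforward hh U' g := by
  have hfactors : Function.FactorsThrough (fun b : U' => C.bform hh b) fun b : U' => C.proj b :=
    fun b b' hbb' => hinv b b.2 b' b'.2 hbb'
  exact ⟨Function.extend (fun b : U' => C.proj b) (fun b : U' => C.bform hh b) 0,
    fun b hb => hfactors.extend_apply 0 ⟨b, hb⟩⟩

theorem contMDiffAt_solderL_chartDeriv_snd (A : SL3) (v₀ : TangentBundle 𝓘(ℝ, CSq) M) :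
    ContMDiffAt 𝓘(ℝ, CSq).tangent 𝓘(ℝ, CSq) ∞
      (fun v : TangentBundle 𝓘(ℝ, CSq) M => solderL A (chartDeriv v₀.proj v.proj v.snd)) v₀ := by
  have hsnd := (Bundle.contMDiffAt_totalSpace.1
    (contMDiffAt_id (I := 𝓘(ℝ, CSq).tangent) (n := ∞) (x := v₀))).2
  refine (((solderL A).restrictScalars ℝ).contMDiff.contMDiffAt.comp v₀
    hsnd).congr_of_eventuallyEq ?_
  have hsource := (FiberBundle.continuous_proj CSq (TangentSpace 𝓘(ℝ, CSq))).continuousAt.eventually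
    ((chartAt CSq v₀.proj).open_source.mem_nhds (mem_chart_source CSq v₀.proj))
  filter_upwards [hsource] with v hv
  exact congrArg (solderL A) (snd_trivializationAt_eq_chartDeriv hv v.snd).symm

namespace IsPushforward

theorem eq_bform (hg : C.IsPushforward hh U' g) (hτ : C.IsAdaptedSection cov x₀ A τ)
    (hy : y ∈ (chartAt CSq x₀).source) (hyU' : τ y ∈ U') (u v : TangentSpace 𝓘(ℝ, CSq) y) :
    g y u v = C.bform hh (τ y) u v := by
  have hgy : (g y : CSq →L[ℝ] CSq →L[ℝ] ℝ) = C.bform hh (τ y) := by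
    rw [← hg _ hyU', hτ.proj_eq y hy]
  exact congrArg (fun L : CSq →L[ℝ] CSq →L[ℝ] ℝ => L u v) hgy

theorem eq_metricForm (hg : C.IsPushforward hh U' g) (hτ : C.IsAdaptedSection cov x₀ A τ)
    (hy : y ∈ (chartAt CSq x₀).source) (hyU' : τ y ∈ U') (u v : TangentSpace 𝓘(ℝ, CSq) y) :
    g y u v = metricForm (hermMatrix hh (τ y)) (solderL A (chartDeriv x₀ y u))
      (solderL A (chartDeriv x₀ y v)) :=
  (hg.eq_bform hτ hy hyU' u v).trans (hτ.bform_eq hy hh u v)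

theorem hermitian (hg : C.IsPushforward hh U' g) (hC : C.IsGeometryOf cov) (hU' : IsOpen U') {x : M}
    (hx : x ∈ C.proj '' U') (u v : TangentSpace 𝓘(ℝ, CSq) x) :
    g x (J x u) (J x v) = g x u v := by
  obtain ⟨A, τ, hτ, hτU'⟩ := hC.exists_isAdaptedSection_eventually_mem hU' hx
  obtain ⟨hxs, hxU'⟩ := hτU'.self_of_nhds
  rw [hg.eq_metricForm hτ hxs hxU', hg.eq_metricForm hτ hxs hxU', chartDeriv_J hxs,
    chartDeriv_J hxs, map_smul (solderL A),
    map_smul (solderL A), metricForm_I_smul_I_smul]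

variable (hg : C.IsPushforward hh U' g) (hC : C.IsGeometryOf cov)
  (hsol : C.IsHermitianSolutionOn hh hv U) (hU' : IsOpen U') (hsub : U' ⊆ U)
include hg hC hsol hU' hsub

theorem symm {x : M} (hx : x ∈ C.proj '' U') (u v : TangentSpace 𝓘(ℝ, CSq) x) :
    g x u v = g x v u := by
  obtain ⟨A, τ, hτ, hτU'⟩ := hC.exists_isAdaptedSection_eventually_mem hU' hx
  obtain ⟨hxs, hxU'⟩ := hτU'.self_of_nhds
  rw [hg.eq_metricForm hτ hxs hxU', hg.eq_metricForm hτ hxs hxU',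
    metricForm_comm (hsol.isHermitian (hsub hxU'))]

theorem eq_zero_of_forall_eq_zero (hdet : ∀ b ∈ U, hdet hh b ≠ 0) {x : M}
    (hx : x ∈ C.proj '' U') {u : TangentSpace 𝓘(ℝ, CSq) x} (hu : ∀ v, g x u v = 0) : u = 0 := by
  obtain ⟨A, τ, hτ, hτU'⟩ := hC.exists_isAdaptedSection_eventually_mem hU' hx
  obtain ⟨hxs, hxU'⟩ := hτU'.self_of_nhds
  have hdet' : (hermMatrix hh (τ x)).det.re ≠ 0 := by
    rw [hsol.det_hermMatrix (hsub hxU'), Complex.ofReal_re]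
    exact hdet _ (hsub hxU')
  have hsolder : solderL A (chartDeriv x x u) = 0 := by
    refine eq_zero_of_metricForm_eq_zero hdet' fun w => ?_
    obtain ⟨w, rfl⟩ := (solderL_bijective hτ.mem).2 w
    rw [← chartDeriv_constField hxs w, ← hg.eq_metricForm hτ hxs hxU']
    exact hu _
  exact chartDeriv_injective hxs <| (solderL_bijective hτ.mem).1 <| by
    rw [hsolder, map_zero, map_zero]

theorem contMDiffAt (hUo : IsOpen U) (hdet : ∀ b ∈ U, hdet hh b ≠ 0)
    {v₀ : TangentBundle 𝓘(ℝ, CSq) M} (hv₀ : v₀.proj ∈ C.proj '' U') :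
    ContMDiffAt 𝓘(ℝ, CSq).tangent 𝓘(ℝ, ℝ) ∞
      (fun v : TangentBundle 𝓘(ℝ, CSq) M => g v.proj v.snd v.snd) v₀ := by
  obtain ⟨A, τ, hτ, hτU'⟩ := hC.exists_isAdaptedSection_eventually_mem hU' hv₀
  obtain ⟨hxs, hxU'⟩ := hτU'.self_of_nhds
  have hproj : ContMDiffAt 𝓘(ℝ, CSq).tangent 𝓘(ℝ, CSq) ∞
      (fun v : TangentBundle 𝓘(ℝ, CSq) M => v.proj) v₀ :=
    Bundle.contMDiff_proj (TangentSpace 𝓘(ℝ, CSq)) v₀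
  have hK : ContMDiffAt 𝓘(ℝ, CSq).tangent 𝓘(ℝ, Fin 2 → Fin 2 → ℂ) ∞
      (fun (v : TangentBundle 𝓘(ℝ, CSq) M) i j => hermMatrix hh (τ v.proj) i j) v₀ :=
    ContMDiffAt.comp (f := fun v : TangentBundle 𝓘(ℝ, CSq) M => v.proj)
      (g := fun p i j => hermMatrix hh (τ p) i j) v₀
      (hsol.contMDiffAt_hermMatrix_comp hUo hτ hxs (hsub hxU')) hproj
  have hsolder := contMDiffAt_solderL_chartDeriv_snd A v₀
  have hdet' : (hermMatrix hh (τ v₀.proj)).det.re ≠ 0 := by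
    rw [hsol.det_hermMatrix (hsub hxU'), Complex.ofReal_re]
    exact hdet _ (hsub hxU')
  have hmetric := ContMDiffAt.comp v₀ (f := fun v : TangentBundle 𝓘(ℝ, CSq) M =>
      (fun i j => hermMatrix hh (τ v.proj) i j, solderL A (chartDeriv v₀.proj v.proj v.snd),
        solderL A (chartDeriv v₀.proj v.proj v.snd)))
    (contDiffAt_metricForm (r := (fun i j => hermMatrix hh (τ v₀.proj) i j,
      solderL A (chartDeriv v₀.proj v₀.proj v₀.snd), solderL A (chartDeriv v₀.proj v₀.proj v₀.snd)))
      hdet').contMDiffAt (hK.prodMk_space (hsolder.prodMk_space hsolder))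
  refine hmetric.congr_of_eventuallyEq ?_
  filter_upwards [hproj.continuousAt.eventually hτU'] with v hv
  exact hg.eq_metricForm hτ hv.1 hv.2 v.snd v.snd

theorem isMetricOn (hUo : IsOpen U) (hdet : ∀ b ∈ U, hdet hh b ≠ 0) :
    IsMetricOn g (C.proj '' U') where
  smooth _ hv := (hg.contMDiffAt hC hsol hU' hsub hUo hdet hv).contMDiffWithinAt
  symm _ hx := hg.symm hC hsol hU' hsub hx
  nondegenerate _ hx _ := hg.eq_zero_of_forall_eq_zero hC hsol hU' hsub hdet hx

theorem exists_isMetricCovector [T2Space M] (hcov : IsComplexLinearOn cov univ) (hUo : IsOpen U)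
    (hdet : ∀ b ∈ U, hdet hh b ≠ 0) {x : M} (hx : x ∈ C.proj '' U') :
    ∃ a : M → CSq →L[ℝ] ℂ, ContMDiffAt 𝓘(ℝ, CSq) 𝓘(ℝ, CSq →L[ℝ] ℂ) ∞ a x ∧
      ∀ᶠ y in 𝓝 x, IsMetricCovector g cov y ((a y).comp (chartDeriv x y)) := by
  obtain ⟨A, τ, hτ, hτU'⟩ := hC.exists_isAdaptedSection_eventually_mem hU' hx
  obtain ⟨hxs, hxU'⟩ := hτU'.self_of_nhds
  refine ⟨leviCivitaCovector cov hh hv x A τ, hsol.contMDiffAt_leviCivitaCovector hUo hτ hcov hxs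
    (hsub hxU') (hdet _ (hsub hxU')), ?_⟩
  filter_upwards [hτU'.eventually_nhds] with y hy
  exact hsol.isMetricCovector hUo hτ hcov hy.self_of_nhds.1 (hsub hy.self_of_nhds.2)
    (hdet _ (hsub hy.self_of_nhds.2)) (hy.mono fun p hp => hg.eq_bform hτ hp.1 hp.2)

end IsPushforward

namespace IsGeometryOf

theorem descendsOn_of_bform_eq [T2Space M] (hcov : IsComplexLinearOn cov univ)
    (hC : C.IsGeometryOf cov) (hsol : C.IsHermitianSolutionOn hh hv U) (hUo : IsOpen U)
    (hdet : ∀ b ∈ U, hdet hh b ≠ 0) (hU' : IsOpen U') (hsub : U' ⊆ U)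
    (hinv : ∀ b ∈ U', ∀ b' ∈ U', C.proj b = C.proj b' → C.bform hh b = C.bform hh b') :
    C.DescendsOn cov hh U' := by
  obtain ⟨g, hg⟩ := exists_isPushforward hinv
  obtain ⟨hkahler, hcompatible⟩ := isPseudoKahlerOn_and_isCompatibleOn hcov
    (hC.isOpen_image_proj hU') (hg.isMetricOn hC hsol hU' hsub hUo hdet)
    (fun _ hx => hg.hermitian hC hU' hx)
    fun _ hx => hg.exists_isMetricCovector hC hsol hU' hsub hcov hUo hdet hx
  exact ⟨hC.isOpen_image_proj hU', g, hkahler, hcompatible, fun b hb w =>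
    (hC.quadForm_eq_bform hsol (hsub hb) w).trans
      (congrArg (fun L : CSq →L[ℝ] CSq →L[ℝ] ℝ => L _ _) (hg b hb)).symm⟩

theorem exists_bform_orbit_eq (hC : C.IsGeometryOf cov) (hsol : C.IsHermitianSolutionOn hh hv U)
    (hUo : IsOpen U) (hb : b ∈ U) : ∃ A τ, C.IsAdaptedSection cov (C.proj b) A τ ∧
      τ (C.proj b) = b ∧ ∃ S ∈ 𝓝 (C.proj b), S ⊆ (chartAt CSq (C.proj b)).source ∧
        ∃ T ∈ 𝓝 parOne, ∀ y ∈ S, ∀ q ∈ T,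
          C.orbit (τ y) q ∈ U ∧ C.bform hh (C.orbit (τ y) q) = C.bform hh (τ y) := by
  obtain ⟨A, τ, hτ, hτb⟩ := hC.exists_isAdaptedSection b
  have hx := mem_chart_source CSq (C.proj b)
  have hU : ∀ᶠ r in 𝓝 (C.proj b) ×ˢ 𝓝 parOne, C.orbit (τ r.1) r.2 ∈ U := by
    rw [← nhds_prod_eq]
    exact (hτ.map_orbit_nhds hx).le (hUo.mem_nhds (hτb.symm ▸ hb))
  obtain ⟨S, hS, T, hT, hST⟩ := eventually_prod_iff.1 hU
  have hT' : ∀ᶠ q in 𝓝 parOne, T q ∧ pdet q ≠ 0 :=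
    hT.and (continuous_pdet.continuousAt.eventually_ne (by simp))
  obtain ⟨ε, hε, hball⟩ := Metric.eventually_nhds_iff_ball.1 hT'
  refine ⟨A, τ, hτ, hτb, {y | S y} ∩ (chartAt CSq (C.proj b)).source,
    inter_mem hS ((chartAt CSq _).open_source.mem_nhds hx), inter_subset_right,
    Metric.ball parOne ε, Metric.ball_mem_nhds _ hε, fun y hy q hq => ?_⟩
  have hsegment (t : ℝ) (ht : t ∈ Icc (0 : ℝ) 1) :
      parOne + t • (q - parOne) ∈ Metric.ball parOne ε :=
    (convex_ball parOne ε).add_smul_sub_mem (Metric.mem_ball_self hε) hq ht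
  exact ⟨hST hy.1 (hball q hq).1, hC.bform_orbit hsol hUo fun t ht =>
    ⟨(hball _ (hsegment t ht)).2, hST hy.1 (hball _ (hsegment t ht)).1⟩⟩

theorem exists_isOpen_bform_eq (hC : C.IsGeometryOf cov) (hsol : C.IsHermitianSolutionOn hh hv U)
    (hUo : IsOpen U) (hb : b ∈ U) : ∃ U' : Set B, IsOpen U' ∧ b ∈ U' ∧ U' ⊆ U ∧
      ∀ b₁ ∈ U', ∀ b₂ ∈ U', C.proj b₁ = C.proj b₂ → C.bform hh b₁ = C.bform hh b₂ := by
  obtain ⟨A, τ, hτ, hτb, S, hS, hsource, T, hT, hST⟩ := hC.exists_bform_orbit_eq hsol hUo hb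
  have hN := image_mem_map (m := fun r : M × Par => C.orbit (τ r.1) r.2) (prod_mem_nhds hS hT)
  rw [hτ.map_orbit_nhds (mem_chart_source CSq (C.proj b)), hτb] at hN
  refine ⟨_, isOpen_interior, mem_interior_iff_mem_nhds.2 hN, ?_, ?_⟩
  · intro b' hb'
    obtain ⟨⟨y, q⟩, ⟨hy, hq⟩, rfl⟩ := interior_subset hb'
    exact (hST y hy q hq).1
  · intro b₁ hb₁ b₂ hb₂ hb₁₂
    obtain ⟨⟨y₁, q₁⟩, ⟨hy₁, hq₁⟩, rfl⟩ := interior_subset hb₁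
    obtain ⟨⟨y₂, q₂⟩, ⟨hy₂, hq₂⟩, rfl⟩ := interior_subset hb₂
    have hy₁₂ : y₁ = y₂ := by
      simpa only [orbit, C.proj_act, hτ.proj_eq _ (hsource hy₁), hτ.proj_eq _ (hsource hy₂)]
        using hb₁₂
    rw [(hST y₁ hy₁ q₁ hq₁).2, (hST y₂ hy₂ q₂ hq₂).2, hy₁₂]

theorem exists_descendsOn [T2Space M] (hcov : IsComplexLinearOn cov univ)
    (hC : C.IsGeometryOf cov) (hsol : C.IsHermitianSolutionOn hh hv U) (hUo : IsOpen U)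
    (hdet : ∀ b ∈ U, hdet hh b ≠ 0) (hb : b ∈ U) :
    ∃ U' : Set B, IsOpen U' ∧ b ∈ U' ∧ U' ⊆ U ∧ C.DescendsOn cov hh U' := by
  obtain ⟨U', hU', hbU', hsub, hinv⟩ := hC.exists_isOpen_bform_eq hsol hUo hb
  exact ⟨U', hU', hbU', hsub, hC.descendsOn_of_bform_eq hcov hsol hUo hdet hU' hsub hinv⟩

theorem descendsOn_of_isPreconnected [T2Space M] (hcov : IsComplexLinearOn cov univ)
    (hC : C.IsGeometryOf cov) (hsol : C.IsHermitianSolutionOn hh hv U) (hUo : IsOpen U)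
    (hdet : ∀ b ∈ U, hdet hh b ≠ 0) (hfib : ∀ x : M, IsPreconnected (U ∩ C.proj ⁻¹' {x})) :
    C.DescendsOn cov hh U := by
  refine hC.descendsOn_of_bform_eq hcov hsol hUo hdet hUo subset_rfl fun b hb b' hb' hbb' => ?_
  refine (hfib (C.proj b)).induction₂ (fun b₁ b₂ => C.bform hh b₁ = C.bform hh b₂) ?_
    (fun _ _ _ _ _ _ => Eq.trans) (fun _ _ _ _ => Eq.symm) ⟨hb, rfl⟩ ⟨hb', hbb'.symm⟩
  rintro b₁ ⟨hb₁, hx₁⟩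
  obtain ⟨U', hU', hbU', -, hinv⟩ := hC.exists_isOpen_bform_eq hsol hUo hb₁
  filter_upwards [mem_nhdsWithin_of_mem_nhds (hU'.mem_nhds hbU'), self_mem_nhdsWithin]
    with b₂ hb₂ hx₂
  exact hinv b₁ hbU' b₂ hb₂ (hx₁.trans hx₂.2.symm)

end IsGeometryOf

end CartanGeometry

end Descent

end CProj

end

theorem mainTheorem2_general
    {M : Type*} [TopologicalSpace M] [T2Space M] [ChartedSpace CProj.CSq M]
    [IsManifold 𝓘(ℂ, CProj.CSq) ω M]
    {F : Type*} [NormedAddCommGroup F] [NormedSpace ℝ F]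
    {B : Type*} [TopologicalSpace B] [ChartedSpace F B] [IsManifold 𝓘(ℝ, F) ∞ B]
    (cov : CProj.Conn M) (hcov : CProj.IsComplexLinearOn cov Set.univ)
    (C : CProj.CartanGeometry M (F := F) B) (hC : C.IsGeometryOf cov)
    (U : Set B) (hUo : IsOpen U)
    (hh : Fin 2 → Fin 2 → B → ℂ) (hv : Fin 2 → B → ℂ)
    (hsol : C.IsHermitianSolutionOn hh hv U)
    (hdet : ∀ b ∈ U, CProj.CartanGeometry.hdet hh b ≠ 0) :
    (∀ b ∈ U, ∃ U' : Set B, IsOpen U' ∧ b ∈ U' ∧ U' ⊆ U ∧ C.DescendsOn cov hh U') ∧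
    ((∀ x : M, IsPreconnected (U ∩ C.proj ⁻¹' {x})) → C.DescendsOn cov hh U) :=
  ⟨fun _ hb => hC.exists_descendsOn hcov hsol hUo hdet hb,
    hC.descendsOn_of_isPreconnected hcov hsol hUo hdet⟩

theorem mainTheorem2
    {M : Type*} [TopologicalSpace M] [T2Space M] [ChartedSpace CProj.CSq M]
    [IsManifold 𝓘(ℂ, CProj.CSq) ω M]
    {F : Type*} [NormedAddCommGroup F] [NormedSpace ℝ F] [FiniteDimensional ℝ F]
    {B : Type*} [TopologicalSpace B] [ChartedSpace F B] [IsManifold 𝓘(ℝ, F) ∞ B]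
    (cov : CProj.Conn M) (hcov : CProj.IsComplexLinearOn cov Set.univ)
    (C : CProj.CartanGeometry M (F := F) B) (hC : C.IsGeometryOf cov)
    (U : Set B) (hUo : IsOpen U) (hUc : IsConnected U)
    (hh : Fin 2 → Fin 2 → B → ℂ) (hv : Fin 2 → B → ℂ) (h : B → ℝ)
    (hsol : C.IsSolutionOn hh hv h U)
    (hdet : ∀ b ∈ U, CProj.CartanGeometry.hdet hh b ≠ 0) :
    (∀ b ∈ U, ∃ U' : Set B, IsOpen U' ∧ b ∈ U' ∧ U' ⊆ U ∧ C.DescendsOn cov hh U') ∧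
    ((∀ x : M, IsPreconnected (U ∩ C.proj ⁻¹' {x})) → C.DescendsOn cov hh U) :=
  mainTheorem2_general cov hcov C hC U hUo hh hv hsol.isHermitianSolutionOn hdet
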